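/- Let $\mathbb F$ be an infinite field. For $n\ge 1$ let $T(\mathbb F^n)$ be the Tits building (the nerve of the poset of proper non-zero subspaces of $\mathbb F^n$), let $\mathrm{St}(\mathbb F^n)=\tilde H_{n-2}(T(\mathbb F^n);\mathbb Z)$ be the Steinberg module, viewed as the group of top-dimensional cycles in the free abelian group on complete flags of $\mathbb F^n$, and put $\mathrm{St}^2(\mathbb F^n)=\mathrm{St}(\mathbb F^n)\otimes_{\mathbb Z}\mathrm{St}(\mathbb F^n)$ with the diagonal $\mathrm{GL}_n(\mathbb F)$-action. Let $\langle-,-\rangle$ be the restriction to $\mathrm{St}(\mathbb F^n)$ of the bilinear form for which complete flags are orthonormal. For flags $A=(0=A_0<\dots<A_m=\mathbb F^m)$ and $B=(0=B_0<\dots<B_n=\mathbb F^n)$ let $A\cdot B=\sum_{(\mu,\nu)}\mathrm{sign}(\mu,\nu)\,\bigl(A_{i(k)}\oplus B_{j(k)}\bigr)_{0\le k\le m+n}$, the sum being over all $(m,n)$-shuffles $(\mu,\nu)$ of $\{0,\dots,m+n-1\}$, where $i(k)$, $j(k)$ are the numbers of elements less than $k$ of $\mu$ and of $\nu$; this induces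 a product $\mathrm{St}(\mathbb F^m)\otimes\mathrm{St}(\mathbb F^n)\to\mathrm{St}(\mathbb F^{m+n})$. Its tensor square, with the Koszul sign, $(a\otimes b)\cdot(a'\otimes b')=(-1)^{mn}(a\cdot a')\otimes(b\cdot b')$ for $a,b\in\mathrm{St}(\mathbb F^m)$ and $a',b'\in\mathrm{St}(\mathbb F^n)$, induces bilinear products on coinvariants $$\mathrm{St}^2(\mathbb F^m)_{\mathrm{GL}_m(\mathbb F)}\otimes\mathrm{St}^2(\mathbb F^n)_{\mathrm{GL}_n(\mathbb F)}\to\mathrm{St}^2(\mathbb F^{m+n})_{\mathrm{GL}_{m+n}(\mathbb F)},$$ and hence a product on $R=\mathbb Z1\oplus\bigoplus_{n\ge1}\mathrm{St}^2(\mathbb F^n)_{\mathrm{GL}_n(\mathbb F)}$ with unit $1$. For a commutative ring $k$ put $\mathrm{St}^2_k(\mathbb F^n)=k\otimes_{\mathbb Z}\mathrm{St}^2(\mathbb F^n)$ and $R_k=k1\oplus\bigoplus_{n\ge1}\mathrm{St}^2_k(\mathbb F^n)_{\mathrm{GL}_n(\mathbb F)}$, with the $k$-bilinear extension of the product. Then: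 (1) For every $n\ge1$ the form $\langle-,-\rangle$ induces an isomorphism $\mathrm{St}^2(\mathbb F^n)_{\mathrm{GL}_n(\mathbb F)}\cong\mathbb Z$. Let $\gamma_n$ be the element corresponding to $(-1)^{n(n-1)/2}$. (2) $R$ is an associative commutative ring, and there is a ring isomorphism from the divided power algebra $\Gamma_{\mathbb Z}[x]$ on one generator to $R$ which sends the $n$-th divided power $\gamma_n(x)$ to $\gamma_n$ for every $n\ge1$. (3) For every commutative ring $k$, $R_k$ is an associative commutative $k$-algebra, and there is an isomorphism of $k$-algebras $\Gamma_k[x]\cong R_k$ which sends $\gamma_n(x)$ to the image of $\gamma_n$ for every $n\ge1$. -/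

import Mathlib

open scoped TensorProduct DirectSum

noncomputable section

namespace Steinberg

section Building

variable (F : Type*) [Field F] (V : Type*) [AddCommGroup V] [Module F V]

/-- The Tits building: the poset of proper non-zero linear subspaces, ordered by inclusion. -/
abbrev TitsBuilding : Type _ := {W : Submodule F V // W ≠ ⊥ ∧ W ≠ ⊤}

/-- The non-degenerate `(q-1)`-simplices of the nerve of the Tits building: strict chains
`W₀ < ⋯ < W_{q-1}` of `q` proper non-zero subspaces. For `q = 0` there is exactly one (the empty
simplex, which accounts for the augmentation). -/
abbrev Simplices (q : ℕ) : Type _ := Fin q ↪o TitsBuilding F V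

/-- The augmented simplicial chains of degree `q - 1` of the Tits building, with coefficients in
`ℤ`. -/
abbrev Chains (q : ℕ) : Type _ := Simplices F V q →₀ ℤ

instance instModuleChains (q : ℕ) : Module ℤ (Chains F V q) := Finsupp.module _ _

/-- The order embedding of `Fin (q - 1)` into `Fin q` whose image omits exactly `j`. -/
def skip {q : ℕ} (j : Fin q) : Fin (q - 1) ↪o Fin q :=
  OrderEmbedding.ofStrictMono
    (fun i => if i.1 < j.1 then ⟨i.1, by omega⟩ else ⟨i.1 + 1, by omega⟩) (by
      intro i i' h
      have h' : i.1 < i'.1 := h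
      rw [Fin.lt_def]
      dsimp only
      split_ifs <;> simp <;> omega)

variable {F V}

/-- The `j`-th face: delete the `j`-th subspace of a chain. -/
def face {q : ℕ} (j : Fin q) (s : Simplices F V q) : Simplices F V (q - 1) :=
  (skip j).trans s

variable (F V)

/-- The boundary map `∑ j, (-1) ^ j d_j` of the augmented simplicial chain complex. -/
def boundary (q : ℕ) : Chains F V q →ₗ[ℤ] Chains F V (q - 1) :=
  ∑ j : Fin q, (-1 : ℤ) ^ (j : ℕ) • Finsupp.lmapDomain ℤ ℤ (face j)

/-- Cycles of degree `q - 1` in the augmented simplicial chain complex of the Tits building. -/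
abbrev Cycles (q : ℕ) : Submodule ℤ (Chains F V q) := LinearMap.ker (boundary F V q)

instance instModuleCycles (q : ℕ) : Module ℤ (Cycles F V q) := Submodule.module _

end Building

/-- The Steinberg module `St(F^(n+1))`: the top reduced homology `H̃_{n-1}(T(F^(n+1)); ℤ)` of the
Tits building (the index is the dimension minus one, so all dimensions `≥ 1` occur). There are no
simplices of dimension `n` in the building, see `isEmpty_simplices`, so this homology group is the
group of cycles of degree `n - 1`, a subgroup of the free abelian group on complete flags. -/
def St (F : Type*) [Field F] (n : ℕ) : Type _ := Cycles F (Fin (n + 1) → F) n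

instance (F : Type*) [Field F] (n : ℕ) : AddCommGroup (St F n) :=
  inferInstanceAs (AddCommGroup (Cycles F (Fin (n + 1) → F) n))

instance (F : Type*) [Field F] (n : ℕ) : Module ℤ (St F n) :=
  inferInstanceAs (Module ℤ (Cycles F (Fin (n + 1) → F) n))

section Basic

variable {F : Type*} [Field F] {V : Type*} [AddCommGroup V] [Module F V]

theorem face_apply_lt {q : ℕ} (j : Fin q) (s : Simplices F V q) (i : Fin (q - 1))
    (h : i.1 < j.1) : face j s i = s ⟨i.1, by omega⟩ :=
  congrArg s (if_pos h)

theorem face_apply_ge {q : ℕ} (j : Fin q) (s : Simplices F V q) (i : Fin (q - 1))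
    (h : ¬ i.1 < j.1) : face j s i = s ⟨i.1 + 1, by omega⟩ :=
  congrArg s (if_neg h)

theorem finrank_ge [FiniteDimensional F V] {q : ℕ} (s : Simplices F V q) :
    ∀ (i : ℕ) (h : i < q), i + 1 ≤ Module.finrank F (s ⟨i, h⟩).1 := by
  intro i
  induction i with
  | zero =>
    intro h
    have := (s ⟨0, h⟩).2.1
    have h2 : Module.finrank F (s ⟨0, h⟩).1 ≠ 0 := fun h0 => this (Submodule.finrank_eq_zero.1 h0)
    omega
  | succ i ih =>
    intro h
    have h1 := ih (by omega)
    have h2 : (s ⟨i, by omega⟩).1 < (s ⟨i + 1, h⟩).1 := by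
      apply s.strictMono
      simp [Fin.lt_def]
    have := Submodule.finrank_lt_finrank_of_lt h2
    omega

theorem isEmpty_simplices [FiniteDimensional F V] {q : ℕ} (hq : q + 1 = Module.finrank F V) :
    IsEmpty (Simplices F V (q + 1)) := by
  refine ⟨fun s => ?_⟩
  have h1 := finrank_ge s q (by omega)
  have h2 := Submodule.finrank_lt (s ⟨q, by omega⟩).2.2
  omega

theorem finrank_le [FiniteDimensional F V] {q : ℕ} (hq : Module.finrank F V = q + 1)
    (s : Simplices F V q) :
    ∀ (i : ℕ) (h : i < q), Module.finrank F (s ⟨q - 1 - i, by omega⟩).1 + i ≤ q := by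
  intro i
  induction i with
  | zero =>
    intro h
    have := Submodule.finrank_lt (s ⟨q - 1 - 0, by omega⟩).2.2
    omega
  | succ i ih =>
    intro h
    have h1 := ih (by omega)
    have h2 : (s ⟨q - 1 - (i + 1), by omega⟩).1 < (s ⟨q - 1 - i, by omega⟩).1 := by
      apply s.strictMono
      simp [Fin.lt_def]
      omega
    have := Submodule.finrank_lt_finrank_of_lt h2
    omega

theorem finrank_eq [FiniteDimensional F V] {q : ℕ} (hq : Module.finrank F V = q + 1)
    (s : Simplices F V q) (i : Fin q) : Module.finrank F (s i).1 = i.1 + 1 := by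
  have h1 := finrank_ge s i.1 i.2
  have h2 := finrank_le hq s (q - 1 - i.1) (by omega)
  have h3 : (⟨q - 1 - (q - 1 - i.1), by omega⟩ : Fin q) = i := by
    ext; simp; omega
  rw [h3] at h2
  have h4 : (⟨i.1, i.2⟩ : Fin q) = i := rfl
  rw [h4] at h1
  omega

/-- In the top degree distinct faces never agree. -/
theorem face_index_eq [FiniteDimensional F V] {q : ℕ} (hq : Module.finrank F V = q + 1)
    {j k : Fin q} {s t : Simplices F V q} (h : face j s = face k t) : j = k := by
  by_contra hne
  wlog hlt : j.1 < k.1 generalizing j k s t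
  · exact this h.symm (Ne.symm hne) (by
      have : j.1 ≠ k.1 := fun h => hne (Fin.ext h)
      omega)
  have e : face j s ⟨j.1, by omega⟩ = face k t ⟨j.1, by omega⟩ := by rw [h]
  rw [face_apply_ge j s _ (by simp), face_apply_lt k t _ (by simpa using hlt)] at e
  have h1 := finrank_eq hq s ⟨j.1 + 1, by omega⟩
  have h2 := finrank_eq hq t ⟨j.1, by omega⟩
  simp only at e h1 h2
  rw [e] at h1
  omega

/-- Each face of a top-dimensional cycle vanishes. -/
theorem face_eq_zero [FiniteDimensional F V] {q : ℕ} (hq : Module.finrank F V = q + 1)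
    {x : Chains F V q} (hx : x ∈ Cycles F V q) (j : Fin q) :
    Finsupp.mapDomain (face j) x = 0 := by
  ext H
  by_cases hH : H ∈ Set.range (face (F := F) (V := V) j)
  · obtain ⟨s, rfl⟩ := hH
    have h : boundary F V q x (face j s) = 0 := by
      rw [LinearMap.mem_ker.1 hx]; rfl
    simp only [boundary, LinearMap.sum_apply, LinearMap.smul_apply, Finsupp.lmapDomain_apply,
      Finsupp.finsetSum_apply, Finsupp.smul_apply] at h
    rw [Finset.sum_eq_single j] at h
    · simpa using h
    · intro k _ hk
      rw [Finsupp.mapDomain_of_notMem_range, smul_zero]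
      rintro ⟨t, ht⟩
      exact hk (face_index_eq hq ht)
    · simp
  · rw [Finsupp.mapDomain_of_notMem_range _ _ hH]; rfl

theorem mem_cycles_of_face {q : ℕ} {x : Chains F V q}
    (h : ∀ j, Finsupp.mapDomain (face j) x = 0) : x ∈ Cycles F V q := by
  rw [LinearMap.mem_ker]
  simp [boundary, LinearMap.sum_apply, h]

theorem linearCombination_eq_zero [FiniteDimensional F V] {q : ℕ}
    (hq : Module.finrank F V = q + 1) {x : Chains F V q} (hx : x ∈ Cycles F V q) (j : Fin q)
    {M : Type*} [AddCommGroup M] (φ : Simplices F V q → M)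
    (hφ : ∀ s t, face j s = face j t → φ s = φ t) : Finsupp.linearCombination ℤ φ x = 0 := by
  have h : φ = Function.extend (face j) φ 0 ∘ face j := by
    funext s
    exact (Function.FactorsThrough.extend_apply (fun a b hab => hφ a b hab) 0 s).symm
  rw [h, ← Finsupp.linearCombination_mapDomain, face_eq_zero hq hx j, map_zero]

end Basic

section Functoriality

variable {F : Type*} [Field F] {V W X : Type*} [AddCommGroup V] [Module F V]
  [AddCommGroup W] [Module F W] [AddCommGroup X] [Module F X]

/-- A linear isomorphism sends subspaces to their images. -/
def mapBuilding (e : V ≃ₗ[F] W) : TitsBuilding F V ↪o TitsBuilding F W where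
  toFun U := ⟨U.1.map (e : V →ₗ[F] W),
    fun h => U.2.1 ((Submodule.map_eq_bot_iff (e := e)).1 h), fun h => U.2.2 (by
      have h2 := congrArg (Submodule.comap (e : V →ₗ[F] W)) h
      rwa [Submodule.comap_map_eq_of_injective e.injective, Submodule.comap_top] at h2)⟩
  inj' U U' h := Subtype.ext
    (Submodule.map_injective_of_injective (f := (e : V →ₗ[F] W)) e.injective
      (congrArg Subtype.val h))
  map_rel_iff' {U U'} := Submodule.map_le_map_iff_of_injective (f := (e : V →ₗ[F] W)) e.injective
    U.1 U'.1

/-- The induced map on simplices. -/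
def mapSimplex (e : V ≃ₗ[F] W) {q : ℕ} (s : Simplices F V q) : Simplices F W q :=
  s.trans (mapBuilding e)

theorem mapSimplex_apply (e : V ≃ₗ[F] W) {q : ℕ} (s : Simplices F V q) (i : Fin q) :
    (mapSimplex e s i).1 = (s i).1.map (e : V →ₗ[F] W) := rfl

theorem mapSimplex_refl {q : ℕ} (s : Simplices F V q) :
    mapSimplex (LinearEquiv.refl F V) s = s := by
  ext i : 2
  rw [mapSimplex_apply]
  exact Submodule.map_id _

theorem mapSimplex_trans (e : V ≃ₗ[F] W) (f : W ≃ₗ[F] X) {q : ℕ} (s : Simplices F V q) :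
    mapSimplex (e.trans f) s = mapSimplex f (mapSimplex e s) := by
  ext i : 2
  simp only [mapSimplex_apply]
  exact Submodule.map_comp _ _ _

/-- The induced map on chains. -/
def mapChains (e : V ≃ₗ[F] W) (q : ℕ) : Chains F V q →ₗ[ℤ] Chains F W q :=
  Finsupp.lmapDomain ℤ ℤ (mapSimplex e)

theorem mapChains_mem (e : V ≃ₗ[F] W) (q : ℕ) (x : Chains F V q) (hx : x ∈ Cycles F V q) :
    mapChains e q x ∈ Cycles F W q := by
  have h : boundary F W q (mapChains e q x) = mapChains e (q - 1) (boundary F V q x) := by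
    simp only [boundary, LinearMap.sum_apply, LinearMap.smul_apply, map_sum, map_smul, mapChains,
      Finsupp.lmapDomain_apply, ← Finsupp.mapDomain_comp]
    rfl
  rw [LinearMap.mem_ker, h, LinearMap.mem_ker.1 hx, map_zero]

/-- The induced map on cycles. -/
def mapCycles (e : V ≃ₗ[F] W) (q : ℕ) : Cycles F V q →ₗ[ℤ] Cycles F W q :=
  (mapChains e q).restrict (mapChains_mem e q)

theorem mapChains_refl (q : ℕ) (x : Chains F V q) :
    mapChains (LinearEquiv.refl F V) q x = x := by
  have h : mapSimplex (LinearEquiv.refl F V) = (id : Simplices F V q → _) :=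
    funext mapSimplex_refl
  simp [mapChains, h]

theorem mapChains_trans (e : V ≃ₗ[F] W) (f : W ≃ₗ[F] X) (q : ℕ) (x : Chains F V q) :
    mapChains (e.trans f) q x = mapChains f q (mapChains e q x) := by
  have h : mapSimplex (e.trans f) = mapSimplex f ∘ mapSimplex (q := q) e :=
    funext (mapSimplex_trans e f)
  simp [mapChains, h, Finsupp.mapDomain_comp]

end Functoriality

section Pairing

variable {F : Type*} [Field F] {V : Type*} [AddCommGroup V] [Module F V]

variable (F V) in
/-- The bilinear form on chains for which the simplices form an orthonormal basis. -/
def chainPairing (q : ℕ) : Chains F V q →ₗ[ℤ] Chains F V q →ₗ[ℤ] ℤ :=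
  Finsupp.linearCombination ℤ (fun s => (Finsupp.lapply s : Chains F V q →ₗ[ℤ] ℤ))

theorem mapSimplex_injective (e : V ≃ₗ[F] V) (q : ℕ) :
    Function.Injective (mapSimplex e : Simplices F V q → Simplices F V q) := by
  intro s t h
  ext i : 1
  exact (mapBuilding e).injective (DFunLike.congr_fun h i)

theorem chainPairing_map (e : V ≃ₗ[F] V) (q : ℕ) (x y : Chains F V q) :
    chainPairing F V q (mapChains e q x) (mapChains e q y) = chainPairing F V q x y := by
  induction x using Finsupp.induction_linear with
  | zero => simp
  | add f g hf hg => simp only [map_add, LinearMap.add_apply, hf, hg]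
  | single s r =>
    simp [chainPairing, mapChains, Finsupp.mapDomain_apply (mapSimplex_injective e q)]

end Pairing

section Shuffle

/-- `(m, n)`-shuffles `(μ, ν)`, recorded by the set `μ` of `m` elements of `{0, …, m+n-1}`; the
set `ν` is its complement. -/
abbrev Shuffle (m n : ℕ) : Type := {S : Finset (Fin (m + n)) // S.card = m}

/-- The sign of a shuffle, `(-1) ^ ∑ (μ_i - (i - 1))` where `μ_1 < ⋯ < μ_m`. -/
def Shuffle.sign {m n : ℕ} (S : Shuffle m n) : ℤ :=
  (-1) ^ (∑ i ∈ S.1, (i : ℕ)) * (-1) ^ (∑ i ∈ Finset.range m, i)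

/-- The number of elements of `μ` below `k`. -/
def Shuffle.left {m n : ℕ} (S : Shuffle m n) (k : ℕ) : ℕ :=
  (S.1.filter (fun i : Fin _ => i.1 < k)).card

/-- The number of elements of `ν` below `k`. -/
def Shuffle.right {m n : ℕ} (S : Shuffle m n) (k : ℕ) : ℕ :=
  (S.1ᶜ.filter (fun i : Fin _ => i.1 < k)).card

variable {m n : ℕ} (S : Shuffle m n)

theorem Shuffle.left_le (k : ℕ) : S.left k ≤ m :=
  (Finset.card_filter_le _ _).trans S.2.le

theorem Shuffle.right_le (k : ℕ) : S.right k ≤ n := by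
  refine (Finset.card_filter_le _ _).trans ?_
  rw [Finset.card_compl, S.2, Fintype.card_fin]
  omega

theorem Shuffle.left_mono {k l : ℕ} (h : k ≤ l) : S.left k ≤ S.left l :=
  Finset.card_le_card (Finset.monotone_filter_right _ (fun _ _ hi => lt_of_lt_of_le hi h))

theorem Shuffle.right_mono {k l : ℕ} (h : k ≤ l) : S.right k ≤ S.right l :=
  Finset.card_le_card (Finset.monotone_filter_right _ (fun _ _ hi => lt_of_lt_of_le hi h))

theorem card_filter_succ {N : ℕ} (T : Finset (Fin N)) (k : ℕ) (hk : k < N) :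
    (T.filter (fun i : Fin _ => i.1 < k + 1)).card =
      (T.filter (fun i : Fin _ => i.1 < k)).card + if (⟨k, hk⟩ : Fin N) ∈ T then 1 else 0 := by
  have h : T.filter (fun i : Fin _ => i.1 < k + 1) =
      T.filter (fun i : Fin _ => i.1 < k) ∪ T.filter (fun i : Fin N => i = ⟨k, hk⟩) := by
    ext i
    simp only [Finset.mem_filter, Finset.mem_union, Fin.ext_iff, ← and_or_left]
    exact and_congr_right fun _ => by omega
  rw [h, Finset.card_union_of_disjoint]
  · rw [Finset.filter_eq']
    split_ifs <;> simp
  · rw [Finset.disjoint_left]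
    intro i hi hi'
    have h1 := (Finset.mem_filter.1 hi).2
    have h2 := (Finset.mem_filter.1 hi').2
    simp [h2] at h1

theorem Shuffle.left_succ (k : ℕ) (hk : k < m + n) :
    S.left (k + 1) = S.left k + if (⟨k, hk⟩ : Fin (m + n)) ∈ S.1 then 1 else 0 :=
  card_filter_succ _ _ _

theorem Shuffle.right_succ (k : ℕ) (hk : k < m + n) :
    S.right (k + 1) = S.right k + if (⟨k, hk⟩ : Fin (m + n)) ∈ S.1 then 0 else 1 := by
  have := card_filter_succ S.1ᶜ k hk
  rw [Shuffle.right, this, Shuffle.right]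
  congr 1
  by_cases h : (⟨k, hk⟩ : Fin (m + n)) ∈ S.1 <;> simp [h]

theorem Shuffle.left_add_right (k : ℕ) (hk : k ≤ m + n) : S.left k + S.right k = k := by
  induction k with
  | zero => simp [Shuffle.left, Shuffle.right]
  | succ k ih =>
    rw [S.left_succ k (by omega), S.right_succ k (by omega)]
    have := ih (by omega)
    split_ifs <;> omega

/-- Permute the positions of a shuffle by exchanging two of them. -/
def Shuffle.swap (a b : Fin (m + n)) : Shuffle m n :=
  ⟨S.1.map (Equiv.swap a b).toEmbedding, by rw [Finset.card_map, S.2]⟩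

theorem Shuffle.mem_swap (a b i : Fin (m + n)) :
    i ∈ (S.swap a b).1 ↔ Equiv.swap a b i ∈ S.1 := by
  simp only [Shuffle.swap, Finset.mem_map_equiv, Equiv.symm_swap]

theorem Shuffle.swap_swap (a b : Fin (m + n)) : (S.swap a b).swap a b = S := by
  apply Subtype.ext
  ext i
  rw [Shuffle.mem_swap, Shuffle.mem_swap, Equiv.swap_apply_self]

end Shuffle

section Product

variable {F : Type*} [Field F] {V W V' W' : Type*} [AddCommGroup V] [Module F V]
  [AddCommGroup W] [Module F W] [AddCommGroup V'] [Module F V'] [AddCommGroup W'] [Module F W']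

/-- A chain `W₀ < ⋯ < W_{q-1}` of proper non-zero subspaces, extended by `0` on the left and by
the whole space on the right: `0 < W₀ < ⋯ < W_{q-1} < V`. -/
def flag {q : ℕ} (s : Simplices F V q) : ℕ → Submodule F V
  | 0 => ⊥
  | i + 1 => if h : i < q then (s ⟨i, h⟩).1 else ⊤

theorem flag_lt {q : ℕ} (s : Simplices F V q) (hV : (⊥ : Submodule F V) ≠ ⊤) {i j : ℕ}
    (hij : i < j) (hi : i ≤ q) : flag s i < flag s j := by
  obtain ⟨j, rfl⟩ : ∃ l, j = l + 1 := ⟨j - 1, by omega⟩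
  rcases i with _ | i
  · simp only [flag]
    split_ifs with h
    · exact bot_lt_iff_ne_bot.2 (s ⟨j, h⟩).2.1
    · exact bot_lt_iff_ne_bot.2 hV.symm
  · simp only [flag]
    rw [dif_pos (by omega)]
    split_ifs with h
    · exact s.strictMono (by simp [Fin.lt_def]; omega)
    · exact lt_top_iff_ne_top.2 (s ⟨i, by omega⟩).2.2

theorem flag_le {q : ℕ} (s : Simplices F V q) (hV : (⊥ : Submodule F V) ≠ ⊤) {i j : ℕ}
    (hij : i ≤ j) (hj : j ≤ q + 1) : flag s i ≤ flag s j := by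
  rcases hij.eq_or_lt with rfl | h
  · exact le_rfl
  · exact (flag_lt s hV h (by omega)).le

theorem flag_last {q : ℕ} (s : Simplices F V q) : flag s (q + 1) = ⊤ := by simp [flag]

theorem prod_lt_prod {P P' : Submodule F V} {Q Q' : Submodule F W} (hP : P ≤ P') (hQ : Q ≤ Q')
    (h : P < P' ∨ Q < Q') : P.prod Q < P'.prod Q' := by
  refine lt_of_le_of_ne (Submodule.prod_mono hP hQ) fun heq => ?_
  rcases h with h | h
  · refine h.not_ge fun x hx => ?_
    have : ((x, 0) : V × W) ∈ P.prod Q := by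
      rw [heq]; exact ⟨hx, Q'.zero_mem⟩
    exact this.1
  · refine h.not_ge fun x hx => ?_
    have : ((0, x) : V × W) ∈ P.prod Q := by
      rw [heq]; exact ⟨P'.zero_mem, hx⟩
    exact this.2

theorem shuffle_flag_lt {a b : ℕ} (hV : (⊥ : Submodule F V) ≠ ⊤) (hW : (⊥ : Submodule F W) ≠ ⊤)
    (S : Shuffle (a + 1) (b + 1)) (s : Simplices F V a) (t : Simplices F W b) {k l : ℕ}
    (h : k < l) (hl : l ≤ a + 1 + (b + 1)) :
    (flag s (S.left k)).prod (flag t (S.right k)) <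
      (flag s (S.left l)).prod (flag t (S.right l)) := by
  have h1 := S.left_mono h.le
  have h2 := S.right_mono h.le
  have h3 := S.left_add_right k (by omega)
  have h4 := S.left_add_right l hl
  have h5 := S.left_le l
  have h6 := S.right_le l
  refine prod_lt_prod (flag_le s hV h1 h5) (flag_le t hW h2 h6) ?_
  by_cases h7 : S.left k < S.left l
  · exact Or.inl (flag_lt s hV h7 (by omega))
  · exact Or.inr (flag_lt t hW (by omega) (by omega))

/-- The simplex of the building of `V × W` obtained from complete flags
`0 = A₀ < ⋯ < A_{a+1} = V` and `0 = B₀ < ⋯ < B_{b+1} = W` and a shuffle `(μ, ν)`: the chain whose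
`k`-th term (`0 ≤ k ≤ a + b + 2`) is `A_i ⊕ B_j` with `i` and `j` the numbers of elements below `k`
of `μ` and of `ν`, where the terms `0` and `V × W` for `k = 0` and `k = a + b + 2` are left out. -/
def mulSimplex {a b : ℕ} (hV : (⊥ : Submodule F V) ≠ ⊤) (hW : (⊥ : Submodule F W) ≠ ⊤)
    (S : Shuffle (a + 1) (b + 1)) (s : Simplices F V a) (t : Simplices F W b) :
    Simplices F (V × W) (a + 1 + b) :=
  OrderEmbedding.ofStrictMono
    (fun k => ⟨(flag s (S.left (k.1 + 1))).prod (flag t (S.right (k.1 + 1))),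
      (bot_le.trans_lt (shuffle_flag_lt hV hW S s t (Nat.succ_pos k.1) (by omega))).ne',
      ((shuffle_flag_lt hV hW S s t (l := a + 1 + (b + 1)) (k := k.1 + 1)
        (by omega) le_rfl).trans_le le_top).ne⟩)
    (fun _ _ h => shuffle_flag_lt hV hW S s t (Nat.succ_lt_succ h) (by omega))

theorem mulSimplex_apply {a b : ℕ} (hV : (⊥ : Submodule F V) ≠ ⊤) (hW : (⊥ : Submodule F W) ≠ ⊤)
    (S : Shuffle (a + 1) (b + 1)) (s : Simplices F V a) (t : Simplices F W b)
    (k : Fin (a + 1 + b)) : (mulSimplex hV hW S s t k).1 =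
      (flag s (S.left (k.1 + 1))).prod (flag t (S.right (k.1 + 1))) := rfl

/-- The shuffle (Eilenberg–Zilber) product of chains on complete flags. -/
def mulChains {a b : ℕ} (hV : (⊥ : Submodule F V) ≠ ⊤) (hW : (⊥ : Submodule F W) ≠ ⊤) :
    Chains F V a →ₗ[ℤ] Chains F W b →ₗ[ℤ] Chains F (V × W) (a + 1 + b) :=
  Finsupp.linearCombination ℤ fun s => Finsupp.linearCombination ℤ fun t =>
    ∑ S : Shuffle (a + 1) (b + 1), Finsupp.single (mulSimplex hV hW S s t) S.sign

theorem mulChains_single {a b : ℕ} (hV : (⊥ : Submodule F V) ≠ ⊤) (hW : (⊥ : Submodule F W) ≠ ⊤)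
    (s : Simplices F V a) (t : Simplices F W b) (p r : ℤ) :
    mulChains hV hW (Finsupp.single s p) (Finsupp.single t r) = (p * r) •
      ∑ S : Shuffle (a + 1) (b + 1), Finsupp.single (mulSimplex hV hW S s t) S.sign := by
  simp [mulChains, mul_smul]

theorem flag_eq_of_face_eq {q : ℕ} {i : Fin q} {s t : Simplices F V q} (h : face i s = face i t)
    {c : ℕ} (hc : c ≠ i.1 + 1) : flag s c = flag t c := by
  rcases c with _ | c
  · rfl
  · simp only [flag]
    split_ifs with hq
    · by_cases hci : c < i.1
      · have := DFunLike.congr_fun h ⟨c, by omega⟩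
        rw [face_apply_lt _ _ _ (by simpa using hci),
          face_apply_lt _ _ _ (by simpa using hci)] at this
        exact congrArg Subtype.val this
      · obtain ⟨d, rfl⟩ : ∃ d, c = d + 1 := ⟨c - 1, by omega⟩
        have := DFunLike.congr_fun h ⟨d, by omega⟩
        rw [face_apply_ge _ _ _ (by simp; omega),
          face_apply_ge _ _ _ (by simp; omega)] at this
        exact congrArg Subtype.val this
    · rfl

theorem face_eq_of_forall {q : ℕ} {j : Fin q} {s t : Simplices F V q}
    (h : ∀ k, k ≠ j → (s k).1 = (t k).1) : face j s = face j t := by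
  ext i : 2
  by_cases hi : i.1 < j.1
  · rw [face_apply_lt _ _ _ hi, face_apply_lt _ _ _ hi]
    exact h _ (fun e => by have := congrArg Fin.val e; simp at this; omega)
  · rw [face_apply_ge _ _ _ hi, face_apply_ge _ _ _ hi]
    exact h _ (fun e => by have := congrArg Fin.val e; simp at this; omega)

theorem Shuffle.sign_swap {m n : ℕ} (S : Shuffle m n) (k : ℕ) (hk : k + 1 < m + n)
    (h1 : (⟨k, by omega⟩ : Fin (m + n)) ∈ S.1) (h2 : (⟨k + 1, hk⟩ : Fin (m + n)) ∉ S.1) :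
    (S.swap ⟨k, by omega⟩ ⟨k + 1, hk⟩).sign = - S.sign := by
  have h : ∑ i ∈ (S.swap ⟨k, by omega⟩ ⟨k + 1, hk⟩).1, (i : ℕ) = (∑ i ∈ S.1, (i : ℕ)) + 1 := by
    rw [Shuffle.swap]
    simp only [Finset.sum_map, Equiv.coe_toEmbedding]
    rw [← Finset.add_sum_erase _ _ h1, ← Finset.add_sum_erase S.1 _ h1, Equiv.swap_apply_left,
      Finset.sum_congr rfl (g := fun i : Fin (m + n) => (i : ℕ))]
    · simp only; omega
    · intro i hi
      rw [Equiv.swap_apply_of_ne_of_ne (Finset.ne_of_mem_erase hi)]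
      rintro rfl
      exact h2 (Finset.mem_of_mem_erase hi)
  rw [Shuffle.sign, h, Shuffle.sign]
  ring

theorem Shuffle.sign_swap' {m n : ℕ} (S : Shuffle m n) (k : ℕ) (hk : k + 1 < m + n)
    (h : ¬ ((⟨k, by omega⟩ : Fin (m + n)) ∈ S.1 ↔ (⟨k + 1, hk⟩ : Fin (m + n)) ∈ S.1)) :
    (S.swap ⟨k, by omega⟩ ⟨k + 1, hk⟩).sign = - S.sign := by
  by_cases h1 : (⟨k, by omega⟩ : Fin (m + n)) ∈ S.1
  · exact S.sign_swap k hk h1 (fun h2 => h (by simp [h1, h2]))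
  · have h2 : (⟨k + 1, hk⟩ : Fin (m + n)) ∈ S.1 := by
      by_contra h2
      exact h (by simp [h1, h2])
    have := (S.swap ⟨k, by omega⟩ ⟨k + 1, hk⟩).sign_swap k hk
      (by rw [Shuffle.mem_swap, Equiv.swap_apply_left]; exact h2)
      (by rw [Shuffle.mem_swap, Equiv.swap_apply_right]; exact h1)
    rw [Shuffle.swap_swap] at this
    rw [this, neg_neg]

theorem Shuffle.left_swap {m n : ℕ} (S : Shuffle m n) (k : ℕ) (hk : k + 1 < m + n) (l : ℕ)
    (hl : l ≠ k + 1) : (S.swap ⟨k, by omega⟩ ⟨k + 1, hk⟩).left l = S.left l := by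
  rw [Shuffle.left, Shuffle.swap]
  simp only [Finset.filter_map, Finset.card_map]
  rw [Shuffle.left]
  congr 1
  apply Finset.filter_congr
  intro i _
  simp only [Function.comp, Equiv.coe_toEmbedding]
  rcases eq_or_ne i ⟨k, by omega⟩ with rfl | h1
  · rw [Equiv.swap_apply_left]; simp only; omega
  · rcases eq_or_ne i ⟨k + 1, hk⟩ with rfl | h2
    · rw [Equiv.swap_apply_right]; simp only; omega
    · rw [Equiv.swap_apply_of_ne_of_ne h1 h2]

theorem Shuffle.right_swap {m n : ℕ} (S : Shuffle m n) (k : ℕ) (hk : k + 1 < m + n) (l : ℕ)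
    (hl : l ≠ k + 1) (hl' : l ≤ m + n) :
    (S.swap ⟨k, by omega⟩ ⟨k + 1, hk⟩).right l = S.right l := by
  have h1 := (S.swap ⟨k, by omega⟩ ⟨k + 1, hk⟩).left_add_right l hl'
  have h2 := S.left_add_right l hl'
  have h3 := S.left_swap k hk l hl
  omega

/-- The product of top-dimensional cycles is a cycle. -/
theorem mulChains_mem [FiniteDimensional F V] [FiniteDimensional F W] {a b : ℕ}
    (ha : Module.finrank F V = a + 1) (hb : Module.finrank F W = b + 1)
    (hV : (⊥ : Submodule F V) ≠ ⊤) (hW : (⊥ : Submodule F W) ≠ ⊤)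
    {x : Chains F V a} {y : Chains F W b} (hx : x ∈ Cycles F V a) (hy : y ∈ Cycles F W b) :
    mulChains hV hW x y ∈ Cycles F (V × W) (a + 1 + b) := by
  apply mem_cycles_of_face
  intro j
  let T : Shuffle (a + 1) (b + 1) → Chains F V a →ₗ[ℤ] Chains F W b →ₗ[ℤ]
      Chains F (V × W) (a + 1 + b - 1) := fun S =>
    Finsupp.linearCombination ℤ fun s => Finsupp.linearCombination ℤ fun t =>
      Finsupp.single (face j (mulSimplex hV hW S s t)) 1
  have hT : ∀ S s t p r, T S (Finsupp.single s p) (Finsupp.single t r) =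
      (p * r) • Finsupp.single (face j (mulSimplex hV hW S s t)) 1 := by
    intro S s t p r
    simp [T]
  have key : ∀ (x : Chains F V a) (y : Chains F W b),
      Finsupp.mapDomain (face j) (mulChains hV hW x y) = ∑ S, S.sign • T S x y := by
    intro x y
    rw [← Finsupp.lmapDomain_apply ℤ ℤ]
    induction x using Finsupp.induction_linear with
    | zero => simp
    | add f g hf hg =>
      simp only [map_add, LinearMap.add_apply, hf, hg, smul_add, Finset.sum_add_distrib]
    | single s p =>
      induction y using Finsupp.induction_linear with
      | zero => simp
      | add f g hf hg => simp only [map_add, hf, hg, smul_add, Finset.sum_add_distrib]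
      | single t r =>
        simp only [mulChains_single, hT, map_smul, map_sum, Finsupp.lmapDomain_apply,
          Finsupp.mapDomain_single, Finset.smul_sum]
        refine Finset.sum_congr rfl fun S _ => ?_
        rw [smul_comm S.sign (p * r), Finsupp.smul_single S.sign, smul_eq_mul, mul_one]
  rw [key]
  have hj := j.2
  have hk : j.1 + 1 < a + 1 + (b + 1) := by omega
  -- two consecutive steps in the same direction
  have same : ∀ S : Shuffle (a + 1) (b + 1),
      ((⟨j.1, by omega⟩ : Fin (a + 1 + (b + 1))) ∈ S.1 ↔
        (⟨j.1 + 1, hk⟩ : Fin (a + 1 + (b + 1))) ∈ S.1) → T S x y = 0 := by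
    intro S hS
    have e1 := S.left_succ j.1 (by omega)
    have e2 := S.left_succ (j.1 + 1) hk
    have f1 := S.right_succ j.1 (by omega)
    have f2 := S.right_succ (j.1 + 1) hk
    have l1 := S.left_le (j.1 + 1 + 1)
    have r1 := S.right_le (j.1 + 1 + 1)
    by_cases h1 : (⟨j.1, by omega⟩ : Fin (a + 1 + (b + 1))) ∈ S.1
    · have h2 := hS.1 h1
      rw [if_pos h1] at e1 f1
      rw [if_pos h2] at e2 f2
      have : T S x = 0 := by
        refine linearCombination_eq_zero ha hx ⟨S.left j.1, by omega⟩ _ ?_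
        intro s s' hs
        congr 1
        funext t
        congr 1
        apply face_eq_of_forall
        intro k hkj
        rw [mulSimplex_apply, mulSimplex_apply, flag_eq_of_face_eq hs]
        simp only
        rcases lt_or_gt_of_ne (fun h => hkj (Fin.ext h) : k.1 ≠ j.1) with h | h
        · have := S.left_mono (show k.1 + 1 ≤ j.1 by omega)
          omega
        · have := S.left_mono (show j.1 + 1 + 1 ≤ k.1 + 1 by omega)
          omega
      rw [this]; rfl
    · have h2 := fun h => h1 (hS.2 h)
      rw [if_neg h1] at e1 f1
      rw [if_neg h2] at e2 f2
      have : ∀ s p, T S (Finsupp.single s p) y = 0 := by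
        intro s p
        simp only [T, Finsupp.linearCombination_single, LinearMap.smul_apply]
        rw [linearCombination_eq_zero hb hy ⟨S.right j.1, by omega⟩, smul_zero]
        intro t t' ht
        congr 1
        apply face_eq_of_forall
        intro k hkj
        rw [mulSimplex_apply, mulSimplex_apply, flag_eq_of_face_eq ht]
        simp only
        rcases lt_or_gt_of_ne (fun h => hkj (Fin.ext h) : k.1 ≠ j.1) with h | h
        · have := S.right_mono (show k.1 + 1 ≤ j.1 by omega)
          omega
        · have := S.right_mono (show j.1 + 1 + 1 ≤ k.1 + 1 by omega)
          omega
      clear hx key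
      induction x using Finsupp.induction_linear with
      | zero => simp
      | add f g hf hg => rw [map_add, LinearMap.add_apply, hf, hg, add_zero]
      | single s p => exact this s p
  -- exchanging two consecutive steps in different directions
  have swapT : ∀ S : Shuffle (a + 1) (b + 1),
      T (S.swap ⟨j.1, by omega⟩ ⟨j.1 + 1, hk⟩) = T S := by
    intro S
    simp only [T]
    congr 1
    funext s
    congr 1
    funext t
    congr 1
    apply face_eq_of_forall
    intro k hkj
    have hne : k.1 + 1 ≠ j.1 + 1 := fun h => hkj (Fin.ext (by omega))
    rw [mulSimplex_apply, mulSimplex_apply, S.left_swap _ _ _ hne,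
      S.right_swap _ _ _ hne (by omega)]
  refine Finset.sum_involution (fun S _ => S.swap ⟨j.1, by omega⟩ ⟨j.1 + 1, hk⟩) ?_ ?_
    (fun _ _ => Finset.mem_univ _) (fun S _ => S.swap_swap _ _)
  · intro S _
    by_cases hS : ((⟨j.1, by omega⟩ : Fin (a + 1 + (b + 1))) ∈ S.1 ↔
        (⟨j.1 + 1, hk⟩ : Fin (a + 1 + (b + 1))) ∈ S.1)
    · rw [swapT, same S hS, smul_zero, smul_zero, add_zero]
    · rw [swapT, S.sign_swap' _ hk hS, neg_smul, add_neg_cancel]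
  · intro S _ hne heq
    by_cases hS : ((⟨j.1, by omega⟩ : Fin (a + 1 + (b + 1))) ∈ S.1 ↔
        (⟨j.1 + 1, hk⟩ : Fin (a + 1 + (b + 1))) ∈ S.1)
    · exact hne (by rw [same S hS, smul_zero])
    · have h1 := S.sign_swap' _ hk hS
      rw [heq] at h1
      have h2 : S.sign = 0 := by omega
      exact hne (by rw [h2, zero_smul])

/-- The product of top-dimensional cycles. -/
def mulCycles [FiniteDimensional F V] [FiniteDimensional F W] {a b : ℕ}
    (ha : Module.finrank F V = a + 1) (hb : Module.finrank F W = b + 1)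
    (hV : (⊥ : Submodule F V) ≠ ⊤) (hW : (⊥ : Submodule F W) ≠ ⊤) :
    Cycles F V a →ₗ[ℤ] Cycles F W b →ₗ[ℤ] Cycles F (V × W) (a + 1 + b) :=
  LinearMap.mk₂ ℤ
    (fun x y => ⟨mulChains hV hW x.1 y.1, mulChains_mem ha hb hV hW x.2 y.2⟩)
    (fun x x' y => Subtype.ext (LinearMap.map_add₂ (mulChains hV hW) x.1 x'.1 y.1))
    (fun c x y => Subtype.ext (LinearMap.map_smul₂ (mulChains hV hW) c x.1 y.1))
    (fun x y y' => Subtype.ext (map_add (mulChains hV hW x.1) y.1 y'.1))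
    (fun c x y => Subtype.ext (map_smul (mulChains hV hW x.1) c y.1))

theorem flag_map (g : V ≃ₗ[F] V') {q : ℕ} (s : Simplices F V q) (c : ℕ) :
    flag (mapSimplex g s) c = (flag s c).map (g : V →ₗ[F] V') := by
  rcases c with _ | c
  · simp [flag]
  · simp only [flag]
    split_ifs
    · rfl
    · rw [Submodule.map_top]
      exact (LinearEquiv.range g).symm

theorem mulChains_map {a b : ℕ} (hV : (⊥ : Submodule F V) ≠ ⊤) (hW : (⊥ : Submodule F W) ≠ ⊤)
    (g : V ≃ₗ[F] V) (h : W ≃ₗ[F] W) (x : Chains F V a) (y : Chains F W b) :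
    mulChains hV hW (mapChains g a x) (mapChains h b y) =
      mapChains (g.prodCongr h) (a + 1 + b) (mulChains hV hW x y) := by
  have key : ∀ (S : Shuffle (a + 1) (b + 1)) s t,
      mulSimplex hV hW S (mapSimplex g s) (mapSimplex h t) =
        mapSimplex (g.prodCongr h) (mulSimplex hV hW S s t) := by
    intro S s t
    ext k : 2
    rw [mapSimplex_apply, mulSimplex_apply, mulSimplex_apply, flag_map, flag_map]
    ext ⟨v, w⟩
    simp only [Submodule.mem_prod, Submodule.mem_map, Prod.exists]
    constructor
    · rintro ⟨⟨v', hv, rfl⟩, ⟨w', hw, rfl⟩⟩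
      exact ⟨v', w', ⟨hv, hw⟩, rfl⟩
    · rintro ⟨v', w', ⟨hv, hw⟩, e⟩
      exact ⟨⟨v', hv, congrArg Prod.fst e⟩, ⟨w', hw, congrArg Prod.snd e⟩⟩
  induction x using Finsupp.induction_linear with
  | zero => simp
  | add f g hf hg => simp only [map_add, LinearMap.add_apply, hf, hg]
  | single s p =>
    induction y using Finsupp.induction_linear with
    | zero => simp
    | add f g hf hg => simp only [map_add, hf, hg]
    | single t r =>
      simp only [mapChains, Finsupp.lmapDomain_apply, Finsupp.mapDomain_single, mulChains_single,
        Finsupp.mapDomain_smul, Finsupp.mapDomain_finsetSum, key]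

end Product

section SteinbergModule

variable (F : Type*) [Field F]

/-- The group `GL(F^n)` of linear automorphisms of `F^n`. -/
abbrev GLn (n : ℕ) : Type _ := (Fin n → F) ≃ₗ[F] (Fin n → F)

/-- The action of `GL(F^(n+1))` on the Steinberg module. -/
def stRep (n : ℕ) : Representation ℤ (GLn F (n + 1)) (St F n) where
  toFun g := mapCycles g n
  map_one' := LinearMap.ext fun x => Subtype.ext (mapChains_refl n x.1)
  map_mul' g h := LinearMap.ext fun x => Subtype.ext (mapChains_trans h g n x.1)

/-- The bilinear form on the Steinberg module, the restriction of the form on chains for which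
complete flags are orthonormal. -/
def stPairing (n : ℕ) : St F n →ₗ[ℤ] St F n →ₗ[ℤ] ℤ :=
  (chainPairing F (Fin (n + 1) → F) n).domRestrict₁₂ (Cycles F (Fin (n + 1) → F) n)
    (Cycles F (Fin (n + 1) → F) n)

/-- `St²(F^(n+1)) = St(F^(n+1)) ⊗ St(F^(n+1))`. -/
def StSq (n : ℕ) : Type _ := St F n ⊗[ℤ] St F n

instance (n : ℕ) : AddCommGroup (StSq F n) := inferInstanceAs (AddCommGroup (St F n ⊗[ℤ] St F n))

instance (n : ℕ) : Module ℤ (StSq F n) := inferInstanceAs (Module ℤ (St F n ⊗[ℤ] St F n))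

variable {F} in
/-- The pure tensors in `St²(F^(n+1))`. -/
def StSq.tmul {n : ℕ} (a b : St F n) : StSq F n := (a ⊗ₜ[ℤ] b : St F n ⊗[ℤ] St F n)

/-- The diagonal action of `GL(F^(n+1))` on `St²(F^(n+1))`. -/
def stSqRep (n : ℕ) : Representation ℤ (GLn F (n + 1)) (StSq F n) :=
  (stRep F n).tprod (stRep F n)

/-- The coinvariants `St²(F^(n+1))_{GL(F^(n+1))}`. -/
def Coinv (n : ℕ) : Type _ := (stSqRep F n).Coinvariants

instance (n : ℕ) : AddCommGroup (Coinv F n) := inferInstanceAs (AddCommGroup (stSqRep F n).Coinvariants)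

instance (n : ℕ) : Module ℤ (Coinv F n) := inferInstanceAs (Module ℤ (stSqRep F n).Coinvariants)

/-- The class of an element in the coinvariants. -/
def Coinv.mk (n : ℕ) : StSq F n →ₗ[ℤ] Coinv F n := Representation.Coinvariants.mk (stSqRep F n)

/-- The map `St²(F^(n+1))_{GL(F^(n+1))} → ℤ` induced by the bilinear form. -/
def coinvPairing (n : ℕ) : Coinv F n →ₗ[ℤ] ℤ :=
  Representation.Coinvariants.lift (stSqRep F n)
    (TensorProduct.lift (stPairing F n) : St F n ⊗[ℤ] St F n →ₗ[ℤ] ℤ) fun g =>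
    TensorProduct.ext' fun x y => chainPairing_map g n x.1 y.1

theorem coinvPairing_mk_tmul (n : ℕ) (x y : St F n) :
    coinvPairing F n (Coinv.mk F n (StSq.tmul x y)) = stPairing F n x y := rfl

/-- The standard isomorphism `F^(m+1) ⊕ F^(n+1) ≃ F^(m+n+2)`, concatenating coordinates. -/
def sumEquiv (m n : ℕ) :
    ((Fin (m + 1) → F) × (Fin (n + 1) → F)) ≃ₗ[F] (Fin (m + 1 + n + 1) → F) :=
  (LinearEquiv.sumArrowLequivProdArrow (Fin (m + 1)) (Fin (n + 1)) F F).symm.trans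
    (LinearEquiv.funCongrLeft F F (finSumFinEquiv (m := m + 1) (n := n + 1)).symm)

theorem bot_ne_top' (n : ℕ) : (⊥ : Submodule F (Fin (n + 1) → F)) ≠ ⊤ := bot_ne_top

/-- The product `St(F^(m+1)) ⊗ St(F^(n+1)) → St(F^(m+1) ⊕ F^(n+1)) = St(F^(m+n+2))`. -/
def stMul (m n : ℕ) : St F m →ₗ[ℤ] St F n →ₗ[ℤ] St F (m + 1 + n) :=
  (mulCycles (by simp) (by simp) (bot_ne_top' F m) (bot_ne_top' F n)).compr₂
    (mapCycles (sumEquiv F m n) (m + 1 + n))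

theorem stMul_coe (m n : ℕ) (x : St F m) (y : St F n) : (stMul F m n x y).1 =
    mapChains (sumEquiv F m n) (m + 1 + n)
      (mulChains (bot_ne_top' F m) (bot_ne_top' F n) x.1 y.1) := rfl

/-- The block sum of two automorphisms. -/
def blockSum (m n : ℕ) (g : GLn F (m + 1)) (h : GLn F (n + 1)) : GLn F (m + 1 + n + 1) :=
  ((sumEquiv F m n).symm.trans (g.prodCongr h)).trans (sumEquiv F m n)

theorem stMul_map (m n : ℕ) (g : GLn F (m + 1)) (h : GLn F (n + 1)) (x : St F m) (y : St F n) :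
    stMul F m n (stRep F m g x) (stRep F n h y) =
      stRep F (m + 1 + n) (blockSum F m n g h) (stMul F m n x y) := by
  apply Subtype.ext
  change mapChains _ _ (mulChains _ _ (mapChains g m x.1) (mapChains h n y.1)) =
    mapChains (blockSum F m n g h) _ (mapChains (sumEquiv F m n) _ (mulChains _ _ x.1 y.1))
  rw [mulChains_map, ← mapChains_trans, ← mapChains_trans]
  congr 1
  congr 1
  ext v : 1
  simp [blockSum]

/-- The product `St²(F^(m+1)) ⊗ St²(F^(n+1)) → St²(F^(m+n+2))`: the tensor square of the product
on Steinberg modules, where `St(F^d)` is placed in degree `d`, so that by the Koszul rule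
`(a ⊗ b) · (a' ⊗ b') = (-1) ^ (|b| |a'|) (a · a') ⊗ (b · b')`. -/
def stSqMul (m n : ℕ) : StSq F m →ₗ[ℤ] StSq F n →ₗ[ℤ] StSq F (m + 1 + n) :=
  (-1 : ℤ) ^ ((m + 1) * (n + 1)) • (TensorProduct.map₂ (stMul F m n) (stMul F m n) :
    (St F m ⊗[ℤ] St F m) →ₗ[ℤ] (St F n ⊗[ℤ] St F n) →ₗ[ℤ]
      (St F (m + 1 + n) ⊗[ℤ] St F (m + 1 + n)))

theorem stSqMul_tmul (m n : ℕ) (a b : St F m) (c d : St F n) :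
    stSqMul F m n (StSq.tmul a b) (StSq.tmul c d) =
      (-1 : ℤ) ^ ((m + 1) * (n + 1)) • StSq.tmul (stMul F m n a c) (stMul F m n b d) := rfl

theorem stSqRep_tmul (n : ℕ) (g : GLn F (n + 1)) (a b : St F n) :
    stSqRep F n g (StSq.tmul a b) = StSq.tmul (stRep F n g a) (stRep F n g b) := rfl

theorem stSq_induction {n : ℕ} {P : StSq F n → Prop} (x : StSq F n) (h0 : P 0)
    (ht : ∀ a b : St F n, P (StSq.tmul a b)) (ha : ∀ x y, P x → P y → P (x + y)) : P x :=
  TensorProduct.induction_on (motive := P) x h0 ht ha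

theorem stSqMul_map (m n : ℕ) (g : GLn F (m + 1)) (h : GLn F (n + 1)) (x : StSq F m)
    (y : StSq F n) : stSqMul F m n (stSqRep F m g x) (stSqRep F n h y) =
      stSqRep F (m + 1 + n) (blockSum F m n g h) (stSqMul F m n x y) := by
  induction x using stSq_induction with
  | h0 => simp
  | ha x x' hx hx' => simp only [map_add, LinearMap.add_apply, hx, hx']
  | ht a b =>
    induction y using stSq_induction with
    | h0 => simp
    | ha x x' hx hx' => simp only [map_add, hx, hx']
    | ht c d =>
      rw [stSqRep_tmul, stSqRep_tmul, stSqMul_tmul, stSqMul_tmul, stMul_map, stMul_map]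
      rw [map_smul, stSqRep_tmul]

end SteinbergModule

section Coinvariants

/-- A bilinear map which is equivariant along a map `G × H → K` descends to coinvariants. -/
def coinvMul {k : Type*} [CommRing k] {G H K A B C : Type*} [Monoid G] [Monoid H] [Monoid K]
    [AddCommGroup A] [Module k A] [AddCommGroup B] [Module k B] [AddCommGroup C] [Module k C]
    (ρ : Representation k G A) (σ : Representation k H B) (τ : Representation k K C)
    (μ : A →ₗ[k] B →ₗ[k] C) (φ : G → H → K)
    (hμ : ∀ g h a b, μ (ρ g a) (σ h b) = τ (φ g h) (μ a b)) :
    ρ.Coinvariants →ₗ[k] σ.Coinvariants →ₗ[k] τ.Coinvariants :=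
  Representation.Coinvariants.lift ρ
    (LinearMap.flip
      (Representation.Coinvariants.lift σ
        (LinearMap.flip (μ.compr₂ (Representation.Coinvariants.mk τ)))
        (fun h => LinearMap.ext fun b => LinearMap.ext fun a => by
          have := hμ 1 h a b
          rw [map_one, Module.End.one_apply] at this
          simp [this])))
    (fun g => LinearMap.ext fun a => Representation.Coinvariants.hom_ext
      (LinearMap.ext fun b => by
        have := hμ g 1 a b
        rw [map_one, Module.End.one_apply] at this
        simp [this]))

theorem coinvMul_mk {k : Type*} [CommRing k] {G H K A B C : Type*} [Monoid G] [Monoid H] [Monoid K]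
    [AddCommGroup A] [Module k A] [AddCommGroup B] [Module k B] [AddCommGroup C] [Module k C]
    (ρ : Representation k G A) (σ : Representation k H B) (τ : Representation k K C)
    (μ : A →ₗ[k] B →ₗ[k] C) (φ : G → H → K)
    (hμ : ∀ g h a b, μ (ρ g a) (σ h b) = τ (φ g h) (μ a b)) (a : A) (b : B) :
    coinvMul ρ σ τ μ φ hμ (Representation.Coinvariants.mk ρ a) (Representation.Coinvariants.mk σ b) =
      Representation.Coinvariants.mk τ (μ a b) := rfl

end Coinvariants

section BaseChange

variable (k : Type*) [CommRing k] (F : Type*) [Field F]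

/-- The product on `⨁_{d ≥ 1} St²(F^d)_{GL(F^d)}` induced by direct sum. -/
def coinvSqMul (m n : ℕ) : Coinv F m →ₗ[ℤ] Coinv F n →ₗ[ℤ] Coinv F (m + 1 + n) :=
  coinvMul (stSqRep F m) (stSqRep F n) (stSqRep F (m + 1 + n)) (stSqMul F m n) (blockSum F m n)
    (stSqMul_map F m n)

theorem coinvSqMul_mk (m n : ℕ) (x : StSq F m) (y : StSq F n) :
    coinvSqMul F m n (Coinv.mk F m x) (Coinv.mk F n y) =
      Coinv.mk F (m + 1 + n) (stSqMul F m n x y) := rfl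

/-- `St²_k(F^(n+1)) = k ⊗ St²(F^(n+1))`. -/
abbrev StSqOver (n : ℕ) : Type _ := k ⊗[ℤ] StSq F n

/-- The action of `GL(F^(n+1))` on `St²_k(F^(n+1))`. -/
def stSqOverRep (n : ℕ) : Representation k (GLn F (n + 1)) (StSqOver k F n) where
  toFun g := LinearMap.baseChange k (stSqRep F n g)
  map_one' := by rw [map_one]; exact LinearMap.baseChange_id
  map_mul' g h := by rw [map_mul]; exact LinearMap.baseChange_comp _ _

theorem stSqOverRep_tmul (n : ℕ) (g : GLn F (n + 1)) (c : k) (z : StSq F n) :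
    stSqOverRep k F n g (c ⊗ₜ z) = c ⊗ₜ stSqRep F n g z := rfl

/-- The `k`-bilinear extension of the product on `St²`. -/
def stSqOverMul (m n : ℕ) :
    StSqOver k F m →ₗ[k] StSqOver k F n →ₗ[k] StSqOver k F (m + 1 + n) :=
  TensorProduct.curry
    ((LinearMap.baseChange k (TensorProduct.lift (stSqMul F m n))).comp
      (TensorProduct.AlgebraTensorModule.distribBaseChange ℤ k (StSq F m) (StSq F n)).symm.toLinearMap)

theorem stSqOverMul_tmul (m n : ℕ) (a b : k) (x : StSq F m) (y : StSq F n) :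
    stSqOverMul k F m n (a ⊗ₜ x) (b ⊗ₜ y) = (a * b) ⊗ₜ[ℤ] stSqMul F m n x y := by
  simp [stSqOverMul]

theorem stSqOverMul_map (m n : ℕ) (g : GLn F (m + 1)) (h : GLn F (n + 1)) (x : StSqOver k F m)
    (y : StSqOver k F n) : stSqOverMul k F m n (stSqOverRep k F m g x) (stSqOverRep k F n h y) =
      stSqOverRep k F (m + 1 + n) (blockSum F m n g h) (stSqOverMul k F m n x y) := by
  induction x using TensorProduct.induction_on with
  | zero => simp
  | add x x' hx hx' => simp only [map_add, LinearMap.add_apply, hx, hx']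
  | tmul a b =>
    induction y using TensorProduct.induction_on with
    | zero => simp
    | add x x' hx hx' => simp only [map_add, hx, hx']
    | tmul c d =>
      rw [stSqOverRep_tmul, stSqOverRep_tmul, stSqOverMul_tmul, stSqOverMul_tmul,
        stSqOverRep_tmul, stSqMul_map]

/-- The coinvariants `St²_k(F^(n+1))_{GL(F^(n+1))}`. -/
def CoinvOver (n : ℕ) : Type _ := (stSqOverRep k F n).Coinvariants

instance (n : ℕ) : AddCommGroup (CoinvOver k F n) :=
  inferInstanceAs (AddCommGroup (stSqOverRep k F n).Coinvariants)

instance (n : ℕ) : Module k (CoinvOver k F n) :=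
  inferInstanceAs (Module k (stSqOverRep k F n).Coinvariants)

/-- The class of an element in the coinvariants. -/
def CoinvOver.mk (n : ℕ) : StSqOver k F n →ₗ[k] CoinvOver k F n :=
  Representation.Coinvariants.mk (stSqOverRep k F n)

/-- The product on `⨁_{d ≥ 1} St²_k(F^d)_{GL(F^d)}` induced by direct sum. -/
def coinvOverMul (m n : ℕ) :
    CoinvOver k F m →ₗ[k] CoinvOver k F n →ₗ[k] CoinvOver k F (m + 1 + n) :=
  coinvMul (stSqOverRep k F m) (stSqOverRep k F n) (stSqOverRep k F (m + 1 + n))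
    (stSqOverMul k F m n) (blockSum F m n) (stSqOverMul_map k F m n)

theorem coinvOverMul_mk (m n : ℕ) (x : StSqOver k F m) (y : StSqOver k F n) :
    coinvOverMul k F m n (CoinvOver.mk k F m x) (CoinvOver.mk k F n y) =
      CoinvOver.mk k F (m + 1 + n) (stSqOverMul k F m n x y) := rfl

/-- The map `St²(F^(n+1))_{GL} → St²_k(F^(n+1))_{GL}`, `[z] ↦ [1 ⊗ z]`. -/
def coinvBaseChange (n : ℕ) : Coinv F n →+ CoinvOver k F n :=
  (Representation.Coinvariants.lift (stSqRep F n)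
    (((CoinvOver.mk k F n).toAddMonoidHom.comp
      (TensorProduct.mk ℤ k (StSq F n) 1).toAddMonoidHom).toIntLinearMap) (fun g =>
        LinearMap.ext fun z =>
          Representation.Coinvariants.mk_self_apply (stSqOverRep k F n) g
            ((1 : k) ⊗ₜ[ℤ] z))).toAddMonoidHom

theorem coinvBaseChange_mk (n : ℕ) (z : StSq F n) :
    coinvBaseChange k F n (Coinv.mk F n z) = CoinvOver.mk k F n (1 ⊗ₜ z) := rfl

end BaseChange

section GradedRing

variable {k : Type*} [CommRing k] (A : ℕ → Type*) [∀ n, AddCommGroup (A n)]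
  [∀ n, Module k (A n)] (μ : ∀ m n, A m →ₗ[k] A n →ₗ[k] A (m + 1 + n))

/-- The multiplication on a direct sum `⨁_{d ≥ 1} A_d` of `k`-modules (the `n`-th summand `A n` has
degree `d = n + 1`) given by bilinear maps `A_d × A_e → A_{d+e}`. -/
def directSumMul : (⨁ n, A n) →ₗ[k] (⨁ n, A n) →ₗ[k] (⨁ n, A n) :=
  DirectSum.toModule k ℕ _ fun m => LinearMap.flip <| DirectSum.toModule k ℕ _ fun n =>
    LinearMap.flip ((μ m n).compr₂ (DirectSum.lof k ℕ A (m + 1 + n)))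

theorem directSumMul_lof (m n : ℕ) (x : A m) (y : A n) :
    directSumMul A μ (DirectSum.lof k ℕ A m x) (DirectSum.lof k ℕ A n y) =
      DirectSum.lof k ℕ A (m + 1 + n) (μ m n x y) := by
  rw [directSumMul, DirectSum.toModule_lof, LinearMap.flip_apply, DirectSum.toModule_lof]
  rfl

/-- The direct sum `⨁_{d ≥ 1} A_d`, with the multiplication `directSumMul`. -/
def PositivePart {k : Type*} [CommRing k] (A : ℕ → Type*) [∀ n, AddCommGroup (A n)]
    [∀ n, Module k (A n)] (_μ : ∀ m n, A m →ₗ[k] A n →ₗ[k] A (m + 1 + n)) : Type _ :=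
  ⨁ n, A n

instance : AddCommGroup (PositivePart A μ) := inferInstanceAs (AddCommGroup (⨁ n, A n))

instance : Module k (PositivePart A μ) := inferInstanceAs (Module k (⨁ n, A n))

instance : NonUnitalNonAssocRing (PositivePart A μ) where
  mul x y := directSumMul A μ x y
  left_distrib x y z := map_add (directSumMul A μ x) y z
  right_distrib x y z := LinearMap.map_add₂ (directSumMul A μ) x y z
  zero_mul x := LinearMap.map_zero₂ (directSumMul A μ) x
  mul_zero x := map_zero (directSumMul A μ x)

/-- The inclusion of a summand. -/
def PositivePart.of (n : ℕ) : A n →ₗ[k] PositivePart A μ := DirectSum.lof k ℕ A n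

theorem PositivePart.of_mul_of (m n : ℕ) (x : A m) (y : A n) :
    of A μ m x * of A μ n y = of A μ (m + 1 + n) (μ m n x y) :=
  directSumMul_lof A μ m n x y

end GradedRing

section SteinbergAlgebra

variable (F : Type*) [Field F]

/-- `⨁_{d ≥ 1} St²(F^d)_{GL(F^d)}` with the product induced by direct sum. -/
abbrev CoinvPositive : Type _ := PositivePart (Coinv F) (coinvSqMul F)

/-- `ℤ 1 ⊕ ⨁_{d ≥ 1} St²(F^d)_{GL(F^d)}` with the product induced by direct sum; the first summand
is spanned by the unit element. -/
abbrev CoinvAlgebra : Type _ := Unitization ℤ (CoinvPositive F)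

/-- The inclusion of `St²(F^(n+1))_{GL(F^(n+1))}`. -/
def CoinvAlgebra.of (n : ℕ) (z : Coinv F n) : CoinvAlgebra F :=
  Unitization.inr (PositivePart.of (Coinv F) (coinvSqMul F) n z)

variable (k : Type*) [CommRing k]

/-- `⨁_{d ≥ 1} St²_k(F^d)_{GL(F^d)}` with the product induced by direct sum. -/
abbrev CoinvPositiveOver : Type _ := PositivePart (CoinvOver k F) (coinvOverMul k F)

/-- `k 1 ⊕ ⨁_{d ≥ 1} St²_k(F^d)_{GL(F^d)}` with the product induced by direct sum; the first
summand is spanned by the unit element. -/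
abbrev CoinvAlgebraOver : Type _ := Unitization k (CoinvPositiveOver F k)

/-- The inclusion of `St²_k(F^(n+1))_{GL(F^(n+1))}`. -/
def CoinvAlgebraOver.of (n : ℕ) (z : CoinvOver k F n) : CoinvAlgebraOver F k :=
  Unitization.inr (PositivePart.of (CoinvOver k F) (coinvOverMul k F) n z)

end SteinbergAlgebra

end Steinberg

end

/-!
Let `*` be the join with a line. An equivariant family of bilinear forms `β U w` on the top cycles
of the `n`-dimensional subspaces `U`, with `w ∈ U`, is a multiple of `⟨-, -⟩`: there is `c` with
`β U w x y = ⟨x, y⟩ • c` for generic `w`. Indeed `x = w * ∂x` and `y = w * ∂y`, where `∂` deletes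
the top member `U` of each flag; `∂x`, `∂y` are sums of cycles of hyperplanes. A pair of cycles of
the same hyperplane gives an equivariant family in dimension `n - 1`, with constant `c₁` by
induction. For distinct hyperplanes with intersection `N` the cycles are sums of joins `l * a` and
`l' * b` with `a`, `b` cycles of `N`; by equivariance only `N` matters, since `w = v + s l + t l'`
and `s l`, `t l'` are as good as `l`, `l'`, and this gives an equivariant family in dimension
`n - 2`, with constant `c₂`. Altogether
`β U w x y = ⟨∂x, ∂y⟩ • (c₁ - c₂) + ⟨∂∂x, ∂∂y⟩ • c₂`, where `∂∂ = 0` and `⟨∂x, ∂y⟩ = ⟨x, y⟩`.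

For `β U w x y` the class of `x ⊗ y` in the coinvariants this shows that the coinvariants are
infinite cyclic and detected by `⟨-, -⟩`. Among the shuffles occurring in two products only equal
ones pair non-trivially, so `⟨a a', b b'⟩ = (m+n choose m) ⟨a, b⟩ ⟨a', b'⟩`, and the sign of `γ_n`
absorbs the Koszul sign: `γ_m γ_n = (m+n choose m) γ_{m+n}`.
-/

noncomputable section

namespace Steinberg

theorem finsupp_linearMap_ext {α M : Type*} [AddCommGroup M] {f g : (α →₀ ℤ) →ₗ[ℤ] M}
    (h : ∀ a, f (Finsupp.single a 1) = g (Finsupp.single a 1)) : f = g :=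
  Finsupp.lhom_ext' fun a => LinearMap.ext_ring (h a)

section FlagChains

variable {F : Type*} [DivisionRing F] {V : Type*} [AddCommGroup V] [Module F V]

variable (F V) in
/-- Integral chains on the flags of a vector space. A flag is recorded as the list of its non-zero
members, the largest one first; lists which are not decreasing are harmless. -/
abbrev FlagChains : Type _ := List (Submodule F V) →₀ ℤ

/-- The operation which puts the subspace `U` on top of each flag. -/
def consTop (U : Submodule F V) : FlagChains F V →ₗ[ℤ] FlagChains F V :=
  Finsupp.lmapDomain ℤ ℤ (List.cons U)

variable (F V) in
/-- The face operator which removes the largest subspace of each flag; it kills the empty flag. -/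
def dropTop : FlagChains F V →ₗ[ℤ] FlagChains F V :=
  Finsupp.linearCombination ℤ fun
    | [] => 0
    | _ :: t => Finsupp.single t 1

/-- The join of the line spanned by `v` with a flag `t`: the signed sum of the flags obtained by
adding the line to the larger members of `t` and repeating one member of `t`. -/
def joinFlag (v : V) : List (Submodule F V) → FlagChains F V
  | [] => Finsupp.single [F ∙ v] 1
  | H :: t => consTop (H ⊔ F ∙ v) (Finsupp.single (H :: t) 1 - joinFlag v t)

variable (F) in
/-- The join with the line spanned by `v`, on chains of flags. -/
def join (v : V) : FlagChains F V →ₗ[ℤ] FlagChains F V :=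
  Finsupp.linearCombination ℤ (joinFlag v)

@[simp]
theorem consTop_single (U : Submodule F V) (t : List (Submodule F V)) (c : ℤ) :
    consTop U (Finsupp.single t c) = Finsupp.single (U :: t) c :=
  Finsupp.mapDomain_single

@[simp]
theorem join_single (v : V) (t : List (Submodule F V)) :
    join F v (Finsupp.single t 1) = joinFlag v t := by
  simp [join]

@[simp]
theorem dropTop_single_nil (c : ℤ) : dropTop F V (Finsupp.single [] c) = 0 := by
  simp [dropTop]

@[simp]
theorem dropTop_consTop (U : Submodule F V) (x : FlagChains F V) :
    dropTop F V (consTop U x) = x := by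
  have h : dropTop F V ∘ₗ consTop U = LinearMap.id :=
    finsupp_linearMap_ext fun t => by simp [dropTop]
  exact LinearMap.congr_fun h x

@[simp]
theorem dropTop_single_cons (U : Submodule F V) (t : List (Submodule F V)) (c : ℤ) :
    dropTop F V (Finsupp.single (U :: t) c) = Finsupp.single t c := by
  rw [← consTop_single, dropTop_consTop]

theorem join_consTop (v : V) (U : Submodule F V) (x : FlagChains F V) :
    join F v (consTop U x) = consTop (U ⊔ F ∙ v) (consTop U x - join F v x) := by
  have h : join F v ∘ₗ consTop U = consTop (U ⊔ F ∙ v) ∘ₗ (consTop U - join F v) :=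
    finsupp_linearMap_ext fun t => by simp [joinFlag]
  exact LinearMap.congr_fun h x

theorem dropTop_join (v : V) (x : FlagChains F V) :
    dropTop F V (join F v x) = x - join F v (dropTop F V x) := by
  have h : dropTop F V ∘ₗ join F v = LinearMap.id - join F v ∘ₗ dropTop F V := by
    refine finsupp_linearMap_ext fun t => ?_
    cases t with
    | nil => simp [joinFlag]
    | cons U t => simp [joinFlag]
  exact LinearMap.congr_fun h x

theorem join_smul {s : F} (hs : s ≠ 0) (v : V) : join F (s • v) = join F v := by
  refine finsupp_linearMap_ext fun t => ?_
  rw [join_single, join_single]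
  induction t with
  | nil => rw [joinFlag, joinFlag, Submodule.span_singleton_smul_eq (IsUnit.mk0 s hs)]
  | cons U t ih =>
    rw [joinFlag, joinFlag, Submodule.span_singleton_smul_eq (IsUnit.mk0 s hs), ih]

/-- The top-dimensional cycles of the Tits building of an `n`-dimensional subspace `U`, as chains
on complete flags of `U` (with `U` itself as top member). Cycles are sums over the hyperplanes `H`
of `U` of chains of the form `H`-cycle with `U` on top: this encodes that all faces which do not
delete `H` vanish, and the kernel of `dropTop` that the face which deletes `H` vanishes as well. -/
def flagCycles : ℕ → Submodule F V → Submodule ℤ (FlagChains F V)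
  | 0, U => Submodule.span ℤ {x | U = ⊥ ∧ x = Finsupp.single [] 1}
  | n + 1, U => (LinearMap.ker (dropTop F V) ⊓
      Submodule.span ℤ {x | ∃ H, H ⋖ U ∧ x ∈ flagCycles n H}).map (consTop U)

/-- The sums of top-dimensional cycles of hyperplanes of the `n + 1`-dimensional subspace `U`. -/
def hyperplaneCycles (n : ℕ) (U : Submodule F V) : Submodule ℤ (FlagChains F V) :=
  Submodule.span ℤ {x | ∃ H, H ⋖ U ∧ x ∈ flagCycles n H}

theorem mem_hyperplaneCycles {n : ℕ} {U H : Submodule F V} (hH : H ⋖ U) {x : FlagChains F V}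
    (hx : x ∈ flagCycles n H) : x ∈ hyperplaneCycles n U :=
  Submodule.subset_span ⟨H, hH, hx⟩

theorem hyperplaneCycles_le {n : ℕ} {U : Submodule F V} {S : Submodule ℤ (FlagChains F V)}
    (h : ∀ H, H ⋖ U → flagCycles n H ≤ S) : hyperplaneCycles n U ≤ S :=
  Submodule.span_le.2 fun _ ⟨H, hH, hx⟩ => h H hH hx

theorem eqOn_hyperplaneCycles {n : ℕ} {U : Submodule F V} {M : Type*} [AddCommGroup M]
    {f g : FlagChains F V →ₗ[ℤ] M} (h : ∀ H, H ⋖ U → Set.EqOn f g (flagCycles n H)) :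
    Set.EqOn f g (hyperplaneCycles n U) :=
  LinearMap.eqOn_span fun _ ⟨H, hH, hx⟩ => h H hH hx

theorem exists_eq_single_of_mem_flagCycles_zero {U : Submodule F V} {x : FlagChains F V}
    (hx : x ∈ flagCycles 0 U) : ∃ c : ℤ, x = Finsupp.single [] c := by
  have h : flagCycles 0 U ≤ LinearMap.range (Finsupp.lsingle (R := ℤ) []) :=
    Submodule.span_le.2 fun y hy => ⟨1, hy.2.symm⟩
  obtain ⟨c, rfl⟩ := h hx
  exact ⟨c, rfl⟩

theorem eq_zero_of_mem_flagCycles_zero {U : Submodule F V} (hU : U ≠ ⊥) {x : FlagChains F V}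
    (hx : x ∈ flagCycles 0 U) : x = 0 := by
  simpa [flagCycles, hU] using hx

theorem single_nil_mem_flagCycles_bot (c : ℤ) :
    Finsupp.single [] c ∈ flagCycles 0 (⊥ : Submodule F V) := by
  rw [← mul_one c, ← smul_eq_mul, ← Finsupp.smul_single]
  exact Submodule.smul_mem _ c (Submodule.subset_span ⟨rfl, rfl⟩)

theorem mem_flagCycles_succ {n : ℕ} {U : Submodule F V} {x : FlagChains F V} :
    x ∈ flagCycles (n + 1) U ↔ dropTop F V x ∈ hyperplaneCycles n U ∧
      dropTop F V (dropTop F V x) = 0 ∧ consTop U (dropTop F V x) = x := by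
  constructor
  · rintro ⟨z, ⟨h1, h2⟩, rfl⟩
    rw [dropTop_consTop]
    exact ⟨h2, h1, rfl⟩
  · rintro ⟨h1, h2, h3⟩
    exact ⟨_, ⟨h2, h1⟩, h3⟩

theorem dropTop_mem_hyperplaneCycles {n : ℕ} {U : Submodule F V} {x : FlagChains F V}
    (hx : x ∈ flagCycles (n + 1) U) : dropTop F V x ∈ hyperplaneCycles n U :=
  (mem_flagCycles_succ.1 hx).1

theorem dropTop_dropTop {n : ℕ} {U : Submodule F V} {x : FlagChains F V}
    (hx : x ∈ flagCycles n U) : dropTop F V (dropTop F V x) = 0 := by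
  cases n with
  | zero =>
    obtain ⟨c, rfl⟩ := exists_eq_single_of_mem_flagCycles_zero hx
    rw [dropTop_single_nil, map_zero]
  | succ n => exact (mem_flagCycles_succ.1 hx).2.1

theorem join_eq_consTop {n : ℕ} {U : Submodule F V} {x : FlagChains F V}
    (hx : x ∈ flagCycles n U) (v : V) :
    join F v x = consTop (U ⊔ F ∙ v) (x - join F v (dropTop F V x)) := by
  cases n with
  | zero =>
    by_cases hU : U = ⊥
    · obtain ⟨c, rfl⟩ := exists_eq_single_of_mem_flagCycles_zero hx
      simp [hU, join, joinFlag]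
    · simp [eq_zero_of_mem_flagCycles_zero hU hx]
  | succ n =>
    have h := (mem_flagCycles_succ.1 hx).2.2
    conv_lhs => rw [← h, join_consTop, h]

end FlagChains

section Hyperplanes

variable {F : Type*} [DivisionRing F] {V : Type*} [AddCommGroup V] [Module F V]
  {H N U : Submodule F V} {w : V}

theorem ne_zero_of_notMem (hw : w ∉ N) : w ≠ 0 :=
  fun h => hw (h ▸ N.zero_mem)

theorem sup_span_singleton_eq (hH : H ⋖ U) (hw : w ∈ U) (hwH : w ∉ H) : H ⊔ F ∙ w = U :=
  (hH.eq_or_eq le_sup_left (sup_le hH.le ((Submodule.span_singleton_le_iff_mem _ _).2 hw))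
    ).resolve_left fun h => hwH (h ▸ Submodule.mem_sup_right (Submodule.mem_span_singleton_self w))

theorem covBy_sup_span_singleton (hw : w ∉ N) : N ⋖ N ⊔ F ∙ w :=
  sup_comm (F ∙ w) N ▸ Submodule.covBy_span_singleton_sup hw

theorem inf_sup_span_singleton (h : H ≤ N) (hw : w ∉ N) : N ⊓ (H ⊔ F ∙ w) = H := by
  rw [inf_comm, sup_inf_assoc_of_le _ h,
    (Submodule.disjoint_span_singleton_of_notMem hw).symm.eq_bot, sup_bot_eq]

theorem sup_span_singleton_covBy (h : H ⋖ N) (hw : w ∉ N) : H ⊔ F ∙ w ⋖ N ⊔ F ∙ w := by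
  have h1 : N ⊓ (H ⊔ F ∙ w) ⋖ N := by rwa [inf_sup_span_singleton h.le hw]
  have h2 := covBy_sup_of_inf_covBy_left h1
  rwa [← sup_assoc, sup_eq_left.2 h.le] at h2

theorem inf_covBy_of_covBy (hH : H ⋖ U) (hN : N ⋖ U) (hne : H ≠ N) : N ⊓ H ⋖ H := by
  have h : N ⊔ H = U := by
    refine (hN.eq_or_eq le_sup_left (sup_le hN.le hH.le)).resolve_left fun h => ?_
    exact (hH.eq_or_eq (sup_eq_left.1 h) hN.le).elim (hne ·.symm) hN.ne
  exact inf_covBy_of_covBy_sup_left (h.symm ▸ hN)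

end Hyperplanes

section Join

variable {F : Type*} [DivisionRing F] {V : Type*} [AddCommGroup V] [Module F V]

theorem join_eq_zero_and_join_dropTop {n : ℕ} {U : Submodule F V} {x : FlagChains F V} {w : V}
    (hx : x ∈ flagCycles n U) (hw : w ∈ U) (hw0 : w ≠ 0) :
    join F w x = 0 ∧ join F w (dropTop F V x) = x := by
  induction n generalizing U x with
  | zero =>
    have hU : U ≠ ⊥ := (Submodule.ne_bot_iff U).2 ⟨w, hw, hw0⟩
    simp [eq_zero_of_mem_flagCycles_zero hU hx]
  | succ n ih =>
    obtain ⟨h1, h2, h3⟩ := mem_flagCycles_succ.1 hx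
    have join_eq : Set.EqOn (join F w) (consTop U ∘ₗ (LinearMap.id - join F w ∘ₗ dropTop F V))
        (hyperplaneCycles n U) := by
      refine eqOn_hyperplaneCycles fun H hH z hz => ?_
      by_cases hwH : w ∈ H
      · obtain ⟨e1, e2⟩ := ih hz hwH
        simp [e1, e2]
      · rw [join_eq_consTop hz, sup_span_singleton_eq hH hw hwH]
        rfl
    have e : join F w (dropTop F V x) = x := by
      simpa [h2, h3] using join_eq h1
    exact ⟨by rw [join_eq_consTop hx, e, sub_self, map_zero], e⟩

theorem join_eq_zero {n : ℕ} {U : Submodule F V} {x : FlagChains F V} {w : V}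
    (hx : x ∈ flagCycles n U) (hw : w ∈ U) (hw0 : w ≠ 0) : join F w x = 0 :=
  (join_eq_zero_and_join_dropTop hx hw hw0).1

theorem join_dropTop {n : ℕ} {U : Submodule F V} {x : FlagChains F V} {w : V}
    (hx : x ∈ flagCycles n U) (hw : w ∈ U) (hw0 : w ≠ 0) : join F w (dropTop F V x) = x :=
  (join_eq_zero_and_join_dropTop hx hw hw0).2

theorem join_mem {n : ℕ} {N : Submodule F V} {x : FlagChains F V} {w : V}
    (hx : x ∈ flagCycles n N) (hw : w ∉ N) : join F w x ∈ flagCycles (n + 1) (N ⊔ F ∙ w) := by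
  have hcov := covBy_sup_span_singleton hw
  induction n generalizing N x with
  | zero =>
    obtain ⟨c, rfl⟩ := exists_eq_single_of_mem_flagCycles_zero hx
    rw [mem_flagCycles_succ, join_eq_consTop hx]
    simpa using mem_hyperplaneCycles hcov hx
  | succ n ih =>
    rw [mem_flagCycles_succ, join_eq_consTop hx, dropTop_consTop]
    refine ⟨Submodule.sub_mem _ (mem_hyperplaneCycles hcov hx) ?_, ?_, rfl⟩
    · suffices hyperplaneCycles n N ≤ (hyperplaneCycles (n + 1) (N ⊔ F ∙ w)).comap (join F w) from
        this (dropTop_mem_hyperplaneCycles hx)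
      refine hyperplaneCycles_le fun H hH y hy => ?_
      have hwH : w ∉ H := fun h => hw (hH.le h)
      exact mem_hyperplaneCycles (sup_span_singleton_covBy hH hw)
        (ih hy hwH (covBy_sup_span_singleton hwH))
    · rw [map_sub, dropTop_join, dropTop_dropTop hx, map_zero, sub_zero, sub_self]

theorem join_mem_of_covBy {n : ℕ} {N U : Submodule F V} {x : FlagChains F V} {w : V}
    (hN : N ⋖ U) (hx : x ∈ flagCycles n N) (hwU : w ∈ U) (hw : w ∉ N) :
    join F w x ∈ flagCycles (n + 1) U :=
  sup_span_singleton_eq hN hwU hw ▸ join_mem hx hw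

theorem join_join_join_dropTop {n : ℕ} {M : Submodule F V} {x : FlagChains F V} {v w l : V}
    (hx : x ∈ flagCycles n M) (hl : l ∉ M) (hw : w ∉ M ⊔ F ∙ l) (hv : v ∈ F ∙ l ⊔ F ∙ w)
    (hv0 : v ≠ 0) : join F v (join F w (join F l (dropTop F V x))) = 0 := by
  cases n with
  | zero =>
    obtain ⟨c, rfl⟩ := exists_eq_single_of_mem_flagCycles_zero hx
    simp
  | succ n =>
    have h : Set.EqOn (join F v ∘ₗ join F w ∘ₗ join F l) (0 : FlagChains F V →ₗ[ℤ] _)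
        (hyperplaneCycles n M) := by
      refine eqOn_hyperplaneCycles fun H hH y hy => ?_
      have hy' := join_mem (join_mem hy fun h => hl (hH.le h))
        fun h => hw (sup_le_sup_right hH.le _ h)
      exact join_eq_zero hy' (by rw [sup_assoc]; exact Submodule.mem_sup_right hv) hv0
    exact h (dropTop_mem_hyperplaneCycles hx)

/-- The faces of the triangle with vertices `l`, `v`, `w` on a common line of the projective space
give a three-term relation between double joins. -/
theorem join_join {n : ℕ} {M : Submodule F V} {x : FlagChains F V} {v w l : V}
    (hx : x ∈ flagCycles n M) (hl : l ∉ M) (hw : w ∉ M ⊔ F ∙ l) (hv : v ∈ F ∙ l ⊔ F ∙ w)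
    (hv0 : v ≠ 0) :
    join F w (join F l x) = join F v (join F l x) - join F v (join F w x) := by
  have hv' : v ∈ M ⊔ F ∙ l ⊔ F ∙ w := by rw [sup_assoc]; exact Submodule.mem_sup_right hv
  rw [← join_dropTop (join_mem (join_mem hx hl) hw) hv' hv0, dropTop_join, dropTop_join]
  simp only [map_sub, join_join_join_dropTop hx hl hw hv hv0, sub_zero]

theorem join_comm {n : ℕ} {M : Submodule F V} {x : FlagChains F V} {w l : V}
    (hx : x ∈ flagCycles n M) (hl : l ∉ M) (hw : w ∉ M ⊔ F ∙ l) :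
    join F w (join F l x) = - join F l (join F w x) := by
  have hl0 := ne_zero_of_notMem hl
  rw [join_join hx hl hw (Submodule.mem_sup_left (Submodule.mem_span_singleton_self l)) hl0,
    join_eq_zero (join_mem hx hl) (Submodule.mem_sup_right (Submodule.mem_span_singleton_self l))
      hl0, zero_sub]

/-- The subgroup generated by the joins of the cycles of the `n`-dimensional subspace `N` with
lines of `U` not contained in `N`. -/
def joinSpan (n : ℕ) (N U : Submodule F V) : Submodule ℤ (FlagChains F V) :=
  Submodule.span ℤ {x | ∃ l a, l ∈ U ∧ l ∉ N ∧ a ∈ flagCycles n N ∧ x = join F l a}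

theorem join_mem_joinSpan {n : ℕ} {N U : Submodule F V} {l : V} {a : FlagChains F V} (hlU : l ∈ U)
    (hlN : l ∉ N) (ha : a ∈ flagCycles n N) : join F l a ∈ joinSpan n N U :=
  Submodule.subset_span ⟨l, a, hlU, hlN, ha, rfl⟩

/-- Replacing `l` by a point `v` of `N` on the line through `l` and `w`, the three-term relation
exchanges the hyperplane `M ⊔ F ∙ l` for the hyperplane `N = M ⊔ F ∙ v`. -/
theorem join_join_mem_joinSpan {n : ℕ} {M N H U : Submodule F V} {a : FlagChains F V} {w l : V}
    (hN : N ⋖ U) (hMN : M ⋖ N) (hMH : M ⋖ H) (hM : N ⊓ H = M) (ha : a ∈ flagCycles n M)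
    (hlU : l ∈ U) (hlH : l ∈ H) (hlM : l ∉ M) (hwU : w ∈ U) (hwH : w ∉ H) (hwN : w ∉ N) :
    join F w (join F l a) ∈ joinSpan (n + 1) N U := by
  have hlN : l ∉ N := fun h => hlM (hM ▸ ⟨h, hlH⟩)
  obtain ⟨v, hvN, y, hy, hvy⟩ := Submodule.mem_sup.1 (sup_span_singleton_eq hN hlU hlN ▸ hwU)
  obtain ⟨s, rfl⟩ := Submodule.mem_span_singleton.1 hy
  have hs : s ≠ 0 := by
    rintro rfl
    exact hwN (by simpa [← hvy] using hvN)
  have hvM : v ∉ M := fun h => hwH (hvy ▸ H.add_mem (hMH.le h) (H.smul_mem s hlH))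
  have hlvw : l ∈ F ∙ v ⊔ F ∙ w := by
    have : l = (-s⁻¹) • v + s⁻¹ • w := by
      rw [← hvy, smul_add, smul_smul, inv_mul_cancel₀ hs, one_smul, neg_smul]; abel
    rw [this]
    exact Submodule.add_mem_sup (Submodule.smul_mem _ _ (Submodule.mem_span_singleton_self v))
      (Submodule.smul_mem _ _ (Submodule.mem_span_singleton_self w))
  have three_term := join_join ha hvM (sup_span_singleton_eq hMN hvN hvM ▸ hwN) hlvw
    (ne_zero_of_notMem hlN)
  have comm := join_comm ha hlM (sup_span_singleton_eq hMH hlH hlM ▸ hwH)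
  have exchange : join F w (join F l a) = join F w (join F v a) - join F l (join F v a) := by
    rw [three_term, comm]; abel
  have hva := join_mem_of_covBy hMN ha hvN hvM
  exact exchange ▸ Submodule.sub_mem _ (join_mem_joinSpan hwU hwN hva)
    (join_mem_joinSpan hlU hlN hva)

theorem flagCycles_le_joinSpan_of_join {n : ℕ} {N U : Submodule F V} {w : V} (hwU : w ∈ U)
    (hwN : w ∉ N) (hjoin : ∀ H, H ⋖ U → H ≠ N → w ∉ H →
      flagCycles n H ≤ (joinSpan n N U).comap (join F w)) :
    flagCycles (n + 1) U ≤ joinSpan n N U := by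
  have hw0 := ne_zero_of_notMem hwN
  suffices hyperplaneCycles n U ≤ (joinSpan n N U).comap (join F w) from fun x hx =>
    join_dropTop hx hwU hw0 ▸ this (dropTop_mem_hyperplaneCycles hx)
  refine hyperplaneCycles_le fun H hH h hh => ?_
  by_cases hHN : H = N
  · exact join_mem_joinSpan hwU hwN (hHN ▸ hh)
  by_cases hwH : w ∈ H
  · simp [join_eq_zero hh hwH hw0]
  · exact hjoin H hH hHN hwH hh

theorem flagCycles_le_joinSpan {n : ℕ} {N U : Submodule F V} (hN : N ⋖ U) :
    flagCycles (n + 1) U ≤ joinSpan n N U := by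
  induction n generalizing N U with
  | zero =>
    obtain ⟨w, hwU, hwN⟩ := Set.exists_of_ssubset hN.lt
    refine flagCycles_le_joinSpan_of_join hwU hwN fun H hH hHN _ h hh => ?_
    have hH0 : H ≠ ⊥ := by
      rintro rfl
      exact (hH.eq_or_eq bot_le hN.le).elim (Ne.symm hHN) hN.ne
    simp [eq_zero_of_mem_flagCycles_zero hH0 hh]
  | succ n ih =>
    obtain ⟨w, hwU, hwN⟩ := Set.exists_of_ssubset hN.lt
    refine flagCycles_le_joinSpan_of_join hwU hwN fun H hH hHN hwH => ?_
    have hMH : N ⊓ H ⋖ H := inf_covBy_of_covBy hH hN hHN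
    have hMN : N ⊓ H ⋖ N := by
      rw [inf_comm]
      exact inf_covBy_of_covBy hN hH (Ne.symm hHN)
    suffices joinSpan n (N ⊓ H) H ≤ (joinSpan (n + 1) N U).comap (join F w) from
      (ih hMH).trans this
    refine Submodule.span_le.2 ?_
    rintro _ ⟨l, a, hlH, hlM, ha, rfl⟩
    rw [SetLike.mem_coe, Submodule.mem_comap]
    exact join_join_mem_joinSpan hN hMN hMH rfl ha (hH.le hlH) hlH hlM hwU hwH hwN

end Join

section FlagPairing

variable {F : Type*} [DivisionRing F] {V : Type*} [AddCommGroup V] [Module F V]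

variable (F V) in
/-- The bilinear form on chains of flags for which the flags are orthonormal. -/
def flagPairing : FlagChains F V →ₗ[ℤ] FlagChains F V →ₗ[ℤ] ℤ :=
  Finsupp.linearCombination ℤ fun t => (Finsupp.lapply t : FlagChains F V →ₗ[ℤ] ℤ)

theorem flagPairing_single (t : List (Submodule F V)) (c : ℤ) (x : FlagChains F V) :
    flagPairing F V (Finsupp.single t c) x = c * x t := by
  simp [flagPairing]

theorem flagPairing_comm (x y : FlagChains F V) :
    flagPairing F V x y = flagPairing F V y x := by
  classical
  have h : flagPairing F V = (flagPairing F V).flip :=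
    finsupp_linearMap_ext fun s => finsupp_linearMap_ext fun t => by
      simp [flagPairing_single, Finsupp.single_apply, eq_comm]
  exact LinearMap.congr_fun₂ h x y

theorem flagPairing_consTop (U : Submodule F V) (x y : FlagChains F V) :
    flagPairing F V (consTop U x) (consTop U y) = flagPairing F V x y := by
  classical
  have h : (flagPairing F V).compl₁₂ (consTop U) (consTop U) = flagPairing F V :=
    finsupp_linearMap_ext fun s => finsupp_linearMap_ext fun t => by
      simp [flagPairing_single, Finsupp.single_apply]
  exact LinearMap.congr_fun₂ h x y

theorem flagPairing_dropTop {n : ℕ} {U : Submodule F V} {x y : FlagChains F V}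
    (hx : x ∈ flagCycles (n + 1) U) (hy : y ∈ flagCycles (n + 1) U) :
    flagPairing F V (dropTop F V x) (dropTop F V y) = flagPairing F V x y := by
  rw [← flagPairing_consTop U, (mem_flagCycles_succ.1 hx).2.2, (mem_flagCycles_succ.1 hy).2.2]

theorem flagPairing_eq_zero_of_disjoint {S T : Set (List (Submodule F V))} (hST : Disjoint S T)
    {x y : FlagChains F V} (hx : x ∈ Finsupp.supported ℤ ℤ S)
    (hy : y ∈ Finsupp.supported ℤ ℤ T) : flagPairing F V x y = 0 := by
  rw [flagPairing, Finsupp.linearCombination_apply, Finsupp.sum, LinearMap.sum_apply]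
  refine Finset.sum_eq_zero fun t ht => ?_
  have hyt : y t = 0 := (Finsupp.mem_supported' ℤ y).1 hy t (Set.disjoint_left.1 hST (hx ht))
  rw [LinearMap.smul_apply, Finsupp.lapply_apply, hyt, smul_zero]

/-- The largest subspace of a flag, `0` for the empty flag. -/
def flagTop (t : List (Submodule F V)) : Submodule F V := t.headD ⊥

theorem consTop_mem_supported (U : Submodule F V) (x : FlagChains F V) :
    consTop U x ∈ Finsupp.supported ℤ ℤ {t | flagTop t = U} := by
  classical
  intro t ht
  obtain ⟨s, _, rfl⟩ := Finset.mem_image.1 (Finsupp.mapDomain_support ht)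
  rfl

theorem flagCycles_le_supported (n : ℕ) (U : Submodule F V) :
    flagCycles n U ≤ Finsupp.supported ℤ ℤ {t | flagTop t = U} := by
  intro x hx
  cases n with
  | zero =>
    by_cases hU : U = ⊥
    · obtain ⟨c, rfl⟩ := exists_eq_single_of_mem_flagCycles_zero hx
      exact Finsupp.single_mem_supported ℤ _ hU.symm
    · simp [eq_zero_of_mem_flagCycles_zero hU hx]
  | succ n => exact (mem_flagCycles_succ.1 hx).2.2 ▸ consTop_mem_supported U _

theorem hyperplaneCycles_le_supported (n : ℕ) (U : Submodule F V) :
    hyperplaneCycles n U ≤ Finsupp.supported ℤ ℤ {t | flagTop t ⋖ U} :=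
  hyperplaneCycles_le fun H hH => (flagCycles_le_supported n H).trans
    (Finsupp.supported_mono fun t (ht : flagTop t = H) => show flagTop t ⋖ U from ht ▸ hH)

theorem join_mem_supported (w : V) (x : FlagChains F V) :
    join F w x ∈ Finsupp.supported ℤ ℤ {t | w ∈ flagTop t} := by
  suffices LinearMap.range (join F w) ≤ Finsupp.supported ℤ ℤ {t | w ∈ flagTop t} from
    this (LinearMap.mem_range_self _ x)
  rw [join, Finsupp.range_linearCombination, Submodule.span_le]
  rintro _ ⟨t, rfl⟩
  cases t with
  | nil => exact Finsupp.single_mem_supported ℤ _ (Submodule.mem_span_singleton_self w)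
  | cons U t =>
    refine Finsupp.supported_mono (fun s (hs : flagTop s = _) => ?_)
      (consTop_mem_supported (U ⊔ F ∙ w) _)
    rw [Set.mem_ofPred_eq, hs]
    exact Submodule.mem_sup_right (Submodule.mem_span_singleton_self w)

theorem flagPairing_eq_zero_of_ne {n : ℕ} {U U' : Submodule F V} (h : U ≠ U')
    {x y : FlagChains F V} (hx : x ∈ flagCycles n U) (hy : y ∈ flagCycles n U') :
    flagPairing F V x y = 0 :=
  flagPairing_eq_zero_of_disjoint (Set.disjoint_left.2 fun _ h1 h2 => h (h1.symm.trans h2))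
    (flagCycles_le_supported n U hx) (flagCycles_le_supported n U' hy)

theorem flagPairing_dropTop_join_left {w : V} {y : FlagChains F V}
    (hy : y ∈ Finsupp.supported ℤ ℤ {t | w ∉ flagTop t}) (x : FlagChains F V) :
    flagPairing F V (dropTop F V (join F w x)) y = flagPairing F V x y := by
  have hjoin : flagPairing F V (join F w (dropTop F V x)) y = 0 :=
    flagPairing_eq_zero_of_disjoint disjoint_compl_right (join_mem_supported w _) hy
  rw [dropTop_join, map_sub, LinearMap.sub_apply, hjoin, sub_zero]

theorem flagPairing_dropTop_join_right {n : ℕ} {N : Submodule F V} {w : V} {x : FlagChains F V}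
    (hx : x ∈ flagCycles n N) (hw : w ∉ N) (y : FlagChains F V) :
    flagPairing F V x (dropTop F V (join F w y)) = flagPairing F V x y := by
  have hx' : x ∈ Finsupp.supported ℤ ℤ {t | w ∉ flagTop t} :=
    Finsupp.supported_mono (fun t (ht : flagTop t = N) => show w ∉ flagTop t from ht ▸ hw)
      (flagCycles_le_supported n N hx)
  rw [flagPairing_comm, flagPairing_dropTop_join_left hx', flagPairing_comm]

theorem flagPairing_dropTop_join {n : ℕ} {N : Submodule F V} {l l' : V} {a b : FlagChains F V}
    (ha : a ∈ flagCycles n N) (hb : b ∈ flagCycles n N) (hl' : l' ∉ N) (hl : l ∉ N ⊔ F ∙ l') :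
    flagPairing F V (dropTop F V (join F l a)) (dropTop F V (join F l' b)) =
      flagPairing F V a b := by
  have hb' : dropTop F V (join F l' b) ∈ Finsupp.supported ℤ ℤ {t | l ∉ flagTop t} :=
    Finsupp.supported_mono (fun t (ht : flagTop t ⋖ _) h => hl (ht.le h))
      (hyperplaneCycles_le_supported _ _ (dropTop_mem_hyperplaneCycles (join_mem hb hl')))
  rw [flagPairing_dropTop_join_left hb', flagPairing_dropTop_join_right ha hl']

end FlagPairing

section FlagAction

variable {F : Type*} [DivisionRing F] {V : Type*} [AddCommGroup V] [Module F V]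

/-- The action of a linear automorphism on chains of flags. -/
def flagMap (g : V ≃ₗ[F] V) : FlagChains F V →ₗ[ℤ] FlagChains F V :=
  Finsupp.lmapDomain ℤ ℤ (List.map (Submodule.map (g : V →ₗ[F] V)))

@[simp]
theorem flagMap_single (g : V ≃ₗ[F] V) (t : List (Submodule F V)) (c : ℤ) :
    flagMap g (Finsupp.single t c) =
      Finsupp.single (t.map (Submodule.map (g : V →ₗ[F] V))) c :=
  Finsupp.mapDomain_single

theorem flagMap_consTop (g : V ≃ₗ[F] V) (U : Submodule F V) (x : FlagChains F V) :
    flagMap g (consTop U x) = consTop (U.map (g : V →ₗ[F] V)) (flagMap g x) := by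
  have h : flagMap g ∘ₗ consTop U = consTop (U.map (g : V →ₗ[F] V)) ∘ₗ flagMap g :=
    finsupp_linearMap_ext fun t => by simp
  exact LinearMap.congr_fun h x

theorem flagMap_dropTop (g : V ≃ₗ[F] V) (x : FlagChains F V) :
    flagMap g (dropTop F V x) = dropTop F V (flagMap g x) := by
  have h : flagMap g ∘ₗ dropTop F V = dropTop F V ∘ₗ flagMap g :=
    finsupp_linearMap_ext fun t => by cases t <;> simp
  exact LinearMap.congr_fun h x

theorem map_sup_span_singleton (g : V ≃ₗ[F] V) (U : Submodule F V) (v : V) :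
    (U ⊔ F ∙ v).map (g : V →ₗ[F] V) = U.map (g : V →ₗ[F] V) ⊔ F ∙ g v := by
  simp [Submodule.map_sup, Submodule.map_span]

theorem flagMap_join (g : V ≃ₗ[F] V) (v : V) (x : FlagChains F V) :
    flagMap g (join F v x) = join F (g v) (flagMap g x) := by
  suffices h : flagMap g ∘ₗ join F v = join F (g v) ∘ₗ flagMap g from LinearMap.congr_fun h x
  refine finsupp_linearMap_ext fun t => ?_
  induction t with
  | nil => simp [joinFlag, Submodule.map_span]
  | cons U t ih =>
    simp only [LinearMap.comp_apply, join_single] at ih ⊢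
    simp only [joinFlag, flagMap_consTop, map_sub, ih, flagMap_single, List.map_cons, join_single,
      map_sup_span_singleton]

theorem map_covBy_map (g : V ≃ₗ[F] V) {H U : Submodule F V} (h : H ⋖ U) :
    H.map (g : V →ₗ[F] V) ⋖ U.map (g : V →ₗ[F] V) :=
  (apply_covBy_apply_iff (Submodule.orderIsoMapComap g)).2 h

theorem flagMap_mem (g : V ≃ₗ[F] V) {n : ℕ} {U : Submodule F V} {x : FlagChains F V}
    (hx : x ∈ flagCycles n U) : flagMap g x ∈ flagCycles n (U.map (g : V →ₗ[F] V)) := by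
  induction n generalizing U x with
  | zero =>
    by_cases hU : U = ⊥
    · obtain ⟨c, rfl⟩ := exists_eq_single_of_mem_flagCycles_zero hx
      rw [hU, flagMap_single, Submodule.map_bot]
      exact single_nil_mem_flagCycles_bot c
    · simp [eq_zero_of_mem_flagCycles_zero hU hx]
  | succ n ih =>
    obtain ⟨h1, h2, h3⟩ := mem_flagCycles_succ.1 hx
    suffices hyperplaneCycles n U ≤
        (hyperplaneCycles n (U.map (g : V →ₗ[F] V))).comap (flagMap g) by
      rw [mem_flagCycles_succ, ← flagMap_dropTop, ← flagMap_dropTop, h2, map_zero,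
        ← flagMap_consTop, h3]
      exact ⟨this h1, rfl, rfl⟩
    exact hyperplaneCycles_le fun H hH y hy => mem_hyperplaneCycles (map_covBy_map g hH) (ih hy)

theorem map_eq_of_fix {g : V ≃ₗ[F] V} {U : Submodule F V} (hg : ∀ u ∈ U, g u = u) :
    U.map (g : V →ₗ[F] V) = U :=
  SetLike.coe_injective ((Set.image_congr hg).trans (Set.image_id' _))

theorem flagMap_eq_of_fix {g : V ≃ₗ[F] V} {n : ℕ} {U : Submodule F V} {x : FlagChains F V}
    (hg : ∀ u ∈ U, g u = u) (hx : x ∈ flagCycles n U) : flagMap g x = x := by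
  induction n generalizing U x with
  | zero =>
    obtain ⟨c, rfl⟩ := exists_eq_single_of_mem_flagCycles_zero hx
    rw [flagMap_single, List.map_nil]
  | succ n ih =>
    obtain ⟨h1, -, h3⟩ := mem_flagCycles_succ.1 hx
    have fix : Set.EqOn (flagMap g) LinearMap.id (hyperplaneCycles n U) :=
      eqOn_hyperplaneCycles fun H hH y hy => ih (fun u hu => hg u (hH.le hu)) hy
    rw [← h3, flagMap_consTop, map_eq_of_fix hg, fix h1, LinearMap.id_apply]

end FlagAction

section Generic

open Filter

variable {F : Type*} [DivisionRing F] {V : Type*} [AddCommGroup V] [Module F V]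

/-- The filter of generic vectors of `U`, generated by the complements in `U` of the subspaces
which do not contain `U`. Over an infinite field it is a proper filter, so statements which hold
for generic vectors can be combined and then specialized. -/
def generic (U : Submodule F V) : Filter V :=
  𝓟 (U : Set V) ⊓ ⨅ S : {S : Submodule F V // ¬ U ≤ S}, 𝓟 ((S.1 : Set V)ᶜ)

theorem eventually_mem_generic (U : Submodule F V) : ∀ᶠ w in generic U, w ∈ U :=
  (inf_le_left : generic U ≤ _) (mem_principal_self (U : Set V))

theorem eventually_notMem_generic {U S : Submodule F V} (h : ¬ U ≤ S) :
    ∀ᶠ w in generic U, w ∉ S :=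
  (inf_le_right.trans (iInf_le _ (⟨S, h⟩ : {S : Submodule F V // ¬ U ≤ S})) : generic U ≤ _)
    (mem_principal_self ((S : Set V)ᶜ))

instance generic_neBot [Infinite F] (U : Submodule F V) : (generic U).NeBot := by
  classical
  rw [generic, inf_comm, (hasBasis_iInf_principal_finite _).inf_principal_neBot_iff]
  intro t ht
  let s : Finset (Submodule F U) := ht.toFinset.image fun S => S.1.comap U.subtype
  have hs : ⊤ ∉ s := fun h => by
    obtain ⟨S, _, hS⟩ := Finset.mem_image.1 h
    exact S.2 (Submodule.comap_subtype_eq_top.1 hS)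
  obtain ⟨w, hw⟩ := (Set.ne_univ_iff_exists_notMem _).1
    (Subspace.biUnion_ne_univ_of_top_notMem hs)
  refine ⟨w.1, Set.mem_iInter₂.2 fun S hS hwS => hw (Set.mem_iUnion₂.2 ?_), w.2⟩
  exact ⟨S.1.comap U.subtype, Finset.mem_image.2 ⟨S, ht.mem_toFinset.2 hS, rfl⟩, hwS⟩

theorem eventually_generic_sup {N L : Submodule F V} (h : Disjoint N L) {P : V → Prop}
    (hP : ∀ᶠ w in generic N, P w) :
    ∀ᶠ w in generic (N ⊔ L), ∀ n ∈ N, w - n ∈ L → P n := by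
  obtain ⟨M, hLM, hM⟩ := h.symm.exists_isCompl
  have tendsto_projection :
      Tendsto (N.projection M hM.symm) (generic (N ⊔ L)) (generic N) := by
    refine tendsto_inf.2 ⟨tendsto_principal.2 (Eventually.of_forall fun w =>
      Submodule.projection_apply_mem hM.symm w), tendsto_iInf.2 fun S => tendsto_principal.2 ?_⟩
    refine eventually_notMem_generic (S := S.1.comap (N.projection M hM.symm)) fun hle =>
      S.2 fun n hn => ?_
    simpa [Submodule.projection_apply_of_mem_left hM.symm hn] using
      hle (Submodule.mem_sup_left hn)
  filter_upwards [tendsto_projection.eventually hP] with w hw n hn hl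
  have h0 := Submodule.projection_apply_of_mem_right hM.symm (hLM hl)
  rw [map_sub, Submodule.projection_apply_of_mem_left hM.symm hn, sub_eq_zero] at h0
  rwa [h0] at hw

end Generic

section Transitivity

variable {F : Type*} [DivisionRing F] {V : Type*} [AddCommGroup V] [Module F V]

theorem exists_dual_apply_ne_zero₂ {H : Submodule F V} {w w' : V} (hw : w ∉ H) (hw' : w' ∉ H) :
    ∃ f : V →ₗ[F] F, H ≤ LinearMap.ker f ∧ f w ≠ 0 ∧ f w' ≠ 0 := by
  obtain ⟨f, hfw, hf⟩ := Submodule.exists_le_ker_of_notMem hw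
  obtain ⟨f', hfw', hf'⟩ := Submodule.exists_le_ker_of_notMem hw'
  by_cases h : f w' = 0
  · by_cases h' : f' w = 0
    · refine ⟨f + f', fun v hv => ?_, by simpa [h'] using hfw, by simpa [h] using hfw'⟩
      simp [LinearMap.mem_ker.1 (hf hv), LinearMap.mem_ker.1 (hf' hv)]
    · exact ⟨f', hf', h', hfw'⟩
  · exact ⟨f, hf, hfw, h⟩

theorem exists_linearEquiv_fix {H : Submodule F V} {w w' : V} (hw : w ∉ H) (hw' : w' ∉ H) :
    ∃ g : V ≃ₗ[F] V, (∀ h ∈ H, g h = h) ∧ g w = w' := by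
  obtain ⟨f, hfH, hfw, hfw'⟩ := exists_dual_apply_ne_zero₂ hw hw'
  have hunit : IsUnit (1 + f ((f w)⁻¹ • (w' - w))) := by
    rw [map_smul, map_sub, smul_eq_mul, mul_sub, inv_mul_cancel₀ hfw, add_sub_cancel]
    exact (mul_ne_zero (inv_ne_zero hfw) hfw').isUnit
  refine ⟨LinearEquiv.dilatransvection hunit, fun h hh => ?_, ?_⟩
  · rw [LinearEquiv.dilatransvection.apply, hfH hh, zero_smul, add_zero]
  · rw [LinearEquiv.dilatransvection.apply, smul_smul, mul_inv_cancel₀ hfw, one_smul,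
      add_sub_cancel]

theorem apply_notMem_map (g : V ≃ₗ[F] V) {H : Submodule F V} {w : V} (hw : w ∉ H) :
    g w ∉ H.map (g : V →ₗ[F] V) := by
  rintro ⟨v, hv, hvw⟩
  exact hw (g.injective hvw ▸ hv)

theorem exists_linearEquiv_fix₂ {N : Submodule F V} {p q p' q' : V} (hp : p ∉ N)
    (hq : q ∉ N ⊔ F ∙ p) (hp' : p' ∉ N) (hq' : q' ∉ N ⊔ F ∙ p') :
    ∃ g : V ≃ₗ[F] V, (∀ h ∈ N, g h = h) ∧ g p = p' ∧ g q = q' := by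
  obtain ⟨g, hg, hgp⟩ := exists_linearEquiv_fix hp hp'
  have hgq : g q ∉ N ⊔ F ∙ p' := by
    rw [← hgp]
    nth_rw 1 [← map_eq_of_fix hg]
    rw [← map_sup_span_singleton]
    exact apply_notMem_map g hq
  obtain ⟨g', hg', hgq'⟩ := exists_linearEquiv_fix hgq hq'
  refine ⟨g.trans g', fun h hh => ?_, ?_, hgq'⟩
  · rw [LinearEquiv.trans_apply, hg h hh, hg' h (Submodule.mem_sup_left hh)]
  · rw [LinearEquiv.trans_apply, hgp,
      hg' _ (Submodule.mem_sup_right (Submodule.mem_span_singleton_self p'))]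

end Transitivity

section EquivariantForms

variable {F : Type*} [DivisionRing F] {V : Type*} [AddCommGroup V] [Module F V] {A : Type*}
  [AddCommGroup A] {β : Submodule F V → V → FlagChains F V →ₗ[ℤ] FlagChains F V →ₗ[ℤ] A}

theorem notMem_sup_comm {N : Submodule F V} {p q : V} (hp : p ∉ N) (hq : q ∉ N ⊔ F ∙ p) :
    p ∉ N ⊔ F ∙ q := fun h => by
  have heq : N ⊔ F ∙ p = N ⊔ F ∙ q :=
    sup_span_singleton_eq (covBy_sup_span_singleton fun h => hq (Submodule.mem_sup_left h)) h hp
  exact hq (heq ▸ Submodule.mem_sup_right (Submodule.mem_span_singleton_self q))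

theorem finrank_of_covBy [FiniteDimensional F V] {H U : Submodule F V} (h : H ⋖ U) :
    Module.finrank F U = Module.finrank F H + 1 := by
  obtain ⟨w, hwU, hwH⟩ := Set.exists_of_ssubset h.lt
  rw [← sup_span_singleton_eq h hwU hwH, Submodule.finrank_sup_span_singleton hwH]

theorem exists_notMem_of_finrank_lt {H : Submodule F V}
    (h : Module.finrank F H < Module.finrank F V) : ∃ w, w ∉ H :=
  SetLike.exists_not_mem_of_ne_top H (fun hH => by rw [hH, finrank_top] at h; exact h.false) rfl

theorem join_mem_of_mem_hyperplaneCycles {m : ℕ} {U : Submodule F V} {x : FlagChains F V} {w : V}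
    (hx : x ∈ hyperplaneCycles m U) (hw : w ∈ U) (hw0 : w ≠ 0) :
    join F w x ∈ flagCycles (m + 1) U := by
  suffices hyperplaneCycles m U ≤ (flagCycles (m + 1) U).comap (join F w) from this hx
  refine hyperplaneCycles_le fun H hH h hh => ?_
  rw [Submodule.mem_comap]
  by_cases hwH : w ∈ H
  · rw [join_eq_zero hh hwH hw0]
    exact Submodule.zero_mem _
  · exact join_mem_of_covBy hH hh hw hwH

/-- Equivariance, under the linear automorphisms of `V`, of a family of bilinear forms `β U w` on
the cycles of the `n`-dimensional subspaces `U` of `V`, depending on a vector `w` of `U`. The forms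
are defined on all chains, and for all `U` and `w`, but only these values are relevant. -/
def IsEquivariantForm (n : ℕ)
    (β : Submodule F V → V → FlagChains F V →ₗ[ℤ] FlagChains F V →ₗ[ℤ] A) : Prop :=
  ∀ (g : V ≃ₗ[F] V) (U : Submodule F V) (w : V), Module.finrank F U = n → w ∈ U →
    ∀ x ∈ flagCycles n U, ∀ y ∈ flagCycles n U,
      β (U.map (g : V →ₗ[F] V)) (g w) (flagMap g x) (flagMap g y) = β U w x y

/-- The form `(x, y) ↦ β U w (w * x) (w * y)`, where `*` is the join. -/
def joinForm (β : Submodule F V → V → FlagChains F V →ₗ[ℤ] FlagChains F V →ₗ[ℤ] A)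
    (U : Submodule F V) (w : V) : FlagChains F V →ₗ[ℤ] FlagChains F V →ₗ[ℤ] A :=
  (β U w).compl₁₂ (join F w) (join F w)

theorem joinForm_apply (U : Submodule F V) (w : V) (x y : FlagChains F V) :
    joinForm β U w x y = β U w (join F w x) (join F w y) :=
  rfl

theorem joinForm_map {m : ℕ} (hβ : IsEquivariantForm (m + 1) β) (g : V ≃ₗ[F] V)
    {U : Submodule F V} {w : V} {x y : FlagChains F V} (hU : Module.finrank F U = m + 1)
    (hw : w ∈ U) (hw0 : w ≠ 0) (hx : x ∈ hyperplaneCycles m U) (hy : y ∈ hyperplaneCycles m U) :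
    joinForm β (U.map (g : V →ₗ[F] V)) (g w) (flagMap g x) (flagMap g y) = joinForm β U w x y := by
  rw [joinForm_apply, joinForm_apply, ← flagMap_join, ← flagMap_join]
  exact hβ g U w hU hw _ (join_mem_of_mem_hyperplaneCycles hx hw hw0) _
    (join_mem_of_mem_hyperplaneCycles hy hw hw0)

/-- The forms induced by `β` on the cycles of subspaces `H` of one dimension less: the forms
`joinForm β (H ⊔ F ∙ w) w`, for any vector `w` outside of `H`. They do not depend on a vector
of `H`. -/
def hyperplaneForm (β : Submodule F V → V → FlagChains F V →ₗ[ℤ] FlagChains F V →ₗ[ℤ] A)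
    (H : Submodule F V) (_ : V) : FlagChains F V →ₗ[ℤ] FlagChains F V →ₗ[ℤ] A :=
  let w : V := Classical.epsilon fun w => w ∉ H
  joinForm β (H ⊔ F ∙ w) w

theorem joinForm_map_sup_span_singleton [FiniteDimensional F V] {m : ℕ}
    (hβ : IsEquivariantForm (m + 1) β) (g : V ≃ₗ[F] V) {H : Submodule F V} {w : V}
    {a b : FlagChains F V} (hH : Module.finrank F H = m) (hw : w ∉ H) (ha : a ∈ flagCycles m H)
    (hb : b ∈ flagCycles m H) :
    joinForm β (H.map (g : V →ₗ[F] V) ⊔ F ∙ g w) (g w) (flagMap g a) (flagMap g b) =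
      joinForm β (H ⊔ F ∙ w) w a b := by
  have hcov := covBy_sup_span_singleton hw
  rw [← map_sup_span_singleton]
  exact joinForm_map hβ g (by rw [Submodule.finrank_sup_span_singleton hw, hH])
    (Submodule.mem_sup_right (Submodule.mem_span_singleton_self w)) (ne_zero_of_notMem hw)
    (mem_hyperplaneCycles hcov ha) (mem_hyperplaneCycles hcov hb)

theorem hyperplaneForm_eq [FiniteDimensional F V] {m : ℕ} (hβ : IsEquivariantForm (m + 1) β)
    {H : Submodule F V} {w : V} {a b : FlagChains F V} (hH : Module.finrank F H = m) (hw : w ∉ H)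
    (v : V) (ha : a ∈ flagCycles m H) (hb : b ∈ flagCycles m H) :
    hyperplaneForm β H v a b = joinForm β (H ⊔ F ∙ w) w a b := by
  obtain ⟨g, hg, hgw⟩ :=
    exists_linearEquiv_fix hw (Classical.epsilon_spec (p := fun w => w ∉ H) ⟨w, hw⟩)
  have h := joinForm_map_sup_span_singleton hβ g hH hw ha hb
  rwa [map_eq_of_fix hg, flagMap_eq_of_fix hg ha, flagMap_eq_of_fix hg hb, hgw] at h

theorem isEquivariantForm_hyperplaneForm [FiniteDimensional F V] {m : ℕ}
    (hβ : IsEquivariantForm (m + 1) β) (hm : m < Module.finrank F V) :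
    IsEquivariantForm m (hyperplaneForm β) := fun g H v hH _ a ha b hb => by
  obtain ⟨w, hw⟩ := exists_notMem_of_finrank_lt (hH.trans_lt hm)
  rw [hyperplaneForm_eq hβ hH hw v ha hb,
    hyperplaneForm_eq hβ ((LinearEquiv.finrank_map_eq g H).trans hH) (apply_notMem_map g hw) (g v)
      (flagMap_mem g ha) (flagMap_mem g hb)]
  exact joinForm_map_sup_span_singleton hβ g hH hw ha hb

/-- The form `(a, b) ↦ β U w (w * p * a) (w * q * b)` for `U = N ⊔ F ∙ p ⊔ F ∙ q` and
`w = v + p + q`, where `*` is the join. -/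
def twoLineForm (β : Submodule F V → V → FlagChains F V →ₗ[ℤ] FlagChains F V →ₗ[ℤ] A)
    (N : Submodule F V) (p q v : V) : FlagChains F V →ₗ[ℤ] FlagChains F V →ₗ[ℤ] A :=
  (joinForm β (N ⊔ F ∙ p ⊔ F ∙ q) (v + p + q)).compl₁₂ (join F p) (join F q)

theorem twoLineForm_map [FiniteDimensional F V] {k : ℕ} (hβ : IsEquivariantForm (k + 1 + 1) β)
    (g : V ≃ₗ[F] V) {N : Submodule F V} {p q v : V} {a b : FlagChains F V}
    (hN : Module.finrank F N = k) (hp : p ∉ N) (hq : q ∉ N ⊔ F ∙ p) (hv : v ∈ N)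
    (ha : a ∈ flagCycles k N) (hb : b ∈ flagCycles k N) :
    twoLineForm β (N.map (g : V →ₗ[F] V)) (g p) (g q) (g v) (flagMap g a) (flagMap g b) =
      twoLineForm β N p q v a b := by
  have hqN : q ∉ N := fun h => hq (Submodule.mem_sup_left h)
  have hvp : v + p ∈ N ⊔ F ∙ p := Submodule.add_mem_sup hv (Submodule.mem_span_singleton_self p)
  have hw0 : v + p + q ≠ 0 :=
    ne_zero_of_notMem fun h => hq ((Submodule.add_mem_iff_right _ hvp).1 h)
  have hcov : N ⊔ F ∙ q ⋖ N ⊔ F ∙ p ⊔ F ∙ q := by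
    rw [sup_right_comm]
    exact covBy_sup_span_singleton (notMem_sup_comm hp hq)
  have h := joinForm_map hβ g
    (by rw [Submodule.finrank_sup_span_singleton hq, Submodule.finrank_sup_span_singleton hp, hN])
    (Submodule.add_mem_sup hvp (Submodule.mem_span_singleton_self q)) hw0
    (mem_hyperplaneCycles (covBy_sup_span_singleton hq) (join_mem ha hp))
    (mem_hyperplaneCycles hcov (join_mem hb hqN))
  rwa [map_sup_span_singleton, map_sup_span_singleton, map_add, map_add, flagMap_join,
    flagMap_join] at h

/-- The forms induced by `β` on the cycles of subspaces `N` of two dimensions less: the forms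
`twoLineForm β N p q v`, for any `p` and `q` which are independent modulo `N`. -/
def codimTwoForm (β : Submodule F V → V → FlagChains F V →ₗ[ℤ] FlagChains F V →ₗ[ℤ] A)
    (N : Submodule F V) (v : V) : FlagChains F V →ₗ[ℤ] FlagChains F V →ₗ[ℤ] A :=
  let r : V × V := Classical.epsilon fun r => r.1 ∉ N ∧ r.2 ∉ N ⊔ F ∙ r.1
  twoLineForm β N r.1 r.2 v

theorem codimTwoForm_eq [FiniteDimensional F V] {k : ℕ} (hβ : IsEquivariantForm (k + 1 + 1) β)
    {N : Submodule F V} {p q v : V} {a b : FlagChains F V} (hN : Module.finrank F N = k)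
    (hp : p ∉ N) (hq : q ∉ N ⊔ F ∙ p) (hv : v ∈ N) (ha : a ∈ flagCycles k N)
    (hb : b ∈ flagCycles k N) : codimTwoForm β N v a b = twoLineForm β N p q v a b := by
  obtain ⟨hp', hq'⟩ := Classical.epsilon_spec (p := fun r : V × V => r.1 ∉ N ∧ r.2 ∉ N ⊔ F ∙ r.1)
    ⟨(p, q), hp, hq⟩
  obtain ⟨g, hg, hgp, hgq⟩ := exists_linearEquiv_fix₂ hp hq hp' hq'
  have h := twoLineForm_map hβ g hN hp hq hv ha hb
  rwa [map_eq_of_fix hg, flagMap_eq_of_fix hg ha, flagMap_eq_of_fix hg hb, hgp, hgq, hg v hv] at h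

theorem isEquivariantForm_codimTwoForm [FiniteDimensional F V] {k : ℕ}
    (hβ : IsEquivariantForm (k + 1 + 1) β) (hk : k + 1 < Module.finrank F V) :
    IsEquivariantForm k (codimTwoForm β) := fun g N v hN hv a ha b hb => by
  obtain ⟨p, hp⟩ := exists_notMem_of_finrank_lt (H := N) (by lia)
  obtain ⟨q, hq⟩ := exists_notMem_of_finrank_lt (H := N ⊔ F ∙ p)
    (by rwa [Submodule.finrank_sup_span_singleton hp, hN])
  have hgq : g q ∉ N.map (g : V →ₗ[F] V) ⊔ F ∙ g p := by
    rw [← map_sup_span_singleton]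
    exact apply_notMem_map g hq
  have hgv : g v ∈ N.map (g : V →ₗ[F] V) := Submodule.mem_map_of_mem hv
  rw [codimTwoForm_eq hβ hN hp hq hv ha hb,
    codimTwoForm_eq hβ ((LinearEquiv.finrank_map_eq g N).trans hN) (apply_notMem_map g hp) hgq hgv
      (flagMap_mem g ha) (flagMap_mem g hb)]
  exact twoLineForm_map hβ g hN hp hq hv ha hb

end EquivariantForms

section GenericFormula

open Filter

variable {F : Type*} [DivisionRing F] {V : Type*} [AddCommGroup V] [Module F V] {A : Type*}
  [AddCommGroup A] {β : Submodule F V → V → FlagChains F V →ₗ[ℤ] FlagChains F V →ₗ[ℤ] A}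

theorem eventually_generic_sup_span_singleton {N : Submodule F V} {l : V} (hl : l ∉ N)
    {P : V → Prop} (hP : ∀ᶠ v in generic N, P v) :
    ∀ᶠ w in generic (N ⊔ F ∙ l), ∃ v, ∃ s : F, s ≠ 0 ∧ P v ∧ w = v + s • l := by
  filter_upwards [eventually_mem_generic _,
    eventually_notMem_generic (covBy_sup_span_singleton hl).lt.not_ge,
    eventually_generic_sup (Submodule.disjoint_span_singleton_of_notMem hl) hP] with w hw hwN hPw
  obtain ⟨v, hv, y, hy, rfl⟩ := Submodule.mem_sup.1 hw
  obtain ⟨s, rfl⟩ := Submodule.mem_span_singleton.1 hy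
  refine ⟨v, s, fun hs => hwN ?_, hPw v hv (by rwa [add_sub_cancel_left]), rfl⟩
  rwa [hs, zero_smul, add_zero]

theorem eventually_ne_zero_generic {U : Submodule F V} (hU : U ≠ ⊥) :
    ∀ᶠ w in generic U, w ≠ 0 := by
  filter_upwards [eventually_notMem_generic (mt le_bot_iff.1 hU)] with w hw
  exact ne_zero_of_notMem hw

theorem eventually_eq_of_mem_span {ι R M N P : Type*} [CommRing R] [AddCommGroup M] [Module R M]
    [AddCommGroup N] [Module R N] [AddCommGroup P] [Module R P] {l : Filter ι}
    {B : ι → M →ₗ[R] N →ₗ[R] P} {C : M →ₗ[R] N →ₗ[R] P} {s : Set M} {t : Set N}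
    (h : ∀ x ∈ s, ∀ y ∈ t, ∀ᶠ i in l, B i x y = C x y) {x : M} {y : N}
    (hx : x ∈ Submodule.span R s) (hy : y ∈ Submodule.span R t) :
    ∀ᶠ i in l, B i x y = C x y := by
  induction hx, hy using Submodule.span_induction₂ with
  | mem_mem x y hx hy => exact h x hx y hy
  | zero_left y => exact .of_forall fun i => by simp
  | zero_right x => exact .of_forall fun i => by simp
  | add_left x x' y _ _ _ h h' => filter_upwards [h, h'] with i h h'; simp [h, h']
  | add_right x y y' _ _ _ h h' => filter_upwards [h, h'] with i h h'; simp [h, h']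
  | smul_left r x y _ _ h => filter_upwards [h] with i h; simp [h]
  | smul_right r x y _ _ h => filter_upwards [h] with i h; simp [h]

/-- On the cycles of every `n`-dimensional subspace `U`, the form `β U w` is the multiple `c` of the
standard form for generic `w`. How generic `w` has to be may depend on the two cycles. -/
def IsGenericMultiple (n : ℕ)
    (β : Submodule F V → V → FlagChains F V →ₗ[ℤ] FlagChains F V →ₗ[ℤ] A) (c : A) : Prop :=
  ∀ U : Submodule F V, Module.finrank F U = n → ∀ x ∈ flagCycles n U, ∀ y ∈ flagCycles n U,
    ∀ᶠ w in generic U, β U w x y = flagPairing F V x y • c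

theorem isGenericMultiple_zero [FiniteDimensional F V]
    (β : Submodule F V → V → FlagChains F V →ₗ[ℤ] FlagChains F V →ₗ[ℤ] A) :
    IsGenericMultiple 0 β (β ⊥ 0 (Finsupp.single [] 1) (Finsupp.single [] 1)) := by
  intro U hU x hx y hy
  obtain rfl := Submodule.finrank_eq_zero.1 hU
  filter_upwards [eventually_mem_generic _] with w hw
  obtain rfl := (Submodule.mem_bot F).1 hw
  obtain ⟨a, rfl⟩ := exists_eq_single_of_mem_flagCycles_zero hx
  obtain ⟨b, rfl⟩ := exists_eq_single_of_mem_flagCycles_zero hy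
  rw [← Finsupp.smul_single_one, ← Finsupp.smul_single_one [] b, map_smul, map_smul,
    LinearMap.smul_apply, LinearMap.map_smul₂, map_smul, flagPairing_single]
  simp [smul_smul, mul_comm]

theorem eventually_joinForm_eq_of_covBy [Infinite F] [FiniteDimensional F V] {m : ℕ}
    (hβ : IsEquivariantForm (m + 1) β) {c : A} (hc : IsGenericMultiple m (hyperplaneForm β) c)
    {U H : Submodule F V} (hU : Module.finrank F U = m + 1) (hH : H ⋖ U) {x y : FlagChains F V}
    (hx : x ∈ flagCycles m H) (hy : y ∈ flagCycles m H) :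
    ∀ᶠ w in generic U, joinForm β U w x y = flagPairing F V x y • c := by
  have hHm : Module.finrank F H = m := Nat.succ_injective ((finrank_of_covBy hH).symm.trans hU)
  obtain ⟨v, hv⟩ := (hc H hHm x hx y hy).exists
  filter_upwards [eventually_mem_generic U, eventually_notMem_generic hH.lt.not_ge] with w hw hwH
  rwa [hyperplaneForm_eq hβ hHm hwH v hx hy, sup_span_singleton_eq hH hw hwH] at hv

theorem eventually_joinForm_join_join [FiniteDimensional F V] {k : ℕ}
    (hβ : IsEquivariantForm (k + 1 + 1) β) {c : A} {N : Submodule F V} {l l' : V}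
    {a b : FlagChains F V} (hN : Module.finrank F N = k) (hl : l ∉ N) (hl' : l' ∉ N ⊔ F ∙ l)
    (ha : a ∈ flagCycles k N) (hb : b ∈ flagCycles k N)
    (hc : ∀ᶠ v in generic N, codimTwoForm β N v a b = flagPairing F V a b • c) :
    ∀ᶠ w in generic (N ⊔ F ∙ l ⊔ F ∙ l'),
      joinForm β (N ⊔ F ∙ l ⊔ F ∙ l') w (join F l a) (join F l' b) = flagPairing F V a b • c := by
  filter_upwards [eventually_generic_sup_span_singleton hl'
    (eventually_generic_sup_span_singleton hl (hc.and (eventually_mem_generic N)))]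
  rintro _ ⟨_, t, ht, ⟨v, s, hs, ⟨hvc, hv⟩, rfl⟩, rfl⟩
  have hsl : F ∙ (s • l) = F ∙ l := Submodule.span_singleton_smul_eq (IsUnit.mk0 s hs) l
  have htl' : F ∙ (t • l') = F ∙ l' := Submodule.span_singleton_smul_eq (IsUnit.mk0 t ht) l'
  have hs' : s • l ∉ N := by rwa [Submodule.smul_mem_iff _ hs]
  have ht' : t • l' ∉ N ⊔ F ∙ (s • l) := by rwa [hsl, Submodule.smul_mem_iff _ ht]
  rw [← hvc, codimTwoForm_eq hβ hN hs' ht' hv ha hb, twoLineForm, hsl, htl', join_smul hs,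
    join_smul ht, LinearMap.compl₁₂_apply]

theorem eventually_joinForm_eq_of_ne [FiniteDimensional F V] {k : ℕ}
    (hβ : IsEquivariantForm (k + 1 + 1) β) {c : A} (hc : IsGenericMultiple k (codimTwoForm β) c)
    {U H H' : Submodule F V} (hU : Module.finrank F U = k + 1 + 1) (hH : H ⋖ U) (hH' : H' ⋖ U)
    (hne : H ≠ H') {x y : FlagChains F V} (hx : x ∈ flagCycles (k + 1) H)
    (hy : y ∈ flagCycles (k + 1) H') :
    ∀ᶠ w in generic U,
      joinForm β U w x y = flagPairing F V (dropTop F V x) (dropTop F V y) • c := by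
  have hNH' : H ⊓ H' ⋖ H' := inf_covBy_of_covBy hH' hH hne.symm
  have hNH : H ⊓ H' ⋖ H := inf_comm H H' ▸ inf_covBy_of_covBy hH hH' hne
  have hNk : Module.finrank F (H ⊓ H' : Submodule F V) = k := by
    have hHU := finrank_of_covBy hH
    have hNH := finrank_of_covBy hNH
    lia
  refine eventually_eq_of_mem_span (C := ((flagPairing F V).compl₁₂ (dropTop F V)
    (dropTop F V)).compr₂ (LinearMap.toSpanSingleton ℤ A c)) ?_ (flagCycles_le_joinSpan hNH hx)
    (flagCycles_le_joinSpan hNH' hy)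
  rintro _ ⟨l, a, hlH, hlN, ha, rfl⟩ _ ⟨l', b, hlH', hlN', hb, rfl⟩
  have heqH : H ⊓ H' ⊔ F ∙ l = H := sup_span_singleton_eq hNH hlH hlN
  have heqH' : H ⊓ H' ⊔ F ∙ l' = H' := sup_span_singleton_eq hNH' hlH' hlN'
  have hl'H : l' ∉ H := fun h => hlN' ⟨h, hlH'⟩
  have heqU : H ⊓ H' ⊔ F ∙ l ⊔ F ∙ l' = U := by
    rw [heqH, sup_span_singleton_eq hH (hH'.le hlH') hl'H]
  have hlH' : l ∉ H ⊓ H' ⊔ F ∙ l' := heqH'.symm ▸ fun h => hlN ⟨hlH, h⟩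
  have h := eventually_joinForm_join_join hβ hNk hlN (heqH.symm ▸ hl'H) ha hb
    (hc _ hNk a ha b hb)
  rw [heqU, ← flagPairing_dropTop_join ha hb hlN' hlH'] at h
  exact h

theorem isGenericMultiple_of_joinForm {m : ℕ} {c c' : A}
    (h : ∀ U : Submodule F V, Module.finrank F U = m + 1 → ∀ H, H ⋖ U → ∀ H', H' ⋖ U →
      ∀ x ∈ flagCycles m H, ∀ y ∈ flagCycles m H', ∀ᶠ w in generic U, joinForm β U w x y =
        flagPairing F V x y • c + flagPairing F V (dropTop F V x) (dropTop F V y) • c') :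
    IsGenericMultiple (m + 1) β c := by
  intro U hU x hx y hy
  have hU0 : U ≠ ⊥ := by
    rintro rfl
    rw [finrank_bot] at hU
    exact m.succ_ne_zero hU.symm
  have hjoin : ∀ᶠ w in generic U, joinForm β U w (dropTop F V x) (dropTop F V y) =
      flagPairing F V (dropTop F V x) (dropTop F V y) • c +
        flagPairing F V (dropTop F V (dropTop F V x)) (dropTop F V (dropTop F V y)) • c' := by
    refine eventually_eq_of_mem_span
      (C := (flagPairing F V).compr₂ (LinearMap.toSpanSingleton ℤ A c) +
        ((flagPairing F V).compl₁₂ (dropTop F V) (dropTop F V)).compr₂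
          (LinearMap.toSpanSingleton ℤ A c')) ?_
      (dropTop_mem_hyperplaneCycles hx) (dropTop_mem_hyperplaneCycles hy)
    rintro x ⟨H, hH, hx⟩ y ⟨H', hH', hy⟩
    exact h U hU H hH H' hH' x hx y hy
  filter_upwards [eventually_mem_generic U, eventually_ne_zero_generic hU0, hjoin] with w hw hw0 h
  rw [joinForm_apply, join_dropTop hx hw hw0, join_dropTop hy hw hw0, dropTop_dropTop hx, map_zero,
    LinearMap.zero_apply, zero_smul, add_zero] at h
  rw [h, flagPairing_dropTop hx hy]

theorem isGenericMultiple_one [Infinite F] [FiniteDimensional F V] (hβ : IsEquivariantForm 1 β)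
    {c : A} (hc : IsGenericMultiple 0 (hyperplaneForm β) c) : IsGenericMultiple 1 β c := by
  refine isGenericMultiple_of_joinForm (c' := 0) fun U hU H hH H' hH' x hx y hy => ?_
  have eq_bot : ∀ H, H ⋖ U → H = ⊥ := fun H hH =>
    Submodule.finrank_eq_zero.1 (Nat.succ_injective ((finrank_of_covBy hH).symm.trans hU))
  obtain rfl : H' = H := (eq_bot H' hH').trans (eq_bot H hH).symm
  simpa using eventually_joinForm_eq_of_covBy hβ hc hU hH hx hy

theorem isGenericMultiple_add_two [Infinite F] [FiniteDimensional F V] {k : ℕ}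
    (hβ : IsEquivariantForm (k + 1 + 1) β) {c₁ c₂ : A}
    (hc₁ : IsGenericMultiple (k + 1) (hyperplaneForm β) c₁)
    (hc₂ : IsGenericMultiple k (codimTwoForm β) c₂) :
    IsGenericMultiple (k + 1 + 1) β (c₁ - c₂) := by
  refine isGenericMultiple_of_joinForm (c' := c₂) fun U hU H hH H' hH' x hx y hy => ?_
  by_cases hne : H = H'
  · subst hne
    filter_upwards [eventually_joinForm_eq_of_covBy hβ hc₁ hU hH hx hy] with w hw
    rw [hw, flagPairing_dropTop hx hy, ← smul_add, sub_add_cancel]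
  · rw [flagPairing_eq_zero_of_ne hne hx hy, zero_smul]
    simpa only [zero_add] using eventually_joinForm_eq_of_ne hβ hc₂ hU hH hH' hne hx hy

theorem exists_isGenericMultiple [Infinite F] [FiniteDimensional F V] {n : ℕ}
    (hβ : IsEquivariantForm n β) (hn : n ≤ Module.finrank F V) :
    ∃ c : A, IsGenericMultiple n β c := by
  induction n using Nat.strong_induction_on generalizing β with
  | _ n ih =>
    match n with
    | 0 => exact ⟨_, isGenericMultiple_zero β⟩
    | 1 =>
      obtain ⟨c, hc⟩ := ih 0 one_pos (isEquivariantForm_hyperplaneForm hβ hn) (Nat.zero_le _)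
      exact ⟨c, isGenericMultiple_one hβ hc⟩
    | k + 2 =>
      obtain ⟨c₁, hc₁⟩ := ih (k + 1) (by lia) (isEquivariantForm_hyperplaneForm hβ hn) (by lia)
      obtain ⟨c₂, hc₂⟩ := ih k (by lia) (isEquivariantForm_codimTwoForm hβ hn) (by lia)
      exact ⟨c₁ - c₂, isGenericMultiple_add_two hβ hc₁ hc₂⟩

theorem exists_flagPairing_eq_one [Infinite F] [FiniteDimensional F V] {n : ℕ}
    {U : Submodule F V} (hU : Module.finrank F U = n) :
    ∃ x ∈ flagCycles n U, ∃ y ∈ flagCycles n U, flagPairing F V x y = 1 := by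
  induction n generalizing U with
  | zero =>
    obtain rfl := Submodule.finrank_eq_zero.1 hU
    exact ⟨_, single_nil_mem_flagCycles_bot 1, _, single_nil_mem_flagCycles_bot 1,
      by simp [flagPairing_single]⟩
  | succ n ih =>
    have hU0 : ⊥ < U := bot_lt_iff_ne_bot.2 fun h => by
      rw [h, finrank_bot] at hU
      exact n.succ_ne_zero hU.symm
    obtain ⟨N, -, hN⟩ := exists_le_covBy_of_lt hU0
    obtain ⟨a, ha, b, hb, hab⟩ := ih (Nat.succ_injective ((finrank_of_covBy hN).symm.trans hU))
    obtain ⟨w, hwU, hwN⟩ := Set.exists_of_ssubset hN.lt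
    have hwa := join_mem_of_covBy hN ha hwU hwN
    have tops_covBy := hyperplaneCycles_le_supported n U (dropTop_mem_hyperplaneCycles hwa)
    have hev : ∀ᶠ w' in generic U,
        ∀ t ∈ (dropTop F V (join F w a)).support, w' ∉ flagTop t :=
      (Finset.eventually_all _).2 fun t ht =>
        eventually_notMem_generic (CovBy.lt (tops_covBy ht)).not_ge
    obtain ⟨w', hw'U, hw'N, hw'⟩ := ((eventually_mem_generic U).and
      ((eventually_notMem_generic hN.lt.not_ge).and hev)).exists
    have hw'b := join_mem_of_covBy hN hb hw'U hw'N
    have hwa' : dropTop F V (join F w a) ∈ Finsupp.supported ℤ ℤ {t | w' ∉ flagTop t} := hw'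
    refine ⟨join F w a, hwa, join F w' b, hw'b, ?_⟩
    calc flagPairing F V (join F w a) (join F w' b)
        = flagPairing F V (dropTop F V (join F w a)) (dropTop F V (join F w' b)) :=
          (flagPairing_dropTop hwa hw'b).symm
      _ = flagPairing F V (dropTop F V (join F w a)) b := by
          rw [flagPairing_comm, flagPairing_dropTop_join_left hwa', flagPairing_comm]
      _ = flagPairing F V b a := by
          rw [flagPairing_comm, flagPairing_dropTop_join_right hb hwN]
      _ = 1 := by rw [flagPairing_comm, hab]

end GenericFormula

section ProperFlags

variable {F : Type*} [DivisionRing F] {V : Type*} [AddCommGroup V] [Module F V]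
  {U H : Submodule F V}

/-- The lists `[W₁, …, Wₙ]` for which `U > W₁ > ⋯ > Wₙ > 0` is a flag of `U`. If `U` has dimension
`n + 1`, these are the complete flags of `U`, without their top member. -/
def properFlags (n : ℕ) (U : Submodule F V) : Set (List (Submodule F V)) :=
  {t | t.length = n ∧ (U :: (t ++ [⊥])).IsChain (· > ·)}

@[simp]
theorem nil_mem_properFlags {n : ℕ} : [] ∈ properFlags n U ↔ n = 0 ∧ U ≠ ⊥ := by
  simp [properFlags, bot_lt_iff_ne_bot, eq_comm]

@[simp]
theorem cons_mem_properFlags {n : ℕ} {t : List (Submodule F V)} :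
    H :: t ∈ properFlags (n + 1) U ↔ H < U ∧ t ∈ properFlags n H := by
  simp [properFlags, and_left_comm]

theorem lt_finrank_of_mem_properFlags [FiniteDimensional F V] {n : ℕ} {t : List (Submodule F V)}
    (ht : t ∈ properFlags n U) : n < Module.finrank F U := by
  induction n generalizing U t with
  | zero =>
    obtain rfl := List.length_eq_zero_iff.1 ht.1
    exact Nat.pos_of_ne_zero fun h => (nil_mem_properFlags.1 ht).2 (Submodule.finrank_eq_zero.1 h)
  | succ n ih =>
    obtain ⟨H, t, rfl⟩ := List.exists_cons_of_length_eq_add_one ht.1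
    obtain ⟨hHU, ht⟩ := cons_mem_properFlags.1 ht
    exact (Nat.succ_le_of_lt (ih ht)).trans_lt (Submodule.finrank_lt_finrank_of_lt hHU)

theorem finrank_of_cons_mem_properFlags [FiniteDimensional F V] {n : ℕ}
    {t : List (Submodule F V)} (hU : Module.finrank F U = n + 2)
    (ht : H :: t ∈ properFlags (n + 1) U) : Module.finrank F H = n + 1 := by
  obtain ⟨hHU, ht⟩ := cons_mem_properFlags.1 ht
  have := lt_finrank_of_mem_properFlags ht
  have := Submodule.finrank_lt_finrank_of_lt hHU
  omega

theorem covBy_of_finrank_eq [FiniteDimensional F V] (h : H < U)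
    (hU : Module.finrank F U = Module.finrank F H + 1) : H ⋖ U := by
  refine ⟨h, fun K h1 h2 => ?_⟩
  have := Submodule.finrank_lt_finrank_of_lt h1
  have := Submodule.finrank_lt_finrank_of_lt h2
  omega

theorem eq_single_nil_of_mem_supported {x : FlagChains F V}
    (hx : x ∈ Finsupp.supported ℤ ℤ (properFlags 0 U)) : ∃ c, x = Finsupp.single [] c := by
  refine ⟨x [], Finsupp.support_subset_singleton.1 fun t ht => ?_⟩
  exact Finset.mem_singleton.2 (List.length_eq_zero_iff.1 (hx ht).1)

theorem apply_nil_of_mem_supported {n : ℕ} {x : FlagChains F V}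
    (hx : x ∈ Finsupp.supported ℤ ℤ (properFlags (n + 1) U)) : x [] = 0 := by
  by_contra h
  simpa using hx (Finsupp.mem_support_iff.2 h)

end ProperFlags

section Faces

variable {F : Type*} [DivisionRing F] {V : Type*} [AddCommGroup V] [Module F V]

/-- The face operator which removes the `i`-th largest subspace, counted from zero, of each flag;
unlike `dropTop`, it keeps the flags which are too short. -/
def eraseFlag (i : ℕ) : FlagChains F V →ₗ[ℤ] FlagChains F V :=
  Finsupp.lmapDomain ℤ ℤ fun t => t.eraseIdx i

@[simp]
theorem eraseFlag_single (i : ℕ) (t : List (Submodule F V)) (c : ℤ) :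
    eraseFlag i (Finsupp.single t c) = Finsupp.single (t.eraseIdx i) c :=
  Finsupp.mapDomain_single

theorem eraseFlag_succ_consTop (i : ℕ) (U : Submodule F V) (x : FlagChains F V) :
    eraseFlag (i + 1) (consTop U x) = consTop U (eraseFlag i x) := by
  have h : eraseFlag (i + 1) ∘ₗ consTop U = consTop U ∘ₗ eraseFlag i :=
    finsupp_linearMap_ext fun t => by simp
  exact LinearMap.congr_fun h x

theorem eraseFlag_zero {x : FlagChains F V} (hx : x [] = 0) :
    eraseFlag 0 x = dropTop F V x := by
  rw [← Finsupp.sum_single x, Finsupp.sum, map_sum, map_sum]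
  refine Finset.sum_congr rfl fun t ht => ?_
  cases t with
  | nil => exact absurd hx (Finsupp.mem_support_iff.1 ht)
  | cons U t => simp

/-- The part of a chain of flags consisting of the flags with top member `H`, which is removed. -/
def belowTop (H : Submodule F V) : FlagChains F V →ₗ[ℤ] FlagChains F V :=
  Finsupp.lcomapDomain (List.cons H) List.cons_injective

theorem belowTop_apply (H : Submodule F V) (x : FlagChains F V) (t : List (Submodule F V)) :
    belowTop H x t = x (H :: t) := rfl

theorem belowTop_single_nil (H : Submodule F V) (c : ℤ) :
    belowTop H (Finsupp.single [] c) = 0 := by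
  ext t
  simp [belowTop_apply]

open scoped Classical in
theorem belowTop_single_cons (H K : Submodule F V) (t : List (Submodule F V)) (c : ℤ) :
    belowTop H (Finsupp.single (K :: t) c) = if K = H then Finsupp.single t c else 0 := by
  ext s
  by_cases h : K = H <;> simp [belowTop_apply, h, Finsupp.single_apply]

theorem eraseFlag_belowTop (H : Submodule F V) (i : ℕ) (x : FlagChains F V) :
    eraseFlag i (belowTop H x) = belowTop H (eraseFlag (i + 1) x) := by
  have h : eraseFlag i ∘ₗ belowTop H = belowTop H ∘ₗ eraseFlag (F := F) (i + 1) := by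
    refine finsupp_linearMap_ext fun t => ?_
    cases t with
    | nil => simp [belowTop_single_nil]
    | cons K t => by_cases h : K = H <;> simp [belowTop_single_cons, h]
  exact LinearMap.congr_fun h x

open scoped Classical in
theorem sum_consTop_belowTop {x : FlagChains F V} (hx : x [] = 0) :
    ∑ H ∈ x.support.image flagTop, consTop H (belowTop H x) = x := by
  have consTop_apply_eq_zero : ∀ {H t}, (∀ s, H :: s ≠ t) → consTop H (belowTop H x) t = 0 :=
    fun {H t} h => Finsupp.mapDomain_of_notMem_range _ _ fun ⟨s, hs⟩ => h s hs
  ext t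
  rw [Finsupp.finsetSum_apply]
  cases t with
  | nil =>
    rw [hx]
    exact Finset.sum_eq_zero fun H _ => consTop_apply_eq_zero fun s => List.cons_ne_nil H s
  | cons K t =>
    have apply_cons : consTop K (belowTop K x) (K :: t) = x (K :: t) :=
      Finsupp.mapDomain_apply List.cons_injective _ _
    rw [Finset.sum_eq_single K, apply_cons]
    · exact fun H _ hHK => consTop_apply_eq_zero fun s hs => hHK (List.cons.inj hs).1
    · intro hK
      rw [apply_cons]
      by_contra h
      exact hK (Finset.mem_image.2 ⟨K :: t, Finsupp.mem_support_iff.2 h, rfl⟩)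

theorem belowTop_mem_supported {n : ℕ} {U : Submodule F V} {x : FlagChains F V}
    (hx : x ∈ Finsupp.supported ℤ ℤ (properFlags (n + 1) U)) (H : Submodule F V) :
    belowTop H x ∈ Finsupp.supported ℤ ℤ (properFlags n H) := fun t ht => by
  rw [Finset.mem_coe, Finsupp.mem_support_iff, belowTop_apply] at ht
  exact (cons_mem_properFlags.1 (hx (Finsupp.mem_support_iff.2 ht))).2

/-- Splitting `z` according to the largest members of its flags presents it as a sum of cycles of
hyperplanes of `U`. -/
theorem consTop_mem_flagCycles [FiniteDimensional F V] {n : ℕ} {U : Submodule F V}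
    {z : FlagChains F V} (hU : Module.finrank F U = n + 1)
    (hz : z ∈ Finsupp.supported ℤ ℤ (properFlags n U)) (herase : ∀ i < n, eraseFlag i z = 0) :
    consTop U z ∈ flagCycles (n + 1) U := by
  rw [mem_flagCycles_succ, dropTop_consTop]
  induction n generalizing U z with
  | zero =>
    have hbot : ⊥ ⋖ U := covBy_of_finrank_eq
      (bot_lt_iff_ne_bot.2 (by rintro rfl; simp at hU)) (by rw [hU, finrank_bot])
    obtain ⟨c, rfl⟩ := eq_single_nil_of_mem_supported hz
    exact ⟨mem_hyperplaneCycles hbot (single_nil_mem_flagCycles_bot c), dropTop_single_nil c, rfl⟩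
  | succ n ih =>
    classical
    have hz0 := apply_nil_of_mem_supported hz
    refine ⟨?_, eraseFlag_zero hz0 ▸ herase 0 n.succ_pos, rfl⟩
    rw [← sum_consTop_belowTop hz0]
    refine Submodule.sum_mem _ fun H hH => ?_
    obtain ⟨_ | ⟨H, t⟩, ht, rfl⟩ := Finset.mem_image.1 hH
    · exact absurd hz0 (Finsupp.mem_support_iff.1 ht)
    have hrank := finrank_of_cons_mem_properFlags hU (hz ht)
    refine mem_hyperplaneCycles (H := H)
      (covBy_of_finrank_eq (cons_mem_properFlags.1 (hz ht)).1 (by rw [hU, hrank])) ?_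
    rw [mem_flagCycles_succ, flagTop, List.headD_cons, dropTop_consTop]
    refine ih hrank (belowTop_mem_supported hz H) fun i hi => ?_
    rw [eraseFlag_belowTop, herase (i + 1) (by omega), map_zero]

theorem hyperplaneCycles_le_supported_properFlags (n : ℕ) (U : Submodule F V) :
    hyperplaneCycles n U ≤ Finsupp.supported ℤ ℤ (properFlags n U) := by
  induction n generalizing U with
  | zero =>
    refine hyperplaneCycles_le fun H hH y hy => ?_
    obtain ⟨c, rfl⟩ := exists_eq_single_of_mem_flagCycles_zero hy
    exact Finsupp.single_mem_supported ℤ c (by simp [(bot_le.trans_lt hH.lt).ne'])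
  | succ n ih =>
    classical
    refine hyperplaneCycles_le fun H hH y hy => ?_
    rw [← (mem_flagCycles_succ.1 hy).2.2]
    intro t ht
    obtain ⟨s, hs, rfl⟩ := Finset.mem_image.1 (Finsupp.mapDomain_support ht)
    exact cons_mem_properFlags.2 ⟨hH.lt, ih H (dropTop_mem_hyperplaneCycles hy) hs⟩

theorem dropTop_mem_supported {n : ℕ} {U : Submodule F V} {x : FlagChains F V}
    (hx : x ∈ flagCycles (n + 1) U) : dropTop F V x ∈ Finsupp.supported ℤ ℤ (properFlags n U) :=
  hyperplaneCycles_le_supported_properFlags n U (dropTop_mem_hyperplaneCycles hx)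

theorem eraseFlag_dropTop {n : ℕ} {U : Submodule F V} {x : FlagChains F V}
    (hx : x ∈ flagCycles (n + 1) U) {i : ℕ} (hi : i < n) : eraseFlag i (dropTop F V x) = 0 := by
  induction i generalizing n U x with
  | zero =>
    obtain ⟨n, rfl⟩ := Nat.exists_eq_succ_of_ne_zero hi.ne'
    rw [eraseFlag_zero (apply_nil_of_mem_supported (dropTop_mem_supported hx)),
      dropTop_dropTop hx]
  | succ i ih =>
    obtain ⟨n, rfl⟩ := Nat.exists_eq_succ_of_ne_zero (Nat.ne_zero_of_lt hi)
    have h : Set.EqOn (eraseFlag (i + 1)) (0 : FlagChains F V →ₗ[ℤ] FlagChains F V)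
        (hyperplaneCycles (n + 1) U) := by
      refine eqOn_hyperplaneCycles fun H _ y hy => ?_
      rw [← (mem_flagCycles_succ.1 hy).2.2, eraseFlag_succ_consTop, ih hy (by omega), map_zero,
        LinearMap.zero_apply]
    exact h (dropTop_mem_hyperplaneCycles hx)

end Faces

section Comparison

variable {F : Type*} [Field F] {V : Type*} [AddCommGroup V] [Module F V]

/-- The members of a simplex of the Tits building, the largest one first. -/
def simplexToList {q : ℕ} (s : Simplices F V q) : List (Submodule F V) :=
  List.ofFn fun i : Fin q => (s i.rev).1

theorem simplexToList_injective (q : ℕ) :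
    Function.Injective (simplexToList : Simplices F V q → List (Submodule F V)) := by
  intro s t h
  ext i : 2
  simpa using congrFun (List.ofFn_injective h) i.rev

theorem simplexToList_mapSimplex (g : V ≃ₗ[F] V) {q : ℕ} (s : Simplices F V q) :
    simplexToList (mapSimplex g s) =
      (simplexToList s).map (Submodule.map (g : V →ₗ[F] V)) := by
  rw [simplexToList, simplexToList, List.map_ofFn]
  rfl

/-- The `j`-th member from below is the one with index `q - 1 - j` from above. -/
theorem simplexToList_face {q : ℕ} (j : Fin q) (s : Simplices F V q) :
    simplexToList (face j s) = (simplexToList s).eraseIdx j.rev := by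
  apply List.ext_getElem
  · rw [List.length_eraseIdx_of_lt (by simp [simplexToList, j.pos])]
    simp [simplexToList]
  intro i h1 h2
  have hi : i < q - 1 := by simpa [simplexToList] using h1
  rw [List.getElem_eraseIdx]
  simp only [simplexToList, List.getElem_ofFn]
  split_ifs with h
  · rw [face_apply_ge _ _ _ (by simp [Fin.rev] at h ⊢; omega)]
    congr 2
    ext
    simp [Fin.rev]
    omega
  · rw [face_apply_lt _ _ _ (by simp [Fin.rev] at h ⊢; omega)]
    congr 2
    ext
    simp [Fin.rev]
    omega

theorem range_simplexToList [Nontrivial V] (q : ℕ) :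
    Set.range (simplexToList : Simplices F V q → List (Submodule F V)) = properFlags q ⊤ := by
  ext t
  have htop : (⊥ : Submodule F V) < ⊤ := bot_lt_top
  simp only [properFlags, List.isChain_iff_pairwise, List.pairwise_cons, List.pairwise_append,
    List.mem_append, List.mem_singleton, Set.mem_ofPred_eq, Set.mem_range]
  constructor
  · rintro ⟨s, rfl⟩
    have hmem : ∀ W ∈ simplexToList s, ⊥ < W ∧ W < ⊤ := by
      intro W hW
      obtain ⟨i, rfl⟩ := List.mem_ofFn.1 hW
      exact ⟨bot_lt_iff_ne_bot.2 (s i.rev).2.1, lt_top_iff_ne_top.2 (s i.rev).2.2⟩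
    have hpair : (simplexToList s).Pairwise (· > ·) :=
      List.pairwise_ofFn.2 fun i j hij => s.strictMono (Fin.rev_lt_rev.2 hij)
    refine ⟨List.length_ofFn, ?_, hpair, ⟨by simp, List.Pairwise.nil⟩, ?_⟩
    · rintro W (hW | rfl)
      exacts [(hmem W hW).2, htop]
    · rintro W hW _ rfl
      exact (hmem W hW).1
  · rintro ⟨rfl, h1, h2, -, h3⟩
    refine ⟨OrderEmbedding.ofStrictMono (fun i => ⟨t.get i.rev,
      (h3 _ (t.get_mem _) ⊥ rfl).ne', (h1 _ (.inl (t.get_mem _))).ne⟩) ?_, ?_⟩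
    · exact fun i j hij => List.pairwise_iff_get.1 h2 _ _ (Fin.rev_lt_rev.2 hij)
    · refine (congrArg List.ofFn (funext fun i => ?_)).trans (List.ofFn_get t)
      exact congrArg t.get (Fin.rev_rev i)

/-- A simplicial chain of the Tits building as a chain on flags, without the whole space. -/
def chainsToFlagChains (q : ℕ) : Chains F V q →ₗ[ℤ] FlagChains F V :=
  Finsupp.lmapDomain ℤ ℤ simplexToList

@[simp]
theorem chainsToFlagChains_single {q : ℕ} (s : Simplices F V q) (c : ℤ) :
    chainsToFlagChains q (Finsupp.single s c) = Finsupp.single (simplexToList s) c :=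
  Finsupp.mapDomain_single

theorem chainsToFlagChains_injective (q : ℕ) :
    Function.Injective (chainsToFlagChains q : Chains F V q → FlagChains F V) :=
  Finsupp.mapDomain_injective (simplexToList_injective q)

theorem flagPairing_chainsToFlagChains {q : ℕ} (x y : Chains F V q) :
    flagPairing F V (chainsToFlagChains q x) (chainsToFlagChains q y) =
      chainPairing F V q x y := by
  classical
  have h : (flagPairing F V).compl₁₂ (chainsToFlagChains q) (chainsToFlagChains q) =
      chainPairing F V q :=
    finsupp_linearMap_ext fun s => finsupp_linearMap_ext fun t => by
      simp [flagPairing_single, chainPairing, Finsupp.single_apply,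
        (simplexToList_injective q).eq_iff, eq_comm]
  exact LinearMap.congr_fun₂ h x y

theorem chainsToFlagChains_mapChains (g : V ≃ₗ[F] V) {q : ℕ} (x : Chains F V q) :
    chainsToFlagChains q (mapChains g q x) = flagMap g (chainsToFlagChains q x) := by
  have h : chainsToFlagChains q ∘ₗ mapChains g q = flagMap g ∘ₗ chainsToFlagChains q :=
    finsupp_linearMap_ext fun s => by simp [mapChains, simplexToList_mapSimplex]
  exact LinearMap.congr_fun h x

theorem chainsToFlagChains_face {q : ℕ} (j : Fin q) (x : Chains F V q) :
    chainsToFlagChains (q - 1) (Finsupp.mapDomain (face j) x) =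
      eraseFlag j.rev (chainsToFlagChains q x) := by
  have h : chainsToFlagChains (q - 1) ∘ₗ Finsupp.lmapDomain ℤ ℤ (face j) =
      eraseFlag j.rev ∘ₗ chainsToFlagChains (F := F) (V := V) q :=
    finsupp_linearMap_ext fun s => by simp [simplexToList_face]
  exact LinearMap.congr_fun h x

theorem consTop_chainsToFlagChains_mem [FiniteDimensional F V] {n : ℕ}
    (hV : Module.finrank F V = n + 1) {x : Chains F V n} (hx : x ∈ Cycles F V n) :
    consTop ⊤ (chainsToFlagChains n x) ∈ flagCycles (n + 1) ⊤ := by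
  have := Module.nontrivial_of_finrank_pos (R := F) (M := V) (by omega)
  refine consTop_mem_flagCycles (by rw [finrank_top, hV]) ?_ fun i hi => ?_
  · classical
    rw [← range_simplexToList]
    intro t ht
    obtain ⟨s, -, rfl⟩ := Finset.mem_image.1 (Finsupp.mapDomain_support ht)
    exact ⟨s, rfl⟩
  · have h := chainsToFlagChains_face (Fin.rev ⟨i, hi⟩) x
    rwa [face_eq_zero hV hx, map_zero, Fin.rev_rev, eq_comm] at h

theorem exists_consTop_chainsToFlagChains_eq [Nontrivial V] {n : ℕ} {y : FlagChains F V}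
    (hy : y ∈ flagCycles (n + 1) ⊤) :
    ∃ x ∈ Cycles F V n, consTop ⊤ (chainsToFlagChains n x) = y := by
  obtain ⟨x, hxy⟩ : ∃ x, chainsToFlagChains n x = dropTop F V y :=
    ⟨_, Finsupp.mapDomain_comapDomain _ (simplexToList_injective n) _ <| by
      rw [range_simplexToList]
      exact dropTop_mem_supported hy⟩
  refine ⟨x, mem_cycles_of_face fun j => chainsToFlagChains_injective (n - 1) ?_, ?_⟩
  · rw [chainsToFlagChains_face, hxy, eraseFlag_dropTop hy j.rev.2, map_zero]
  · rw [hxy, (mem_flagCycles_succ.1 hy).2.2]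

end Comparison

section CoinvariantsOfSteinberg

variable (F : Type*) [Field F]

/-- The Steinberg module of `F^(n+1)` as a group of chains on complete flags; its image consists
of the `flagCycles` of the whole space. -/
def stToFlagChains (n : ℕ) : St F n →ₗ[ℤ] FlagChains F (Fin (n + 1) → F) :=
  consTop ⊤ ∘ₗ chainsToFlagChains n ∘ₗ (Cycles F (Fin (n + 1) → F) n).subtype

theorem stToFlagChains_injective (n : ℕ) : Function.Injective (stToFlagChains F n) :=
  (Finsupp.mapDomain_injective List.cons_injective).comp
    ((chainsToFlagChains_injective n).comp Subtype.val_injective)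

theorem stToFlagChains_mem {n : ℕ} (x : St F n) : stToFlagChains F n x ∈ flagCycles (n + 1) ⊤ :=
  consTop_chainsToFlagChains_mem (by simp) x.2

theorem exists_stToFlagChains_eq {n : ℕ} {y : FlagChains F (Fin (n + 1) → F)}
    (hy : y ∈ flagCycles (n + 1) ⊤) : ∃ x, stToFlagChains F n x = y := by
  obtain ⟨x, hx, rfl⟩ := exists_consTop_chainsToFlagChains_eq hy
  exact ⟨(⟨x, hx⟩ : Cycles F (Fin (n + 1) → F) n), rfl⟩

theorem stToFlagChains_stRep {n : ℕ} (g : GLn F (n + 1)) (x : St F n) :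
    stToFlagChains F n (stRep F n g x) = flagMap g (stToFlagChains F n x) := by
  have h : consTop ⊤ (chainsToFlagChains n (mapChains g n x.1)) =
      flagMap g (consTop ⊤ (chainsToFlagChains n x.1)) := by
    rw [chainsToFlagChains_mapChains, flagMap_consTop, Submodule.map_top, LinearEquiv.range]
  exact h

theorem stPairing_eq {n : ℕ} (x y : St F n) :
    stPairing F n x y = flagPairing F _ (stToFlagChains F n x) (stToFlagChains F n y) :=
  ((flagPairing_consTop _ _ _).trans (flagPairing_chainsToFlagChains x.1 y.1)).symm

/-- The tensor square of `stToFlagChains`. -/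
def stSqToFlagChains (n : ℕ) : StSq F n →ₗ[ℤ]
    FlagChains F (Fin (n + 1) → F) ⊗[ℤ] FlagChains F (Fin (n + 1) → F) :=
  TensorProduct.map (stToFlagChains F n) (stToFlagChains F n)

theorem stSqToFlagChains_injective (n : ℕ) : Function.Injective (stSqToFlagChains F n) := by
  have : Module.Flat ℤ (St F n) := inferInstanceAs (Module.Flat ℤ (Cycles F (Fin (n + 1) → F) n))
  exact TensorProduct.map_injective_of_flat_flat _ _ (stToFlagChains_injective F n)
    (stToFlagChains_injective F n)

/-- The submodule by which the tensors of chains of flags have to be divided in order to contain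
the coinvariants `Coinv F n`. -/
def coinvRelations (n : ℕ) : Submodule ℤ
    (FlagChains F (Fin (n + 1) → F) ⊗[ℤ] FlagChains F (Fin (n + 1) → F)) :=
  (LinearMap.ker (Coinv.mk F n)).map (stSqToFlagChains F n)

theorem stSqToFlagChains_mem_coinvRelations {n : ℕ} {z : StSq F n} :
    stSqToFlagChains F n z ∈ coinvRelations F n ↔ Coinv.mk F n z = 0 := by
  rw [coinvRelations, ← LinearMap.mem_ker, ← SetLike.mem_coe, Submodule.map_coe,
    (stSqToFlagChains_injective F n).mem_set_image, SetLike.mem_coe]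

theorem coinv_mk_surjective (n : ℕ) : Function.Surjective (Coinv.mk F n) :=
  Representation.Coinvariants.mk_surjective (stSqRep F n)

theorem coinv_mk_tmul_stRep {n : ℕ} (g : GLn F (n + 1)) (x y : St F n) :
    Coinv.mk F n (StSq.tmul (stRep F n g x) (stRep F n g y)) = Coinv.mk F n (StSq.tmul x y) :=
  Representation.Coinvariants.mk_self_apply (stSqRep F n) g (StSq.tmul x y)

theorem isEquivariantForm_mkQ_coinvRelations (n : ℕ) :
    IsEquivariantForm (n + 1) fun (_ : Submodule F (Fin (n + 1) → F)) _ =>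
      (TensorProduct.mk ℤ _ _).compr₂ (coinvRelations F n).mkQ := by
  intro g U w hU _ x hx y hy
  obtain rfl : U = ⊤ := Submodule.eq_top_of_finrank_eq (by simp [hU])
  obtain ⟨a, rfl⟩ := exists_stToFlagChains_eq F hx
  obtain ⟨b, rfl⟩ := exists_stToFlagChains_eq F hy
  have h : stSqToFlagChains F n (StSq.tmul (stRep F n g a) (stRep F n g b) - StSq.tmul a b) ∈
      coinvRelations F n := by
    rw [stSqToFlagChains_mem_coinvRelations, map_sub, coinv_mk_tmul_stRep, sub_self]
  rw [← stToFlagChains_stRep, ← stToFlagChains_stRep]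
  rw [map_sub] at h
  exact (Submodule.Quotient.eq _).2 h

variable [Infinite F]

theorem coinvPairing_injective (n : ℕ) : Function.Injective (coinvPairing F n) := by
  obtain ⟨c, hc⟩ := exists_isGenericMultiple (isEquivariantForm_mkQ_coinvRelations F n) (by simp)
  have mkQ_eq (z : StSq F n) : (coinvRelations F n).mkQ (stSqToFlagChains F n z) =
      coinvPairing F n (Coinv.mk F n z) • c := by
    induction z using stSq_induction with
    | h0 => simp
    | ha x y hx hy => simp only [map_add, add_smul, hx, hy]
    | ht a b =>
      obtain ⟨_, h⟩ :=
        (hc ⊤ (by simp) _ (stToFlagChains_mem F a) _ (stToFlagChains_mem F b)).exists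
      rwa [← stPairing_eq] at h
  refine (injective_iff_map_eq_zero _).2 fun z hz => ?_
  obtain ⟨z, rfl⟩ := coinv_mk_surjective F n z
  have h := mkQ_eq z
  rw [hz, zero_smul, Submodule.mkQ_apply, Submodule.Quotient.mk_eq_zero] at h
  exact (stSqToFlagChains_mem_coinvRelations F).1 h

theorem coinvPairing_surjective (n : ℕ) : Function.Surjective (coinvPairing F n) := by
  obtain ⟨x, hx, y, hy, h⟩ := exists_flagPairing_eq_one (F := F) (V := Fin (n + 1) → F)
    (n := n + 1) (U := ⊤) (by simp)
  obtain ⟨a, rfl⟩ := exists_stToFlagChains_eq F hx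
  obtain ⟨b, rfl⟩ := exists_stToFlagChains_eq F hy
  intro c
  refine ⟨c • Coinv.mk F n (StSq.tmul a b), ?_⟩
  rw [map_smul, coinvPairing_mk_tmul, stPairing_eq, h, smul_eq_mul, mul_one]

theorem coinvPairing_bijective (n : ℕ) : Function.Bijective (coinvPairing F n) :=
  ⟨coinvPairing_injective F n, coinvPairing_surjective F n⟩

end CoinvariantsOfSteinberg

section PairingOfProducts

variable {F : Type*} [Field F] {V W : Type*} [AddCommGroup V] [Module F V]
  [AddCommGroup W] [Module F W]

theorem exists_card_filter_lt_eq {N : ℕ} (T : Finset (Fin N)) {c : ℕ} (hc : c ≤ T.card) :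
    ∃ k ≤ N, (T.filter fun i : Fin N => i.1 < k).card = c := by
  suffices ∀ n ≤ N, c ≤ (T.filter fun i : Fin N => i.1 < n).card →
      ∃ k ≤ n, (T.filter fun i : Fin N => i.1 < k).card = c from
    this N le_rfl (by rwa [Finset.filter_true_of_mem fun i _ => i.2])
  intro n hn hcn
  induction n with
  | zero => exact ⟨0, le_rfl, by simp_all⟩
  | succ n ih =>
    rw [card_filter_succ T n hn] at hcn
    by_cases h : c ≤ (T.filter fun i : Fin N => i.1 < n).card
    · obtain ⟨k, hk, e⟩ := ih (by omega) h
      exact ⟨k, by omega, e⟩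
    · refine ⟨n + 1, le_rfl, ?_⟩
      rw [card_filter_succ T n hn]
      split_ifs at hcn ⊢ <;> omega

namespace Shuffle

variable {m n : ℕ} (S : Shuffle m n)

theorem left_zero : S.left 0 = 0 := by simp [left]

theorem right_zero : S.right 0 = 0 := by simp [right]

theorem left_total : S.left (m + n) = m := by
  rw [left, Finset.filter_true_of_mem fun i _ => i.2, S.2]

theorem right_total : S.right (m + n) = n := by
  have := S.left_add_right (m + n) le_rfl
  rw [S.left_total] at this
  omega

theorem exists_left_eq {c : ℕ} (hc : c ≤ m) : ∃ k ≤ m + n, S.left k = c :=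
  exists_card_filter_lt_eq S.1 (hc.trans S.2.ge)

theorem exists_right_eq {c : ℕ} (hc : c ≤ n) : ∃ k ≤ m + n, S.right k = c :=
  exists_card_filter_lt_eq S.1ᶜ <| hc.trans_eq <| by
    rw [Finset.card_compl, S.2, Fintype.card_fin, Nat.add_sub_cancel_left]

variable {S} in
theorem ext_left {T : Shuffle m n} (h : ∀ k ≤ m + n, S.left k = T.left k) : S = T := by
  ext i
  have h1 := S.left_succ i.1 i.2
  have h2 := T.left_succ i.1 i.2
  rw [h i.1 i.2.le, h (i.1 + 1) i.2, h2] at h1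
  by_cases hS : i ∈ S.1 <;> by_cases hT : i ∈ T.1 <;> simp_all

theorem sign_mul_self : S.sign * S.sign = 1 := by
  rw [sign, mul_mul_mul_comm, ← mul_pow, ← mul_pow]
  norm_num

end Shuffle

theorem finrank_flag [FiniteDimensional F V] {q : ℕ} (hq : Module.finrank F V = q + 1)
    (s : Simplices F V q) {c : ℕ} (hc : c ≤ q + 1) : Module.finrank F (flag s c) = c := by
  rcases c with _ | c
  · exact finrank_bot F V
  · by_cases h : c < q
    · rw [show flag s (c + 1) = (s ⟨c, h⟩).1 from dif_pos h]
      exact finrank_eq hq s ⟨c, h⟩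
    · rw [show flag s (c + 1) = ⊤ from dif_neg h, finrank_top]
      omega

theorem flag_injective {q : ℕ} {s s' : Simplices F V q}
    (h : ∀ c ≤ q + 1, flag s c = flag s' c) : s = s' := by
  ext i : 2
  simpa [flag] using h (i.1 + 1) (by omega)

theorem prod_eq_prod_iff {P P' : Submodule F V} {Q Q' : Submodule F W} :
    P.prod Q = P'.prod Q' ↔ P = P' ∧ Q = Q' := by
  refine ⟨fun h => ⟨?_, ?_⟩, fun ⟨hP, hQ⟩ => hP ▸ hQ ▸ rfl⟩
  · rw [← Submodule.prod_map_fst P Q, h, Submodule.prod_map_fst]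
  · rw [← Submodule.prod_map_snd P Q, h, Submodule.prod_map_snd]

section MulSimplex

variable {a b : ℕ} {hV : (⊥ : Submodule F V) ≠ ⊤} {hW : (⊥ : Submodule F W) ≠ ⊤}
  {S S' : Shuffle (a + 1) (b + 1)} {s s' : Simplices F V a} {t t' : Simplices F W b}

theorem flag_eq_of_mulSimplex_eq (h : mulSimplex hV hW S s t = mulSimplex hV hW S' s' t') {k : ℕ}
    (hk : k ≤ a + 1 + (b + 1)) :
    flag s (S.left k) = flag s' (S'.left k) ∧ flag t (S.right k) = flag t' (S'.right k) := by
  rcases k with _ | k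
  · simp only [Shuffle.left_zero, Shuffle.right_zero, flag, and_self]
  rcases hk.eq_or_lt with hk | hk
  · simp only [hk, Shuffle.left_total, Shuffle.right_total, flag_last, and_self]
  · have := congrArg Subtype.val (DFunLike.congr_fun h ⟨k, by omega⟩)
    rwa [mulSimplex_apply, mulSimplex_apply, prod_eq_prod_iff] at this

theorem mulSimplex_eq_iff [FiniteDimensional F V] (ha : Module.finrank F V = a + 1) :
    mulSimplex hV hW S s t = mulSimplex hV hW S' s' t' ↔ S = S' ∧ s = s' ∧ t = t' := by
  refine ⟨fun h => ?_, fun ⟨hS, hs, ht⟩ => hS ▸ hs ▸ ht ▸ rfl⟩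
  obtain rfl : S = S' := Shuffle.ext_left fun k hk => by
    rw [← finrank_flag ha s (S.left_le k), (flag_eq_of_mulSimplex_eq h hk).1,
      finrank_flag ha s' (S'.left_le k)]
  refine ⟨rfl, flag_injective fun c hc => ?_, flag_injective fun c hc => ?_⟩
  · obtain ⟨k, hk, rfl⟩ := S.exists_left_eq hc
    exact (flag_eq_of_mulSimplex_eq h hk).1
  · obtain ⟨k, hk, rfl⟩ := S.exists_right_eq hc
    exact (flag_eq_of_mulSimplex_eq h hk).2

end MulSimplex

open scoped Classical in
theorem chainPairing_single (q : ℕ) (s t : Simplices F V q) (a b : ℤ) :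
    chainPairing F V q (Finsupp.single s a) (Finsupp.single t b) = if s = t then a * b else 0 := by
  simp [chainPairing, Finsupp.single_apply, eq_comm]

theorem chainPairing_mapChains (e : V ≃ₗ[F] W) (q : ℕ) (x y : Chains F V q) :
    chainPairing F W q (mapChains e q x) (mapChains e q y) = chainPairing F V q x y := by
  have hinj : Function.Injective (mapSimplex e : Simplices F V q → Simplices F W q) :=
    fun s t h => DFunLike.ext s t fun i => (mapBuilding e).injective (DFunLike.congr_fun h i)
  induction x using Finsupp.induction_linear with
  | zero => simp
  | add f g hf hg => simp only [map_add, LinearMap.add_apply, hf, hg]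
  | single s r =>
    induction y using Finsupp.induction_linear with
    | zero => simp
    | add f g hf hg => simp only [map_add, hf, hg]
    | single t c =>
      simp only [mapChains, Finsupp.lmapDomain_apply, Finsupp.mapDomain_single,
        chainPairing_single, hinj.eq_iff]

section MulChains

variable [FiniteDimensional F V] {a b : ℕ} (ha : Module.finrank F V = a + 1)
  (hV : (⊥ : Submodule F V) ≠ ⊤) (hW : (⊥ : Submodule F W) ≠ ⊤)
include ha

open scoped Classical in
/-- For equal flags only the diagonal pairs of shuffles contribute, and `S.sign * S.sign = 1`. -/
theorem chainPairing_sum_mulSimplex (s s' : Simplices F V a) (t t' : Simplices F W b) :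
    chainPairing F (V × W) (a + 1 + b)
        (∑ S : Shuffle (a + 1) (b + 1), Finsupp.single (mulSimplex hV hW S s t) S.sign)
        (∑ S : Shuffle (a + 1) (b + 1), Finsupp.single (mulSimplex hV hW S s' t') S.sign) =
      (a + 1 + (b + 1)).choose (a + 1) * if s = s' ∧ t = t' then 1 else 0 := by
  simp only [map_sum, LinearMap.sum_apply, chainPairing_single, mulSimplex_eq_iff ha]
  by_cases h : s = s' ∧ t = t'
  · simp [h, Shuffle.sign_mul_self]
  · simp [h]

theorem chainPairing_mulChains (x x' : Chains F V a) (y y' : Chains F W b) :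
    chainPairing F (V × W) (a + 1 + b) (mulChains hV hW x y) (mulChains hV hW x' y') =
      (a + 1 + (b + 1)).choose (a + 1) * (chainPairing F V a x x' * chainPairing F W b y y') := by
  induction x using Finsupp.induction_linear with
  | zero => simp
  | add f g hf hg => simp only [map_add, LinearMap.add_apply, hf, hg]; ring
  | single s p =>
  induction y using Finsupp.induction_linear with
  | zero => simp
  | add f g hf hg => simp only [map_add, LinearMap.add_apply, hf, hg]; ring
  | single t r =>
  induction x' using Finsupp.induction_linear with
  | zero => simp
  | add f g hf hg => simp only [map_add, LinearMap.add_apply, hf, hg]; ring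
  | single s' p' =>
  induction y' using Finsupp.induction_linear with
  | zero => simp
  | add f g hf hg => simp only [map_add, hf, hg]; ring
  | single t' r' =>
  simp only [mulChains_single, map_smul, LinearMap.smul_apply, chainPairing_sum_mulSimplex ha,
    chainPairing_single, smul_eq_mul]
  split_ifs <;> simp_all
  ring

end MulChains

end PairingOfProducts

section Structure

variable (F : Type*) [Field F]

theorem stPairing_stMul (m n : ℕ) (a b : St F m) (c d : St F n) :
    stPairing F (m + 1 + n) (stMul F m n a c) (stMul F m n b d) =
      (m + 1 + (n + 1)).choose (m + 1) * (stPairing F m a b * stPairing F n c d) :=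
  (chainPairing_mapChains (sumEquiv F m n) (m + 1 + n) _ _).trans <|
    chainPairing_mulChains (by simp) (bot_ne_top' F m) (bot_ne_top' F n) a.1 b.1 c.1 d.1

theorem coinvPairing_coinvSqMul (m n : ℕ) (x : Coinv F m) (y : Coinv F n) :
    coinvPairing F (m + 1 + n) (coinvSqMul F m n x y) = (-1) ^ ((m + 1) * (n + 1)) *
      ((m + 1 + (n + 1)).choose (m + 1) * (coinvPairing F m x * coinvPairing F n y)) := by
  obtain ⟨x, rfl⟩ := coinv_mk_surjective F m x
  obtain ⟨y, rfl⟩ := coinv_mk_surjective F n y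
  rw [coinvSqMul_mk]
  induction x using stSq_induction with
  | h0 => simp
  | ha x x' hx hx' => simp only [map_add, LinearMap.add_apply, hx, hx']; ring
  | ht a b =>
    induction y using stSq_induction with
    | h0 => simp
    | ha x x' hx hx' => simp only [map_add, hx, hx']; ring
    | ht c d =>
      rw [stSqMul_tmul, map_smul, map_smul, coinvPairing_mk_tmul, coinvPairing_mk_tmul,
        coinvPairing_mk_tmul, stPairing_stMul, smul_eq_mul]

theorem neg_one_pow_triangle_mul (m n : ℕ) :
    (-1 : ℤ) ^ ((m + 1) * (n + 1)) * ((-1) ^ ((m + 1) * m / 2) * (-1) ^ ((n + 1) * n / 2)) =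
      (-1) ^ ((m + 1 + n + 1) * (m + 1 + n) / 2) := by
  rw [← pow_add, ← pow_add]
  congr 1
  have triangle (k : ℕ) : (k + 1) * k / 2 * 2 = (k + 1) * k :=
    Nat.div_mul_cancel (by rw [mul_comm]; exact (Nat.even_mul_succ_self k).two_dvd)
  have hadd : (m + 1 + n + 1) * (m + 1 + n) =
      (m + 1) * m + (n + 1) * n + 2 * ((m + 1) * (n + 1)) := by ring
  have := triangle m
  have := triangle n
  have := triangle (m + 1 + n)
  omega

end Structure

section BaseChangeOfCoinvariants

variable (k : Type*) [CommRing k] (F : Type*) [Field F]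

/-- The `k`-linear form on `St²_k(F^(n+1))_{GL(F^(n+1))}` induced by the bilinear form on the
Steinberg module; it detects that the image of `γ_n` is not a torsion element. -/
def coinvOverPairing (n : ℕ) : CoinvOver k F n →ₗ[k] k :=
  Representation.Coinvariants.lift (stSqOverRep k F n)
    ((TensorProduct.AlgebraTensorModule.rid ℤ k k).toLinearMap ∘ₗ
      (coinvPairing F n ∘ₗ Coinv.mk F n).baseChange k) fun g => by
    ext z
    have hinv : Coinv.mk F n (stSqRep F n g z) = Coinv.mk F n z :=
      Representation.Coinvariants.mk_self_apply (stSqRep F n) g z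
    simp [stSqOverRep_tmul, hinv]

theorem coinvOverPairing_coinvBaseChange (n : ℕ) (x : Coinv F n) :
    coinvOverPairing k F n (coinvBaseChange k F n x) = (coinvPairing F n x : k) := by
  obtain ⟨x, rfl⟩ := coinv_mk_surjective F n x
  change TensorProduct.AlgebraTensorModule.rid ℤ k k
    ((coinvPairing F n ∘ₗ Coinv.mk F n).baseChange k (1 ⊗ₜ x)) = _
  rw [LinearMap.baseChange_tmul, TensorProduct.AlgebraTensorModule.rid_tmul, zsmul_one,
    LinearMap.comp_apply]

theorem coinvOverMul_coinvBaseChange (m n : ℕ) (x : Coinv F m) (y : Coinv F n) :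
    coinvOverMul k F m n (coinvBaseChange k F m x) (coinvBaseChange k F n y) =
      coinvBaseChange k F (m + 1 + n) (coinvSqMul F m n x y) := by
  obtain ⟨x, rfl⟩ := coinv_mk_surjective F m x
  obtain ⟨y, rfl⟩ := coinv_mk_surjective F n y
  rw [coinvSqMul_mk, coinvBaseChange_mk, coinvBaseChange_mk, coinvBaseChange_mk, coinvOverMul_mk,
    stSqOverMul_tmul, mul_one]

variable {F} in
theorem toSpanSingleton_coinvBaseChange_surjective {n : ℕ} {c : Coinv F n}
    (hc : Function.Surjective (LinearMap.toSpanSingleton ℤ _ c)) :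
    Function.Surjective (LinearMap.toSpanSingleton k _ (coinvBaseChange k F n c)) := by
  intro x
  obtain ⟨x, rfl⟩ : ∃ x', CoinvOver.mk k F n x' = x :=
    Representation.Coinvariants.mk_surjective (stSqOverRep k F n) x
  simp only [LinearMap.toSpanSingleton_apply]
  induction x using TensorProduct.induction_on with
  | zero => exact ⟨0, by simp⟩
  | add x y hx hy =>
    obtain ⟨s, hs⟩ := hx
    obtain ⟨t, ht⟩ := hy
    exact ⟨s + t, by rw [map_add, ← hs, ← ht, add_smul]⟩
  | tmul a z =>
    obtain ⟨t, ht⟩ := hc (Coinv.mk F n z)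
    have ha : a ⊗ₜ[ℤ] z = a • ((1 : k) ⊗ₜ[ℤ] z) := by
      rw [TensorProduct.smul_tmul', smul_eq_mul, mul_one]
    refine ⟨a * t, ?_⟩
    rw [ha, map_smul, ← coinvBaseChange_mk, ← ht, LinearMap.toSpanSingleton_apply, map_zsmul,
      mul_smul, Int.cast_smul_eq_zsmul]

end BaseChangeOfCoinvariants

section DividedPowers

open Submodule

variable {k : Type*} [CommRing k]

theorem span_range_dp_eq_top {M : Type*} [AddCommGroup M] [Module k M] {m : M}
    (hm : span k {m} = ⊤) :
    span k (Set.range fun n => DividedPowerAlgebra.dp k n m) = ⊤ := by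
  have hspan := DividedPowerAlgebra.submodule_span_prod_dp_eq_top (R := k)
    (v := fun _ : Unit => m) (by rwa [Set.range_const])
  refine top_unique (hspan.ge.trans (span_mono ?_))
  rintro _ ⟨n, rfl⟩
  exact ⟨n (), by simp [Finsupp.prod_fintype, DividedPowerAlgebra.dp_zero]⟩

variable {A : ℕ → Type*} [∀ n, AddCommGroup (A n)] [∀ n, Module k (A n)]
  {μ : ∀ m n, A m →ₗ[k] A n →ₗ[k] A (m + 1 + n)}

instance : IsScalarTower k (PositivePart A μ) (PositivePart A μ) :=
  ⟨fun c x y => LinearMap.map_smul₂ (directSumMul A μ) c x y⟩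

instance : SMulCommClass k (PositivePart A μ) (PositivePart A μ) :=
  ⟨fun c x y => (map_smul (directSumMul A μ x) c y).symm⟩

theorem PositivePart.linearMap_ext {M : Type*} [AddCommGroup M] [Module k M]
    {f g : PositivePart A μ →ₗ[k] M} (h : ∀ n, f ∘ₗ of A μ n = g ∘ₗ of A μ n) : f = g :=
  DirectSum.linearMap_ext k h

/-- Bases `g n` of the free rank one modules `A n` which multiply like the divided powers
`γ_{n+1}(x)`; as `A n` sits in degree `n + 1`, the structure constant of `g m` and `g n` is
`(m + n + 2).choose (m + 1)`. -/
structure IsDividedPowerSystem (μ : ∀ m n, A m →ₗ[k] A n →ₗ[k] A (m + 1 + n)) (g : ∀ n, A n) :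
    Prop where
  bijective_toSpanSingleton : ∀ n, Function.Bijective (LinearMap.toSpanSingleton k (A n) (g n))
  mul_eq : ∀ m n, μ m n (g m) (g n) = (m + 1 + n + 1).choose (m + 1) • g (m + 1 + n)

namespace IsDividedPowerSystem

variable {g : ∀ n, A n} (h : IsDividedPowerSystem μ g)
include h

theorem of_mul_of (m n : ℕ) :
    PositivePart.of A μ m (g m) * PositivePart.of A μ n (g n) =
      (m + 1 + n + 1).choose (m + 1) • PositivePart.of A μ (m + 1 + n) (g (m + 1 + n)) := by
  rw [PositivePart.of_mul_of, h.mul_eq, map_nsmul]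

theorem linearMap_ext {M : Type*} [AddCommGroup M] [Module k M] {f f' : PositivePart A μ →ₗ[k] M}
    (hf : ∀ n, f (PositivePart.of A μ n (g n)) = f' (PositivePart.of A μ n (g n))) : f = f' := by
  refine PositivePart.linearMap_ext fun n => LinearMap.ext fun a => ?_
  obtain ⟨c, rfl⟩ := (h.bijective_toSpanSingleton n).2 a
  simp [hf]

theorem mul_comm (x y : PositivePart A μ) : x * y = y * x := by
  suffices LinearMap.mul k (PositivePart A μ) = (LinearMap.mul k (PositivePart A μ)).flip from
    LinearMap.congr_fun₂ this x y
  refine h.linearMap_ext fun m => h.linearMap_ext fun n => ?_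
  rw [LinearMap.flip_apply, LinearMap.mul_apply', LinearMap.mul_apply', h.of_mul_of, h.of_mul_of,
    show n + 1 + m = m + 1 + n by omega,
    Nat.choose_symm_of_eq_add (by omega : m + 1 + n + 1 = m + 1 + (n + 1))]

theorem mul_assoc (x y z : PositivePart A μ) : x * y * z = x * (y * z) := by
  let P := PositivePart A μ
  suffices (LinearMap.mul k P).compr₂ (LinearMap.mul k P) =
      ((LinearMap.llcomp k P P P).flip.comp (LinearMap.mul k P)).flip.comp (LinearMap.mul k P) from
    LinearMap.congr_fun (LinearMap.congr_fun₂ this x y) z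
  refine h.linearMap_ext fun l => h.linearMap_ext fun m => h.linearMap_ext fun n => ?_
  change PositivePart.of A μ l (g l) * PositivePart.of A μ m (g m) * PositivePart.of A μ n (g n) =
    PositivePart.of A μ l (g l) * (PositivePart.of A μ m (g m) * PositivePart.of A μ n (g n))
  rw [h.of_mul_of, h.of_mul_of, smul_mul_assoc, mul_smul_comm, h.of_mul_of, h.of_mul_of, smul_smul,
    smul_smul, show l + 1 + (m + 1 + n) = l + 1 + m + 1 + n by omega]
  have hchoose := Nat.choose_mul (n := l + 1 + m + 1 + n + 1) (k := l + 1 + m + 1) (s := l + 1)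
    (by omega)
  rw [show l + 1 + m + 1 + n + 1 - (l + 1) = m + 1 + n + 1 by omega,
    show l + 1 + m + 1 - (l + 1) = m + 1 by omega] at hchoose
  rw [Nat.mul_comm, hchoose, Nat.mul_comm]

/-- The multiplication `directSumMul` of a divided power system is that of a commutative ring. -/
abbrev nonUnitalCommRing : NonUnitalCommRing (PositivePart A μ) where
  mul_assoc := h.mul_assoc
  mul_comm := h.mul_comm

theorem unitization_mul_comm (x y : Unitization k (PositivePart A μ)) : x * y = y * x :=
  let _ := h.nonUnitalCommRing
  _root_.mul_comm x y

theorem unitization_mul_assoc (x y z : Unitization k (PositivePart A μ)) :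
    x * y * z = x * (y * z) :=
  let _ := h.nonUnitalCommRing
  _root_.mul_assoc x y z

omit h

variable (μ g) in
/-- The divided powers `γ_n(x)`, where `x` is the generator `g 0` of degree one. -/
def power : ℕ → Unitization k (PositivePart A μ)
  | 0 => 1
  | n + 1 => Unitization.inr (PositivePart.of A μ n (g n))

theorem linearMap_ext_power (h : IsDividedPowerSystem μ g) {M : Type*} [AddCommGroup M]
    [Module k M] {f f' : Unitization k (PositivePart A μ) →ₗ[k] M}
    (hf : ∀ n, f (power μ g n) = f' (power μ g n)) : f = f' := by
  refine Unitization.linearMap_ext (fun r => ?_) fun a => ?_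
  · rw [← mul_one r, ← smul_eq_mul, Unitization.inl_smul, map_smul, map_smul]
    exact congrArg (r • ·) (hf 0)
  · exact LinearMap.congr_fun (h.linearMap_ext (f := f ∘ₗ Unitization.inrHom k k _)
      (f' := f' ∘ₗ Unitization.inrHom k k _) fun n => hf (n + 1)) a

theorem power_mul_power (h : IsDividedPowerSystem μ g) (m n : ℕ) :
    power μ g m * power μ g n = (m + n).choose m • power μ g (m + n) := by
  rcases m with _ | m
  · rw [power, one_mul, zero_add, Nat.choose_zero_right, one_smul]
  rcases n with _ | n
  · rw [add_zero, Nat.choose_self, one_smul]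
    exact mul_one _
  · rw [power, power, ← Unitization.inr_mul, h.of_mul_of, Unitization.inr_smul,
      show m + 1 + (n + 1) = m + 1 + n + 1 by omega, power]

theorem exists_linearMap_dp_eq_power (h : IsDividedPowerSystem μ g) :
    ∃ f : DividedPowerAlgebra k k →ₗ[k] Unitization k (PositivePart A μ),
      (∀ x y, f (x * y) = f x * f y) ∧ ∀ n, f (DividedPowerAlgebra.dp k n 1) = power μ g n := by
  let _ := h.nonUnitalCommRing
  have hmul (m n : ℕ) (r s : k) :
      r • power μ g m * s • power μ g n = (r * s) • (m + n).choose m • power μ g (m + n) := by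
    rw [smul_mul_smul_comm]
    exact congrArg _ (h.power_mul_power m n)
  let Φ : DividedPowerAlgebra k k →ₐ[k] Unitization k (PositivePart A μ) :=
    DividedPowerAlgebra.lift' (f := fun p : ℕ × k => p.2 ^ p.1 • power μ g p.1)
      (fun m => by rw [pow_zero, one_smul]; rfl)
      (fun n r m => by rw [smul_eq_mul, mul_pow, mul_smul])
      (fun n p m => by rw [hmul, ← pow_add, smul_comm])
      (fun n u v => by
        rw [(Commute.all u v).add_pow', Finset.sum_smul]
        refine Finset.sum_congr rfl fun p hp => ?_
        obtain rfl := Finset.HasAntidiagonal.mem_antidiagonal.1 hp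
        rw [smul_assoc, smul_comm]
        exact (hmul p.1 p.2 (u ^ p.1) (v ^ p.2)).symm)
  refine ⟨Φ.toLinearMap, map_mul Φ, fun n => ?_⟩
  rw [AlgHom.toLinearMap_apply, DividedPowerAlgebra.lift'_apply_dp, one_pow, one_smul]

theorem exists_linearMap_power_eq_dp (h : IsDividedPowerSystem μ g) :
    ∃ f : Unitization k (PositivePart A μ) →ₗ[k] DividedPowerAlgebra k k,
      ∀ n, f (power μ g n) = DividedPowerAlgebra.dp k n 1 := by
  let ε n := LinearEquiv.ofBijective _ (h.bijective_toSpanSingleton n)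
  have hε n : (ε n).symm (g n) = 1 := by
    rw [LinearEquiv.symm_apply_eq]
    exact (one_smul k (g n)).symm
  let ψ : PositivePart A μ →ₗ[k] DividedPowerAlgebra k k :=
    DirectSum.toModule k ℕ _ fun n =>
      LinearMap.toSpanSingleton k _ (DividedPowerAlgebra.dp k (n + 1) 1) ∘ₗ (ε n).symm
  have hψ n : ψ (PositivePart.of A μ n (g n)) = DividedPowerAlgebra.dp k (n + 1) 1 :=
    (DirectSum.toModule_lof k n (g n)).trans (by simp [hε])
  refine ⟨(Algebra.linearMap k _).coprod ψ ∘ₗ (Unitization.linearEquiv k k _).toLinearMap,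
    fun n => ?_⟩
  rcases n with _ | n
  · simp [power, DividedPowerAlgebra.dp_zero, Unitization.linearEquiv, Unitization.addEquiv,
      Unitization.equiv]
  · simp [power, hψ, Unitization.linearEquiv, Unitization.addEquiv, Unitization.equiv]

theorem exists_linearEquiv (h : IsDividedPowerSystem μ g) :
    ∃ e : DividedPowerAlgebra k k ≃ₗ[k] Unitization k (PositivePart A μ),
      e 1 = 1 ∧ (∀ x y, e (x * y) = e x * e y) ∧
      ∀ n : ℕ, e (DividedPowerAlgebra.dp k (n + 1) (1 : k)) =
        Unitization.inr (PositivePart.of A μ n (g n)) := by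
  obtain ⟨f, hmul, hf⟩ := h.exists_linearMap_dp_eq_power
  obtain ⟨f', hf'⟩ := h.exists_linearMap_power_eq_dp
  have hff' : f ∘ₗ f' = .id := h.linearMap_ext_power fun n => by simp [hf, hf']
  have hf'f : f' ∘ₗ f = .id :=
    LinearMap.ext_on_range (span_range_dp_eq_top (Ideal.span_singleton_one (α := k)))
      fun n => by simp [hf, hf']
  refine ⟨LinearEquiv.ofLinearMap f f' hff' hf'f, ?_, hmul, fun n => hf (n + 1)⟩
  rw [← DividedPowerAlgebra.dp_zero (R := k) (m := (1 : k))]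
  exact hf 0

end IsDividedPowerSystem

end DividedPowers

section SteinbergRing

theorem toSpanSingleton_injective_of_isUnit {k M : Type*} [CommRing k] [AddCommGroup M]
    [Module k M] (f : M →ₗ[k] k) {m : M} (hm : IsUnit (f m)) :
    Function.Injective (LinearMap.toSpanSingleton k M m) := fun r s hrs =>
  hm.mul_left_injective (by simpa using congrArg f hrs)

variable (F : Type*) [Field F] [Infinite F] {γ : ∀ n, Coinv F n}
  (hγ : ∀ n, coinvPairing F n (γ n) = (-1) ^ ((n + 1) * n / 2))
include hγ

theorem isDividedPowerSystem_coinv : IsDividedPowerSystem (coinvSqMul F) γ where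
  bijective_toSpanSingleton n := by
    have hunit : IsUnit (coinvPairing F n (γ n)) := hγ n ▸ isUnit_neg_one.pow _
    refine ⟨toSpanSingleton_injective_of_isUnit _ hunit, fun z => ?_⟩
    obtain ⟨c, hc⟩ := hunit.dvd (a := coinvPairing F n z)
    refine ⟨c, coinvPairing_injective F n ?_⟩
    rw [LinearMap.toSpanSingleton_apply, map_smul, hc, smul_eq_mul, mul_comm]
  mul_eq m n := coinvPairing_injective F (m + 1 + n) <| by
    rw [coinvPairing_coinvSqMul, map_nsmul, hγ, hγ, hγ, ← neg_one_pow_triangle_mul, nsmul_eq_mul]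
    ring_nf

theorem isDividedPowerSystem_coinvOver (k : Type*) [CommRing k] :
    IsDividedPowerSystem (coinvOverMul k F) fun n => coinvBaseChange k F n (γ n) where
  bijective_toSpanSingleton n := by
    refine ⟨toSpanSingleton_injective_of_isUnit (coinvOverPairing k F n) ?_,
      toSpanSingleton_coinvBaseChange_surjective k
        ((isDividedPowerSystem_coinv F hγ).bijective_toSpanSingleton n).2⟩
    rw [coinvOverPairing_coinvBaseChange, hγ, Int.cast_pow, Int.cast_neg, Int.cast_one]
    exact isUnit_neg_one.pow _
  mul_eq m n := by
    rw [coinvOverMul_coinvBaseChange, (isDividedPowerSystem_coinv F hγ).mul_eq, map_nsmul]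

end SteinbergRing

end Steinberg

end

theorem mainTheorem8 (F : Type*) [Field F] [Infinite F] :
    (∀ n : ℕ, Function.Bijective (Steinberg.coinvPairing F n)) ∧
    ∃ γ : ∀ n : ℕ, Steinberg.Coinv F n,
      (∀ n : ℕ, Steinberg.coinvPairing F n (γ n) = (-1) ^ ((n + 1) * n / 2)) ∧
      ((∀ x y z : Steinberg.CoinvAlgebra F, x * y * z = x * (y * z)) ∧
        (∀ x y : Steinberg.CoinvAlgebra F, x * y = y * x) ∧
        ∃ e : DividedPowerAlgebra ℤ ℤ ≃ₗ[ℤ] Steinberg.CoinvAlgebra F,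
          e 1 = 1 ∧ (∀ x y, e (x * y) = e x * e y) ∧
          ∀ n : ℕ, e (DividedPowerAlgebra.dp ℤ (n + 1) (1 : ℤ)) =
            Steinberg.CoinvAlgebra.of F n (γ n)) ∧
      ∀ (k : Type*) [CommRing k],
        (∀ x y z : Steinberg.CoinvAlgebraOver F k, x * y * z = x * (y * z)) ∧
        (∀ x y : Steinberg.CoinvAlgebraOver F k, x * y = y * x) ∧
        ∃ e : DividedPowerAlgebra k k ≃ₗ[k] Steinberg.CoinvAlgebraOver F k,
          e 1 = 1 ∧ (∀ x y, e (x * y) = e x * e y) ∧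
          ∀ n : ℕ, e (DividedPowerAlgebra.dp k (n + 1) (1 : k)) =
            Steinberg.CoinvAlgebraOver.of F k n (Steinberg.coinvBaseChange k F n (γ n)) := by
  have hbij := Steinberg.coinvPairing_bijective F
  choose γ hγ using fun n => (hbij n).2 ((-1) ^ ((n + 1) * n / 2))
  have h := Steinberg.isDividedPowerSystem_coinv F hγ
  refine ⟨hbij, γ, hγ, ⟨h.unitization_mul_assoc, h.unitization_mul_comm, h.exists_linearEquiv⟩,
    fun k _ => ?_⟩
  have hk := Steinberg.isDividedPowerSystem_coinvOver F hγ k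
  exact ⟨hk.unitization_mul_assoc, hk.unitization_mul_comm, hk.exists_linearEquiv⟩
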